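/- Let $\alpha,\beta>-1$, $t>0$ and $\theta,\varphi\in[0,\pi]$. Let $\mathcal P_n^{\alpha,\beta}(\theta)$ be the classical Jacobi polynomials $P_n^{(\alpha,\beta)}(\cos\theta)$, normalized in $L^2\big([0,\pi],(\sin\frac\theta2)^{2\alpha+1}(\cos\frac\theta2)^{2\beta+1}d\theta\big)$, and let $$\mathbb H_t^{\alpha,\beta}(\theta,\varphi)=\sum_{n=0}^\infty e^{-t\left(n+\frac{\alpha+\beta+1}2\right)}\mathcal P_n^{\alpha,\beta}(\theta)\mathcal P_n^{\alpha,\beta}(\varphi).$$ Put $c_{\alpha,\beta}=\frac{\Gamma(\alpha+\beta+2)}{2^{\alpha+\beta+1}\Gamma(\alpha+1)\Gamma(\beta+1)}$ and $$\Psi(u,v)=\Psi^{\alpha,\beta}(t,\theta,\varphi,u,v)=\frac{c_{\alpha,\beta}\sinh\frac t2}{\big(\cosh\frac t2-u\sin\frac\theta2\sin\frac\varphi2-v\cos\frac\theta2\cos\frac\varphi2\big)^{\alpha+\beta+2}} .$$ For $\nu>-1$, $\nu\neq-\frac12$ and $|u|<1$ let $$\Pi_\nu(u)=\frac{\Gamma(\nu+1)}{\sqrt\pi\,\Gamma(\nu+1/2)}\int_0^u(1-w^2)^{\nu-1/2}\,dw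 ;$$ for $\nu>-\frac12$ let $d\Pi_\nu$ be the measure on $[-1,1]$ with density $\Pi_\nu'$, and let $d\Pi_{-1/2}=\frac12(\delta_{-1}+\delta_1)$, where $\delta_{\pm1}$ is the point mass at $\pm1$. Then the series defining $\mathbb H_t^{\alpha,\beta}(\theta,\varphi)$ converges absolutely, and, with all double integrals taken over $[-1,1]^2$, the following hold. (i) If $\alpha,\beta\ge-\frac12$, then $\displaystyle \mathbb H_t^{\alpha,\beta}(\theta,\varphi)=\iint\Psi\,d\Pi_\alpha(u)\,d\Pi_\beta(v)$. (ii) If $-1<\alpha<-\frac12\le\beta$, then $$\mathbb H_t^{\alpha,\beta}(\theta,\varphi)=\iint-\partial_u\Psi\;\Pi_\alpha(u)\,du\,d\Pi_\beta(v)+\iint\Psi\,d\Pi_{-1/2}(u)\,d\Pi_\beta(v).$$ (iii) If $-1<\beta<-\frac12\le\alpha$, then $$\mathbb H_t^{\alpha,\beta}(\theta,\varphi)=\iint-\partial_v\Psi\;d\Pi_\alpha(u)\,\Pi_\beta(v)\,dv+\iint\Psi\,d\Pi_\alpha(u)\,d\Pi_{-1/2}(v).$$ (iv) If $-1<\alpha,\beta<-\frac12$,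 then $$\mathbb H_t^{\alpha,\beta}(\theta,\varphi)=\iint\partial_u\partial_v\Psi\;\Pi_\alpha(u)\,du\,\Pi_\beta(v)\,dv-\iint\partial_u\Psi\;\Pi_\alpha(u)\,du\,d\Pi_{-1/2}(v)-\iint\partial_v\Psi\;d\Pi_{-1/2}(u)\,\Pi_\beta(v)\,dv+\iint\Psi\,d\Pi_{-1/2}(u)\,d\Pi_{-1/2}(v).$$ All these double integrals converge absolutely, and each of them, taken together with the sign in front of it, is nonnegative. -/

import Mathlib

open MeasureTheory

noncomputable section

/-- The classical Jacobi polynomial `P_n^{(α,β)}(x)`, for `α, β > -1`, in its hypergeometric form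
`(α+1)_n / n! * ∑ k, (-n)_k (n+α+β+1)_k / ((α+1)_k k!) * ((1-x)/2)^k`. -/
def jacobiPoly (α β : ℝ) (n : ℕ) (x : ℝ) : ℝ :=
  (ascPochhammer ℝ n).eval (α + 1) / (n.factorial : ℝ) *
    ∑ k ∈ Finset.range (n + 1),
      (ascPochhammer ℝ k).eval (-(n : ℝ)) * (ascPochhammer ℝ k).eval ((n : ℝ) + α + β + 1) /
        ((ascPochhammer ℝ k).eval (α + 1) * (k.factorial : ℝ)) * ((1 - x) / 2) ^ k

/-- The measure `(sin (θ/2))^(2α+1) (cos (θ/2))^(2β+1) dθ` on `[0,π]`. -/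
def jacobiMeasure (α β : ℝ) : Measure ℝ :=
  (volume.restrict (Set.Icc 0 Real.pi)).withDensity fun θ =>
    ENNReal.ofReal (Real.sin (θ / 2) ^ (2 * α + 1) * Real.cos (θ / 2) ^ (2 * β + 1))

/-- The Jacobi trigonometric polynomial `θ ↦ P_n^{(α,β)}(cos θ)`, normalized in
`L²(jacobiMeasure α β)`. -/
def jacobiTrig (α β : ℝ) (n : ℕ) (θ : ℝ) : ℝ :=
  jacobiPoly α β n (Real.cos θ) /
    Real.sqrt (∫ τ, jacobiPoly α β n (Real.cos τ) ^ 2 ∂(jacobiMeasure α β))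

/-- The `n`-th term of the series defining the auxiliary Jacobi-Poisson kernel. -/
def jacobiKernelTerm (α β t θ φ : ℝ) (n : ℕ) : ℝ :=
  Real.exp (-t * ((n : ℝ) + (α + β + 1) / 2)) * jacobiTrig α β n θ * jacobiTrig α β n φ

/-- The auxiliary Jacobi-Poisson kernel `ℍ_t^{α,β}(θ,φ)`. -/
def jacobiKernel (α β t θ φ : ℝ) : ℝ :=
  ∑' n : ℕ, jacobiKernelTerm α β t θ φ n

/-- The constant `c_{α,β}`. -/
def jacobiConst (α β : ℝ) : ℝ :=
  Real.Gamma (α + β + 2) /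
    ((2 : ℝ) ^ (α + β + 1) * Real.Gamma (α + 1) * Real.Gamma (β + 1))

/-- `q(θ,φ,u,v) = 1 - u sin(θ/2) sin(φ/2) - v cos(θ/2) cos(φ/2)`. -/
def jacobiQ (θ φ u v : ℝ) : ℝ :=
  1 - u * Real.sin (θ / 2) * Real.sin (φ / 2) - v * Real.cos (θ / 2) * Real.cos (φ / 2)

/-- The function `Ψ^{α,β}(t,θ,φ,u,v)`. -/
def jacobiPsi (α β t θ φ u v : ℝ) : ℝ :=
  jacobiConst α β * Real.sinh (t / 2) /
    (Real.cosh (t / 2) - 1 + jacobiQ θ φ u v) ^ (α + β + 2)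

/-- The partial derivative `∂_u Ψ`. -/
def jacobiPsiU (α β t θ φ u v : ℝ) : ℝ :=
  deriv (fun x => jacobiPsi α β t θ φ x v) u

/-- The partial derivative `∂_v Ψ`. -/
def jacobiPsiV (α β t θ φ u v : ℝ) : ℝ :=
  deriv (fun y => jacobiPsi α β t θ φ u y) v

/-- The mixed partial derivative `∂_u ∂_v Ψ`. -/
def jacobiPsiUV (α β t θ φ u v : ℝ) : ℝ :=
  deriv (fun x => jacobiPsiV α β t θ φ x v) u

/-- The density `Γ(ν+1) / (√π Γ(ν+1/2)) (1-w²)^(ν-1/2)`, for `ν > -1`, `ν ≠ -1/2`, `|w| < 1`. -/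
def piDensity (ν w : ℝ) : ℝ :=
  Real.Gamma (ν + 1) / (Real.sqrt Real.pi * Real.Gamma (ν + 1 / 2)) *
    (1 - w ^ 2) ^ (ν - 1 / 2)

/-- The odd function `Π_ν(u) = ∫_0^u piDensity ν w dw`, for `ν > -1`, `ν ≠ -1/2`, `|u| < 1`. -/
def piFun (ν u : ℝ) : ℝ :=
  ∫ w in (0 : ℝ)..u, piDensity ν w

open scoped Classical in
/-- The probability measure `dΠ_ν` on `[-1,1]`, for `ν ≥ -1/2`: it has density `piDensity ν` if
`ν > -1/2`, and it is `(δ_{-1} + δ_1)/2` if `ν = -1/2`. -/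
def piMeasure (ν : ℝ) : Measure ℝ :=
  if ν = -1 / 2 then
    (2⁻¹ : ENNReal) • (Measure.dirac (-1 : ℝ) + Measure.dirac (1 : ℝ))
  else
    (volume.restrict (Set.Ioo (-1) 1)).withDensity fun w => ENNReal.ofReal (piDensity ν w)

/-- Lebesgue measure on `[-1,1]`. -/
def lebSym : Measure ℝ := volume.restrict (Set.Icc (-1) 1)

end

/-! Put `a = α+1`, `b = β+1`, `l = a+b`, `w = e^{-t/2}`, `S = sin(θ/2) sin(φ/2)`, `K = cos(θ/2)
cos(φ/2)`, so that `S, K ≥ 0` and `S + K ≤ 1`. Up to an explicit factor containing `1 - w²`, `Ψ` is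
`(1 - 2w(uS+vK) + w²)^(-l)`, the generating function of the Gegenbauer polynomials
`C_N^{(l)}(uS+vK)` (`jacobiPsi_eq`, `hasSum_geg`).

Apply to `C_N^{(l)}(uS+vK)` the functional sending `u^i v^k` to the product of the moments of `dΠ_α`
and `dΠ_β`. Odd `N` give 0; `N = 2n` gives a number `G_n` (`gegBi_odd`, `gegBi_even`). The heart is
that `G_{n+1} - G_n` is, up to `Γ(a+b)/(Γ(a)Γ(b))`, the product of the normalized Jacobi polynomials
of degree `n+1` at `θ` and `φ` (`jacobiTrig_mul_succ`). The factor `1 - w²` turns `∑ G_n w^{2n}`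
into the series of these differences, which is the kernel (`hasSum_jacobiKernelTerm`).

The difference `G_{n+1} - G_n` is a multiple of an Appell polynomial `F₄` in `xy` and `(1-x)(1-y)`,
with `x = sin²(θ/2)`, `y = sin²(φ/2)`. It factors (`eval_appell`) because it is symmetric and is, in
`x`, a polynomial eigenfunction of the Jacobi operator, hence determined by its value at 0. The
constants are matched with the `L²` norms (`integral_hyp_sq`).

The moments `(1/2)_m / (ν+1)_m` make sense for every `ν > -1`. For `ν ≥ -1/2` they are integrals
against `dΠ_ν`; for `ν < -1/2` integration by parts yields the same numbers from `-Π_ν(u) du` paired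
with the derivative of `u^k`, plus `dΠ_{-1/2}` paired with `u^k` (`integral_powDeriv_one_add`). So
all four cases feed one series, and termwise integration is justified by a majorant uniform on
`[-1,1]²` (`integral_genKernel`).

For the signs, `-Π_ν` is odd and has the sign of `u` when `ν < -1/2`, while the odd part of `∂_u Ψ`
in `u`, and the part of `∂_u ∂_v Ψ` odd in both variables, have the sign of `u` and of `uv`. -/

/-! ### Rising factorials and terminating hypergeometric sums. -/

/-- The rising factorial `(a)_n`. -/
noncomputable def poch (a : ℝ) (n : ℕ) : ℝ := (ascPochhammer ℝ n).eval a

@[simp] lemma poch_zero (a : ℝ) : poch a 0 = 1 := by simp [poch]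

lemma poch_succ (a : ℝ) (n : ℕ) : poch a (n + 1) = poch a n * (a + n) :=
  ascPochhammer_succ_eval n a

lemma poch_succ_left (a : ℝ) (n : ℕ) : poch a (n + 1) = a * poch (a + 1) n := by
  simp [poch, ascPochhammer_succ_left]

lemma poch_pos {a : ℝ} (ha : 0 < a) (n : ℕ) : 0 < poch a n := ascPochhammer_pos n a ha

lemma poch_add (a : ℝ) (n k : ℕ) : poch a (n + k) = poch a n * poch (a + n) k := by
  induction k with
  | zero => simp
  | succ k ih => rw [← add_assoc, poch_succ, ih, poch_succ]; push_cast; ring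

lemma poch_neg_natCast (n k : ℕ) :
    poch (-(n : ℝ)) k = (-1) ^ k * (k.factorial * n.choose k : ℝ) := by
  rw [poch, ascPochhammer_eval_neg_eq_descPochhammer, descPochhammer_eval_eq_descFactorial,
    Nat.descFactorial_eq_factorial_mul_choose]
  push_cast; ring

lemma poch_neg_natCast_self (n : ℕ) : poch (-(n : ℝ)) n = (-1) ^ n * n.factorial := by
  simp [poch_neg_natCast]

lemma poch_neg_natCast_of_lt {n k : ℕ} (h : n < k) : poch (-(n : ℝ)) k = 0 := by
  simp [poch_neg_natCast, Nat.choose_eq_zero_of_lt h]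

/-- The factors are those of `(a)_n`, negated and in reverse order. This produces the sign when a
Jacobi polynomial is evaluated at the opposite endpoint. -/
lemma poch_reflect (a : ℝ) (n : ℕ) : poch (1 - n - a) n = (-1) ^ n * poch a n := by
  induction n generalizing a with
  | zero => simp
  | succ n ih =>
    rw [poch_succ, poch_succ_left a]
    have h := ih (a + 1)
    have e : (1 : ℝ) - ((n + 1 : ℕ) : ℝ) - a = 1 - n - (a + 1) := by push_cast; ring
    rw [e, h]; ring

lemma Gamma_add_natCast {a : ℝ} (ha : 0 < a) (n : ℕ) :
    Real.Gamma (a + n) = poch a n * Real.Gamma a := by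
  induction n with
  | zero => simp
  | succ n ih =>
    rw [poch_succ, Nat.cast_succ, ← add_assoc, Real.Gamma_add_one (by positivity), ih]; ring

/-- The Chu–Vandermonde summation with binomial coefficients. -/
lemma sum_choose_poch_div_poch (n : ℕ) (b : ℝ) {c : ℝ} (hc : 0 < c) :
    ∑ k ∈ Finset.range (n + 1), (-1) ^ k * (n.choose k : ℝ) * poch b k / poch c k =
      poch (c - b) n / poch c n := by
  induction n generalizing b c with
  | zero => simp
  | succ n ih =>
    have h1 := ih b hc
    have h2 := ih (b + 1) (c := c + 1) (by positivity)
    have hp := (poch_pos hc n).ne'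
    have hp1 := (poch_pos (by positivity : 0 < c + 1) n).ne'
    -- Pascal's rule splits the sum into the one for `(n, b, c)` and, after `k ↦ k+1`, the one for
    -- `(n, b+1, c+1)`; both have the same `c - b`.
    have key : ∑ k ∈ Finset.range (n + 1 + 1), (-1) ^ k * ((n + 1).choose k : ℝ) * poch b k /
        poch c k = poch (c - b) n / poch c n - b / c * (poch (c + 1 - (b + 1)) n / poch (c + 1) n) := by
      rw [← h1, ← h2, Finset.sum_range_succ', Finset.mul_sum]
      have h3 : ∑ k ∈ Finset.range (n + 1), (-1) ^ k * (n.choose k : ℝ) * poch b k / poch c k =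
          ∑ k ∈ Finset.range (n + 1), (-1) ^ (k + 1) * (n.choose (k + 1) : ℝ) * poch b (k + 1) /
            poch c (k + 1) + 1 := by
        have := Finset.sum_range_succ' (fun k => (-1) ^ k * (n.choose k : ℝ) * poch b k / poch c k)
          (n + 1)
        rw [Finset.sum_range_succ] at this
        simpa using this
      rw [h3, add_sub_right_comm, ← Finset.sum_sub_distrib]
      congr 1
      · refine Finset.sum_congr rfl fun k _ => ?_
        have := (poch_pos (by positivity : 0 < c + 1) k).ne'
        rw [poch_succ_left, poch_succ_left, Nat.choose_succ_succ]
        push_cast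
        field_simp
        ring
      · simp
    have e : c * poch (c + 1) n = poch c n * (c + n) := by rw [← poch_succ_left, poch_succ]
    rw [key, poch_succ, poch_succ, add_sub_add_right_eq_sub]
    have hcn : c + n ≠ 0 := by positivity
    have : poch (c + 1) n = poch c n * (c + n) / c := by rw [← e]; field_simp
    rw [this]
    field_simp
    ring

/-- The terminating hypergeometric polynomial `₂F₁(-n, b; c; x)`. -/
noncomputable def hyp (n : ℕ) (b c x : ℝ) : ℝ :=
  ∑ k ∈ Finset.range (n + 1), poch (-(n : ℝ)) k * poch b k / (poch c k * k.factorial) * x ^ k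

lemma hyp_one (n : ℕ) (b : ℝ) {c : ℝ} (hc : 0 < c) :
    hyp n b c 1 = poch (c - b) n / poch c n := by
  rw [← sum_choose_poch_div_poch n b hc, hyp]
  refine Finset.sum_congr rfl fun k _ => ?_
  have := (poch_pos hc k).ne'
  have := k.factorial_ne_zero
  rw [poch_neg_natCast, one_pow, mul_one]
  field_simp

lemma jacobiPoly_eq (α β : ℝ) (n : ℕ) (x : ℝ) :
    jacobiPoly α β n x =
      poch (α + 1) n / n.factorial * hyp n (n + α + β + 1) (α + 1) ((1 - x) / 2) := rfl

/-! ### The Jacobi operator and the factorization of the Appell polynomial. -/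

section Appell

open Polynomial

/-- The Jacobi differential operator on `[0,1]`, with eigenfunctions `₂F₁(-n, n+a+b-1; a; x)`. -/
noncomputable def jacobiOp (a b : ℝ) (f : ℝ[X]) : ℝ[X] :=
  X * (1 - X) * derivative (derivative f) + (C a - C (a + b) * X) * derivative f

lemma jacobiOp_sum (a b : ℝ) {ι : Type*} (s : Finset ι) (f : ι → ℝ[X]) :
    jacobiOp a b (∑ i ∈ s, f i) = ∑ i ∈ s, jacobiOp a b (f i) := by
  simp [jacobiOp, Finset.mul_sum, Finset.sum_add_distrib]

lemma jacobiOp_C_mul (a b c : ℝ) (f : ℝ[X]) :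
    jacobiOp a b (C c * f) = C c * jacobiOp a b f := by
  simp [jacobiOp]; ring

/-- The operator sends `X^k` into the span of `X^k` and `X^(k-1)`, so an eigenvalue equation becomes
a two-term recursion for the coefficients. -/
lemma jacobiOp_coeff (a b : ℝ) (f : ℝ[X]) (k : ℕ) :
    (jacobiOp a b f).coeff k =
      (k + 1) * (k + a) * f.coeff (k + 1) - k * (k + a + b - 1) * f.coeff k := by
  have e : jacobiOp a b f = X * derivative (derivative f) - X * (X * derivative (derivative f))
      + C a * derivative f - C (a + b) * (X * derivative f) := by
    simp only [jacobiOp]; ring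
  rw [e, coeff_sub, coeff_C_mul]
  rcases k with _ | _ | k
  · simp [coeff_derivative]
  · simp [coeff_derivative, coeff_X_mul]; ring
  · simp [coeff_derivative, coeff_X_mul]; ring

/-- The coefficient recursion has leading factor `(k+1)(k+a)`, nonzero since `a > 0`, so the
constant term determines all coefficients. They vanish beyond degree `n` because `(-n)_k` does. -/
lemma eval_eq_of_jacobiOp {a b : ℝ} (ha : 0 < a) (n : ℕ) (f : ℝ[X])
    (hf : jacobiOp a b f = C (-(n * (n + a + b - 1))) * f) (x : ℝ) :
    f.eval x = f.eval 0 * hyp n (n + a + b - 1) a x := by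
  have hc : ∀ k, f.coeff k = f.eval 0 *
      (poch (-(n : ℝ)) k * poch (n + a + b - 1) k / (poch a k * k.factorial)) := by
    intro k
    induction k with
    | zero => simp [coeff_zero_eq_eval_zero]
    | succ k ih =>
      have h := congrArg (fun p => coeff p k) hf
      simp only [jacobiOp_coeff, coeff_C_mul] at h
      have hp := (poch_pos ha k).ne'
      have hk : (k : ℝ) + a ≠ 0 := by positivity
      have h1 : f.coeff (k + 1) = (k - n) * (k + (n + a + b - 1)) / ((k + 1) * (k + a)) *
          f.coeff k := by
        field_simp
        linear_combination h
      have hk1 : a + (k : ℝ) ≠ 0 := by positivity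
      rw [h1, ih, poch_succ, poch_succ, poch_succ, Nat.factorial_succ]
      push_cast
      field_simp
      ring
  have hd : f.natDegree < n + 1 := by
    rw [Nat.lt_succ_iff, natDegree_le_iff_coeff_eq_zero]
    intro k hk
    rw [hc, poch_neg_natCast_of_lt hk]; simp
  rw [eval_eq_sum_range' hd, hyp, Finset.mul_sum]
  refine Finset.sum_congr rfl fun k _ => ?_
  rw [hc]; ring

/-- When `m` or `l` is 0 the truncated exponent `m - 1` or `l - 1` is harmless, its coefficient
being 0. -/
lemma jacobiOp_X_pow_mul (a b : ℝ) (m l : ℕ) :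
    jacobiOp a b (X ^ m * (1 - X) ^ l) =
      C (m * (m + a - 1)) * (X ^ (m - 1) * (1 - X) ^ l) +
      C (l * (l + b - 1)) * (X ^ m * (1 - X) ^ (l - 1)) -
      C ((m + l) * (m + l + a + b - 1)) * (X ^ m * (1 - X) ^ l) := by
  rcases m with _ | _ | m <;> rcases l with _ | _ | l <;>
    simp [jacobiOp, derivative_pow] <;> ring

/-- The homogeneous block of degree `j` in the Appell `F₄` expansion of a product of two
Jacobi polynomials, as a polynomial in the first variable. -/
noncomputable def appellBlock (a b y : ℝ) (j : ℕ) : ℝ[X] :=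
  ∑ i ∈ Finset.HasAntidiagonal.antidiagonal j,
    C (y ^ i.1 / (i.1.factorial * poch a i.1) * ((1 - y) ^ i.2 / (i.2.factorial * poch b i.2))) *
      (X ^ i.1 * (1 - X) ^ i.2)

lemma eval_appellBlock (a b y : ℝ) (j : ℕ) (x : ℝ) :
    (appellBlock a b y j).eval x = ∑ i ∈ Finset.HasAntidiagonal.antidiagonal j,
      (x * y) ^ i.1 / (i.1.factorial * poch a i.1) *
        (((1 - x) * (1 - y)) ^ i.2 / (i.2.factorial * poch b i.2)) := by
  simp only [appellBlock, eval_finsetSum, eval_mul, eval_C, eval_pow, eval_X, eval_sub, eval_one]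
  refine Finset.sum_congr rfl fun i _ => ?_
  rw [mul_pow, mul_pow]; ring

lemma eval_appellBlock_symm (a b y : ℝ) (j : ℕ) (x : ℝ) :
    (appellBlock a b y j).eval x = (appellBlock a b x j).eval y := by
  simp only [eval_appellBlock, mul_comm]

lemma eval_zero_appellBlock (a b y : ℝ) (j : ℕ) :
    (appellBlock a b y j).eval 0 = (1 - y) ^ j / (j.factorial * poch b j) := by
  rw [eval_appellBlock, Finset.sum_eq_single (0, j)]
  · simp
  · rintro ⟨m, l⟩ h hne
    rcases m with _ | m
    · simp_all
    · simp
  · simp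

lemma jacobiOp_appellBlock_zero (a b y : ℝ) : jacobiOp a b (appellBlock a b y 0) = 0 := by
  simp [appellBlock, jacobiOp]

/-- Lowering the exponent of `X` reproduces the block of degree `j` times `y`, lowering that of `1 -
X` reproduces it times `1 - y`, and the two weights add up to 1. This is what the factorials and
Pochhammer symbols in the block are for. -/
lemma jacobiOp_appellBlock_succ {a b : ℝ} (ha : 0 < a) (hb : 0 < b) (y : ℝ) (j : ℕ) :
    jacobiOp a b (appellBlock a b y (j + 1)) =
      appellBlock a b y j - C ((j + 1) * (j + a + b)) * appellBlock a b y (j + 1) := by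
  have h1 : ∑ i ∈ Finset.HasAntidiagonal.antidiagonal (j + 1),
      C (y ^ i.1 / (i.1.factorial * poch a i.1) * ((1 - y) ^ i.2 / (i.2.factorial * poch b i.2))) *
        (C (i.1 * (i.1 + a - 1)) * (X ^ (i.1 - 1) * (1 - X) ^ i.2)) =
      C y * appellBlock a b y j := by
    rw [Finset.Nat.sum_antidiagonal_succ, appellBlock, Finset.mul_sum]
    simp only [Nat.cast_zero, zero_mul, C_0, mul_zero, zero_add]
    refine Finset.sum_congr rfl fun i _ => ?_
    simp only [Nat.add_sub_cancel, ← mul_assoc, ← C_mul]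
    congr 3
    have := (poch_pos ha i.1).ne'
    have : a + (i.1 : ℝ) ≠ 0 := by positivity
    rw [poch_succ, Nat.factorial_succ, Nat.cast_mul, Nat.cast_succ]
    field_simp
    ring
  have h2 : ∑ i ∈ Finset.HasAntidiagonal.antidiagonal (j + 1),
      C (y ^ i.1 / (i.1.factorial * poch a i.1) * ((1 - y) ^ i.2 / (i.2.factorial * poch b i.2))) *
        (C (i.2 * (i.2 + b - 1)) * (X ^ i.1 * (1 - X) ^ (i.2 - 1))) =
      C (1 - y) * appellBlock a b y j := by
    rw [Finset.Nat.sum_antidiagonal_succ', appellBlock, Finset.mul_sum]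
    simp only [Nat.cast_zero, zero_mul, C_0, mul_zero, zero_add]
    refine Finset.sum_congr rfl fun i _ => ?_
    simp only [Nat.add_sub_cancel, ← mul_assoc, ← C_mul]
    congr 3
    have := (poch_pos hb i.2).ne'
    have : b + (i.2 : ℝ) ≠ 0 := by positivity
    rw [poch_succ, Nat.factorial_succ, Nat.cast_mul, Nat.cast_succ]
    field_simp
    ring
  have h3 : ∑ i ∈ Finset.HasAntidiagonal.antidiagonal (j + 1),
      C (y ^ i.1 / (i.1.factorial * poch a i.1) * ((1 - y) ^ i.2 / (i.2.factorial * poch b i.2))) *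
        (C ((i.1 + i.2) * (i.1 + i.2 + a + b - 1)) * (X ^ i.1 * (1 - X) ^ i.2)) =
      C ((j + 1) * (j + a + b)) * appellBlock a b y (j + 1) := by
    rw [appellBlock, Finset.mul_sum]
    refine Finset.sum_congr rfl fun i hi => ?_
    have hij : (i.1 : ℝ) + i.2 = j + 1 := by
      exact_mod_cast Finset.HasAntidiagonal.mem_antidiagonal.1 hi
    rw [hij, show (j : ℝ) + 1 + a + b - 1 = j + a + b by ring]
    ring
  conv_lhs => rw [appellBlock, jacobiOp_sum]
  simp only [jacobiOp_C_mul, jacobiOp_X_pow_mul, mul_sub, mul_add, Finset.sum_sub_distrib,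
    Finset.sum_add_distrib]
  simp only [mul_add, mul_sub] at h1 h2 h3
  rw [h1, h2, h3]
  simp only [map_sub, map_one, map_mul, map_add]; ring

/-- The Appell polynomial `F₄(-n, n+a+b-1; a, b; xy, (1-x)(1-y))`. -/
noncomputable def appell (a b : ℝ) (n : ℕ) (y : ℝ) : ℝ[X] :=
  ∑ j ∈ Finset.range (n + 1),
    C (poch (-(n : ℝ)) j * poch (n + a + b - 1) j) * appellBlock a b y j

lemma eval_appell_symm (a b y : ℝ) (n : ℕ) (x : ℝ) :
    (appell a b n y).eval x = (appell a b n x).eval y := by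
  simp only [appell, eval_finsetSum, eval_mul, eval_C, eval_appellBlock_symm a b y _ x]

lemma eval_zero_appell (a b y : ℝ) (n : ℕ) :
    (appell a b n y).eval 0 = hyp n (n + a + b - 1) b (1 - y) := by
  simp only [appell, eval_finsetSum, eval_mul, eval_C, eval_zero_appellBlock, hyp]
  exact Finset.sum_congr rfl fun k _ => by ring

/-- Since the operator lowers blocks by one degree, the coefficients of an eigenfunction must
satisfy `d (j+1) = d j * (j-n)(j+n+a+b-1)`, and this factor is `j(j+a+b-1)` minus `n(n+a+b-1)`. -/
lemma jacobiOp_appell {a b : ℝ} (ha : 0 < a) (hb : 0 < b) (n : ℕ) (y : ℝ) :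
    jacobiOp a b (appell a b n y) = C (-(n * (n + a + b - 1))) * appell a b n y := by
  set d : ℕ → ℝ := fun j => poch (-(n : ℝ)) j * poch (n + a + b - 1) j with hd
  have hds : ∀ j, d (j + 1) = d j * ((j - n) * (j + n + a + b - 1)) := by
    intro j; simp only [hd, poch_succ]; ring
  have hdn : d (n + 1) = 0 := by simp [hd, poch_neg_natCast_of_lt]
  have e1 : jacobiOp a b (appell a b n y) =
      ∑ j ∈ Finset.range n, C (d (j + 1)) * appellBlock a b y j -
      ∑ j ∈ Finset.range n, C (d (j + 1)) * (C ((j + 1) * (j + a + b)) *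
        appellBlock a b y (j + 1)) := by
    simp only [appell, jacobiOp_sum, jacobiOp_C_mul]
    rw [Finset.sum_range_succ', jacobiOp_appellBlock_zero, mul_zero, add_zero,
      ← Finset.sum_sub_distrib]
    exact Finset.sum_congr rfl fun j _ => by rw [jacobiOp_appellBlock_succ ha hb, mul_sub]
  -- The term `j = n` may be added because `(-n)_{n+1} = 0`.
  have e2 : ∑ j ∈ Finset.range n, C (d (j + 1)) * appellBlock a b y j =
      ∑ j ∈ Finset.range (n + 1), C (d (j + 1)) * appellBlock a b y j := by
    rw [Finset.sum_range_succ, hdn]; simp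
  have e3 : ∑ j ∈ Finset.range n, C (d (j + 1)) * (C ((j + 1) * (j + a + b)) *
        appellBlock a b y (j + 1)) =
      ∑ j ∈ Finset.range (n + 1), C (d j) * (C (j * (j + a + b - 1)) * appellBlock a b y j) := by
    rw [Finset.sum_range_succ']
    simp only [Nat.cast_zero, zero_mul, C_0, mul_zero, add_zero]
    refine Finset.sum_congr rfl fun j _ => ?_
    rw [show ((j + 1 : ℕ) : ℝ) + a + b - 1 = j + a + b by push_cast; ring]
    push_cast; rfl
  rw [e1, e2, e3, ← Finset.sum_sub_distrib, appell, Finset.mul_sum]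
  refine Finset.sum_congr rfl fun j _ => ?_
  change _ = _ * (C (d j) * _)
  rw [hds]
  simp only [← mul_assoc, ← C_mul]
  rw [← sub_mul, ← C_sub]
  congr 2
  ring

/-- Reflection `x ↦ 1 - x` of Jacobi polynomials. The Appell polynomial with one variable 0 is
computed twice: directly it is the left side; as an eigenfunction in the other variable it is a
multiple of the right side, with factor given by Chu–Vandermonde. -/
lemma hyp_one_sub {a b : ℝ} (ha : 0 < a) (hb : 0 < b) (n : ℕ) (y : ℝ) :
    hyp n (n + a + b - 1) b (1 - y) =
      (-1) ^ n * poch a n / poch b n * hyp n (n + a + b - 1) a y := by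
  have h := eval_eq_of_jacobiOp ha n _ (jacobiOp_appell ha hb n 0) y
  rw [eval_appell_symm, eval_zero_appell, eval_zero_appell, sub_zero, hyp_one n _ hb,
    show b - (n + a + b - 1) = 1 - n - a by ring, poch_reflect] at h
  exact h

/-- Bailey's factorization of `F₄` into a product of two Jacobi polynomials. -/
theorem eval_appell {a b : ℝ} (ha : 0 < a) (hb : 0 < b) (n : ℕ) (x y : ℝ) :
    (appell a b n y).eval x = (-1) ^ n * poch a n / poch b n *
      (hyp n (n + a + b - 1) a x * hyp n (n + a + b - 1) a y) := by
  rw [eval_eq_of_jacobiOp ha n _ (jacobiOp_appell ha hb n y) x, eval_zero_appell,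
    hyp_one_sub ha hb]
  ring

end Appell

/-! ### Gegenbauer polynomials and their generating function. -/

/-- The coefficient of `(2q)^(N-2k)` in the Gegenbauer polynomial `C_N^{(l)}(q)`. -/
noncomputable def gegCoeff (l : ℝ) (N k : ℕ) : ℝ :=
  (-1) ^ k * poch l (N - k) / (N - k).factorial * (N - k).choose k

/-- The Gegenbauer polynomial `C_N^{(l)}(q)`. -/
noncomputable def geg (l : ℝ) (N : ℕ) (q : ℝ) : ℝ :=
  ∑ k ∈ Finset.range (N + 1), gegCoeff l N k * (2 * q) ^ (N - 2 * k)

/-- Makes the truncated exponents `N - 2k` harmless and lets the summation range be enlarged freely.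
-/
lemma gegCoeff_of_lt {l : ℝ} {N k : ℕ} (h : N < 2 * k) : gegCoeff l N k = 0 := by
  rw [gegCoeff, Nat.choose_eq_zero_of_lt (by omega)]; simp

lemma geg_eq_sum_range (l : ℝ) {N M : ℕ} (h : N + 1 ≤ M) (q : ℝ) :
    geg l N q = ∑ k ∈ Finset.range M, gegCoeff l N k * (2 * q) ^ (N - 2 * k) := by
  refine Finset.sum_subset (Finset.range_mono h) fun k _ hk => ?_
  rw [gegCoeff_of_lt, zero_mul]
  have := Finset.mem_range.not.1 hk
  omega

lemma gegCoeff_succ_succ (l : ℝ) (N k : ℕ) (h : 2 * k ≤ N) :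
    (N + 2) * gegCoeff l (N + 2) (k + 1) =
      (N + 1 + l) * gegCoeff l (N + 1) (k + 1) - (N + 2 * l) * gegCoeff l N k := by
  obtain ⟨p, rfl⟩ : ∃ p, N = p + k := ⟨N - k, by omega⟩
  have hkp : k ≤ p := by omega
  simp only [gegCoeff, show p + k + 2 - (k + 1) = p + 1 by omega,
    show p + k + 1 - (k + 1) = p by omega, show p + k - k = p by omega]
  have h1 : ((p + 1).choose (k + 1) : ℝ) = p.choose k * (p + 1) / (k + 1) := by
    rw [eq_div_iff (by positivity)]
    exact_mod_cast (show (p + 1).choose (k + 1) * (k + 1) = p.choose k * (p + 1) by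
      rw [← Nat.add_one_mul_choose_eq, mul_comm])
  have h2 : (p.choose (k + 1) : ℝ) = p.choose k * (p - k) / (k + 1) := by
    rw [eq_div_iff (by positivity), ← Nat.cast_sub hkp]
    exact_mod_cast Nat.choose_succ_right_eq p k
  rw [h1, h2, poch_succ, Nat.factorial_succ]
  push_cast
  field_simp
  ring

lemma geg_zero (l q : ℝ) : geg l 0 q = 1 := by simp [geg, gegCoeff]

lemma geg_one (l q : ℝ) : geg l 1 q = 2 * q * l := by
  simp [geg, gegCoeff, Finset.sum_range_succ, poch_succ]; ring

lemma geg_rec (l : ℝ) (N : ℕ) (q : ℝ) :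
    (N + 2) * geg l (N + 2) q =
      2 * q * (N + 1 + l) * geg l (N + 1) q - (N + 2 * l) * geg l N q := by
  have hA := Finset.sum_range_succ'
    (fun k => gegCoeff l (N + 2) k * (2 * q) ^ (N + 2 - 2 * k)) (N + 2)
  have hB := Finset.sum_range_succ'
    (fun k => gegCoeff l (N + 1) k * (2 * q) ^ (N + 1 - 2 * k)) (N + 2)
  rw [geg_eq_sum_range l (le_refl (N + 2 + 1)),
    geg_eq_sum_range l (show N + 1 + 1 ≤ N + 2 + 1 by omega),
    geg_eq_sum_range l (show N + 1 ≤ N + 2 by omega), hA, hB, mul_add, mul_add, add_sub_right_comm,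
    Finset.mul_sum, Finset.mul_sum, Finset.mul_sum, ← Finset.sum_sub_distrib]
  congr 1
  · refine Finset.sum_congr rfl fun k _ => ?_
    rcases Nat.lt_or_ge N (2 * k) with h | h
    · simp [gegCoeff_of_lt (show N < 2 * k from h), gegCoeff_of_lt (show N + 2 < 2 * (k + 1) by omega),
        gegCoeff_of_lt (show N + 1 < 2 * (k + 1) by omega)]
    · have e : N + 2 - 2 * (k + 1) = N - 2 * k := by omega
      rw [e, ← mul_assoc, gegCoeff_succ_succ l N k h]
      -- If `N = 2k`, the exponent `N + 1 - 2(k+1)` truncates to 0 instead of being -1, but its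
      -- coefficient vanishes.
      rcases h.eq_or_lt with h | h
      · rw [gegCoeff_of_lt (show N + 1 < 2 * (k + 1) by omega)]; ring
      · rw [show N - 2 * k = N + 1 - 2 * (k + 1) + 1 by omega, pow_succ]; ring
  · have : ((N + 1).factorial : ℝ) ≠ 0 := by positivity
    simp only [gegCoeff, Nat.sub_zero, mul_zero, Nat.choose_zero_right, pow_zero, Nat.cast_one,
      poch_succ _ (N + 1), Nat.factorial_succ (N + 1)]
    push_cast
    have h2 : (N : ℝ) + 1 + 1 ≠ 0 := by positivity
    field_simp
    ring

lemma hasDerivAt_geg_succ (l : ℝ) (N : ℕ) (q : ℝ) :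
    HasDerivAt (geg l (N + 1)) (2 * l * geg (l + 1) N q) q := by
  have h : HasDerivAt (fun q => ∑ k ∈ Finset.range (N + 1 + 1),
      gegCoeff l (N + 1) k * (2 * q) ^ (N + 1 - 2 * k))
      (∑ k ∈ Finset.range (N + 1 + 1), gegCoeff l (N + 1) k *
        (((N + 1 - 2 * k : ℕ) : ℝ) * (2 * q) ^ (N + 1 - 2 * k - 1) * (2 * 1))) q := by
    refine HasDerivAt.fun_sum fun k _ => ?_
    exact (((hasDerivAt_id q).const_mul 2).pow _).const_mul _
  refine h.congr_deriv ?_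
  rw [Finset.sum_range_succ, gegCoeff_of_lt (show N + 1 < 2 * (N + 1) by omega), zero_mul, add_zero,
    geg, Finset.mul_sum]
  refine Finset.sum_congr rfl fun k hk => ?_
  have hk : k ≤ N := by have := Finset.mem_range.1 hk; omega
  obtain ⟨M, rfl⟩ := Nat.exists_eq_add_of_le hk
  rw [show k + M + 1 - 2 * k - 1 = k + M - 2 * k by omega]
  have e : ((M + 1).choose k : ℝ) * ((k + M + 1 - 2 * k : ℕ) : ℝ) = M.choose k * (M + 1) := by
    rw [show k + M + 1 - 2 * k = M + 1 - k by omega]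
    exact_mod_cast (Nat.choose_mul_succ_eq M k).symm
  have e2 : gegCoeff l (k + M + 1) k * ((k + M + 1 - 2 * k : ℕ) : ℝ) =
      l * gegCoeff (l + 1) (k + M) k := by
    simp only [gegCoeff, show k + M + 1 - k = M + 1 by omega, Nat.add_sub_cancel_left]
    rw [poch_succ_left, Nat.factorial_succ, mul_assoc, e]
    push_cast
    field_simp
  linear_combination (2 * (2 * q) ^ (k + M - 2 * k)) * e2

/-- The binomial coefficient `(l)_n / n!`. -/
noncomputable def binCoeff (l : ℝ) (n : ℕ) : ℝ := poch l n / n.factorial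

lemma binCoeff_nonneg {l : ℝ} (hl : 0 < l) (n : ℕ) : 0 ≤ binCoeff l n :=
  div_nonneg (poch_pos hl n).le (by positivity)

lemma binCoeff_succ (l : ℝ) (n : ℕ) : (n + 1) * binCoeff l (n + 1) = (l + n) * binCoeff l n := by
  rw [binCoeff, binCoeff, poch_succ, Nat.factorial_succ]; push_cast; field_simp

lemma choose_eq_binCoeff (l : ℝ) (n : ℕ) : Ring.choose (l + n - 1) n = binCoeff l n := by
  have h := Ring.factorial_nsmul_multichoose_eq_ascPochhammer l n
  rw [Ring.choose, show l + n - 1 - n + 1 = l by ring, binCoeff, eq_div_iff (by positivity), mul_comm,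
    poch, ← Polynomial.ascPochhammer_smeval_eq_eval, ← h, nsmul_eq_mul]

lemma hasSum_binCoeff (l : ℝ) {x : ℂ} (hx : ‖x‖ < 1) :
    HasSum (fun n => (binCoeff l n : ℂ) * x ^ n) (1 / (1 - x) ^ (l : ℂ)) := by
  have h := (Complex.one_div_one_sub_cpow_hasFPowerSeriesOnBall_zero (l : ℂ)).hasSum
    (y := x) (by simpa [enorm_eq_nnnorm, ← NNReal.coe_lt_coe] using hx)
  have e : ∀ n : ℕ, Ring.choose ((l : ℂ) + n - 1) n = (binCoeff l n : ℂ) := by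
    intro n
    rw [← choose_eq_binCoeff, Complex.ofReal_choose]
    push_cast; rfl
  simpa [FormalMultilinearSeries.ofScalars, e] using h

lemma summable_binCoeff {l : ℝ} {w : ℝ} (hw0 : 0 ≤ w) (hw : w < 1) :
    Summable (fun n => binCoeff l n * w ^ n) := by
  have h := (hasSum_binCoeff l (x := (w : ℂ)) (by simpa [abs_of_nonneg hw0] using hw)).summable
  exact_mod_cast h

/-- The majorant of the terms of the Gegenbauer generating series. -/
noncomputable def gegMaj (l w : ℝ) (N : ℕ) : ℝ :=
  ∑ i ∈ Finset.HasAntidiagonal.antidiagonal N, (binCoeff l i.1 * w ^ i.1) * (binCoeff l i.2 * w ^ i.2)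

lemma summable_gegMaj {l w : ℝ} (hw0 : 0 ≤ w) (hw : w < 1) :
    Summable (gegMaj l w) := by
  have h := (summable_binCoeff (l := l) hw0 hw).norm
  exact (summable_norm_sum_mul_antidiagonal_of_summable_norm h h).of_norm

/-- The coefficients of `(1 - zX)^(-l) (1 - z'X)^(-l)`. -/
noncomputable def gegComplex (l : ℝ) (z z' : ℂ) (N : ℕ) : ℂ :=
  ∑ i ∈ Finset.HasAntidiagonal.antidiagonal N,
    ((binCoeff l i.1 : ℂ) * z ^ i.1) * ((binCoeff l i.2 : ℂ) * z' ^ i.2)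

open PowerSeries in
-- The logarithmic derivative of `(1 - zX)^(-l)`, stated for formal power series.
lemma binSeries_deriv (l : ℝ) (z : ℂ) :
    (1 - C z * X) * d⁄dX ℂ (mk fun n => (binCoeff l n : ℂ) * z ^ n) =
      C (l * z) * mk fun n => (binCoeff l n : ℂ) * z ^ n := by
  ext n
  rw [sub_mul, one_mul, mul_assoc, map_sub, coeff_C_mul, coeff_C_mul, coeff_derivative, coeff_mk]
  have h := fun n : ℕ => congrArg (fun x : ℝ => (x : ℂ)) (binCoeff_succ l n)
  push_cast at h
  rcases n with _ | n
  · have := h 0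
    simp at this
    simp [this]; ring
  · rw [coeff_succ_X_mul, coeff_derivative, coeff_mk]
    have := h (n + 1)
    push_cast at this ⊢
    linear_combination z ^ (n + 1 + 1) * this

open PowerSeries in
-- The product `(1 - zX)^(-l) (1 - z'X)^(-l)` has logarithmic derivative with denominator `(1 -
-- zX)(1 - z'X) = 1 - 2qX + X²`.
lemma gegComplex_series (l q : ℝ) {z z' : ℂ} (h1 : z * z' = 1) (h2 : z + z' = 2 * q) :
    (1 - C (2 * q : ℂ) * X + X * X) * d⁄dX ℂ (mk (gegComplex l z z')) =
      C (l : ℂ) * (C (2 * q : ℂ) - 2 * X) * mk (gegComplex l z z') := by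
  set A : ℂ⟦X⟧ := mk fun n => (binCoeff l n : ℂ) * z ^ n with hA
  set B : ℂ⟦X⟧ := mk fun n => (binCoeff l n : ℂ) * z' ^ n with hB
  have hG : mk (gegComplex l z z') = A * B := by
    ext n; simp [gegComplex, coeff_mul, hA, hB]
  have dA := binSeries_deriv l z
  have dB := binSeries_deriv l z'
  rw [← hA] at dA
  rw [← hB] at dB
  rw [hG, Derivation.leibniz, smul_eq_mul, smul_eq_mul]
  have c1 : (C z * C z' : ℂ⟦X⟧) = 1 := by rw [← map_mul, h1, map_one]
  rw [map_mul] at dA dB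
  rw [← h2, map_add]
  linear_combination (B * (1 - C z' * X)) * dA + (A * (1 - C z * X)) * dB
    - (X ^ 2 * A * d⁄dX ℂ B + X ^ 2 * B * d⁄dX ℂ A + 2 * C (l : ℂ) * X * A * B) * c1

/-- Comparing coefficients in the differential equation gives the three-term recurrence of
`geg_rec`; the initial values agree. -/
lemma gegComplex_eq (l q : ℝ) {z z' : ℂ} (h1 : z * z' = 1) (h2 : z + z' = 2 * q) (N : ℕ) :
    gegComplex l z z' N = geg l N q := by
  have hs := gegComplex_series l q h1 h2
  have h0 : gegComplex l z z' 0 = geg l 0 q := by simp [gegComplex, geg_zero, binCoeff]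
  have hc : ∀ n, PowerSeries.coeff n (PowerSeries.mk (gegComplex l z z')) = gegComplex l z z' n :=
    fun n => PowerSeries.coeff_mk _ _
  set G : PowerSeries ℂ := PowerSeries.mk (gegComplex l z z')
  have e : PowerSeries.derivative ℂ G - PowerSeries.C (2 * q : ℂ) * (PowerSeries.X *
      PowerSeries.derivative ℂ G) + PowerSeries.X * (PowerSeries.X * PowerSeries.derivative ℂ G) =
      PowerSeries.C (2 * q * l : ℂ) * G - PowerSeries.C (2 * l : ℂ) * (PowerSeries.X * G) := by
    have : (2 : PowerSeries ℂ) = PowerSeries.C 2 := by rw [map_ofNat]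
    rw [this] at hs
    simp only [map_mul] at hs ⊢
    linear_combination hs
  have hr1 : gegComplex l z z' 1 = geg l 1 q := by
    have := congrArg (PowerSeries.coeff 0) e
    simp only [map_sub, map_add, PowerSeries.coeff_C_mul, PowerSeries.coeff_zero_X_mul,
      PowerSeries.coeff_derivative, hc, h0, geg_zero] at this
    simp at this
    rw [geg_one]; push_cast; linear_combination this
  have hrec : ∀ n : ℕ, ((n : ℂ) + 2) * gegComplex l z z' (n + 2) =
      2 * q * (n + 1 + l) * gegComplex l z z' (n + 1) - (n + 2 * l) * gegComplex l z z' n := by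
    intro n
    have := congrArg (PowerSeries.coeff (n + 1)) e
    simp only [map_sub, map_add, PowerSeries.coeff_C_mul, PowerSeries.coeff_succ_X_mul,
      PowerSeries.coeff_derivative, hc] at this
    rcases n with _ | n
    · simp at this ⊢
      linear_combination this
    · simp only [PowerSeries.coeff_succ_X_mul, PowerSeries.coeff_derivative, hc] at this
      push_cast at this ⊢
      linear_combination this
  induction N using Nat.twoStepInduction with
  | zero => exact h0
  | one => exact hr1
  | more n ih1 ih2 =>
    have h := hrec n
    have hg := congrArg (fun x : ℝ => (x : ℂ)) (geg_rec l n q)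
    push_cast at hg
    rw [ih1, ih2, ← hg] at h
    exact mul_left_cancel₀ (by exact_mod_cast (show n + 2 ≠ 0 by omega)) h

/-- The point of the unit circle with real part `q`. -/
lemma exists_unit_complex {q : ℝ} (hq : |q| ≤ 1) :
    ∃ z : ℂ, ‖z‖ = 1 ∧ z * starRingEnd ℂ z = 1 ∧ z + starRingEnd ℂ z = 2 * q := by
  refine ⟨⟨q, Real.sqrt (1 - q ^ 2)⟩, ?_⟩
  have h : Complex.normSq ⟨q, Real.sqrt (1 - q ^ 2)⟩ = 1 := by
    have : 0 ≤ 1 - q ^ 2 := by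
      have := sq_le_one_iff_abs_le_one q |>.2 hq; linarith
    rw [Complex.normSq_mk, Real.mul_self_sqrt this]; ring
  refine ⟨?_, ?_, ?_⟩
  · have := Complex.normSq_eq_norm_sq ⟨q, Real.sqrt (1 - q ^ 2)⟩
    rw [h] at this
    exact (pow_eq_one_iff_of_nonneg (norm_nonneg _) two_ne_zero).1 this.symm
  · rw [Complex.mul_conj, h]; simp
  · rw [Complex.add_conj]; simp

lemma one_sub_two_mul_add_sq_pos {q w : ℝ} (hq : |q| ≤ 1) (hw0 : 0 ≤ w) (hw : w < 1) :
    0 < 1 - 2 * w * q + w ^ 2 := by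
  have := (abs_le.1 hq).2
  nlinarith [mul_le_mul_of_nonneg_left this hw0, mul_pos (sub_pos.2 hw) (sub_pos.2 hw)]

/-- With `q = Re z`, `|z| = 1`, the polynomial is a sum of terms `z^i z̄^j` with nonnegative
coefficients when `l > 0`; the bound is its value at `q = 1`, hence uniform in `q`. -/
lemma abs_geg_mul_pow_le {l q w : ℝ} (hl : 0 < l) (hq : |q| ≤ 1) (hw0 : 0 ≤ w) (N : ℕ) :
    |geg l N q * w ^ N| ≤ gegMaj l w N := by
  obtain ⟨z, hz, h1, h2⟩ := exists_unit_complex hq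
  have h := gegComplex_eq l q h1 h2 N
  have : ‖gegComplex l z (starRingEnd ℂ z) N‖ ≤ ∑ i ∈ Finset.HasAntidiagonal.antidiagonal N,
      binCoeff l i.1 * binCoeff l i.2 := by
    refine (norm_sum_le _ _).trans (Finset.sum_le_sum fun i _ => ?_)
    simp [hz, abs_of_nonneg (binCoeff_nonneg hl _)]
  rw [h, Complex.norm_real, Real.norm_eq_abs] at this
  rw [abs_mul, abs_of_nonneg (pow_nonneg hw0 N)]
  refine (mul_le_mul_of_nonneg_right this (pow_nonneg hw0 N)).trans (le_of_eq ?_)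
  rw [gegMaj, Finset.sum_mul]
  refine Finset.sum_congr rfl fun i hi => ?_
  rw [← Finset.HasAntidiagonal.mem_antidiagonal.1 hi, pow_add]; ring

/-- The generating function of the Gegenbauer polynomials. -/
theorem hasSum_geg {l q w : ℝ} (hl : 0 < l) (hq : |q| ≤ 1) (hw0 : 0 ≤ w) (hw : w < 1) :
    HasSum (fun N => geg l N q * w ^ N) ((1 - 2 * w * q + w ^ 2) ^ (-l)) := by
  obtain ⟨z, hz, h1, h2⟩ := exists_unit_complex hq
  have hx : ‖z * w‖ < 1 := by simpa [hz, abs_of_nonneg hw0] using hw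
  have hx' : ‖starRingEnd ℂ z * w‖ < 1 := by simpa [hz, abs_of_nonneg hw0] using hw
  have s1 := hasSum_binCoeff l hx
  have s2 := hasSum_binCoeff l hx'
  have n1 : Summable fun n => ‖(binCoeff l n : ℂ) * (z * w) ^ n‖ := by
    simpa [hz, abs_of_nonneg hw0, abs_of_nonneg (binCoeff_nonneg hl _)] using
      summable_binCoeff (l := l) hw0 hw
  have n2 : Summable fun n => ‖(binCoeff l n : ℂ) * (starRingEnd ℂ z * w) ^ n‖ := by
    simpa [hz, abs_of_nonneg hw0, abs_of_nonneg (binCoeff_nonneg hl _)] using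
      summable_binCoeff (l := l) hw0 hw
  have hsum := (summable_norm_sum_mul_antidiagonal_of_summable_norm n1 n2).of_norm.hasSum
  rw [← tsum_mul_tsum_eq_tsum_sum_antidiagonal_of_summable_norm n1 n2, s1.tsum_eq, s2.tsum_eq] at hsum
  -- Since `1 - zw` has positive real part, the principal power commutes with conjugation, so the
  -- product is the inverse of `|1 - zw|^(2l)`, and `|1 - zw|² = 1 - 2wq + w²`.
  have hv : 1 / (1 - z * w) ^ (l : ℂ) * (1 / (1 - starRingEnd ℂ z * w) ^ (l : ℂ)) =
      (((1 - 2 * w * q + w ^ 2) ^ (-l) : ℝ) : ℂ) := by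
    have hre : 0 < (1 - z * w).re := by
      have := (Complex.re_le_norm (z * w)).trans_lt hx
      rw [Complex.sub_re, Complex.one_re]; linarith
    have harg : (1 - z * w).arg ≠ Real.pi := fun h => by
      have := (Complex.arg_eq_pi_iff.1 h).1; linarith
    have hc : (1 - starRingEnd ℂ z * w) ^ (l : ℂ) = starRingEnd ℂ ((1 - z * w) ^ (l : ℂ)) := by
      have := congrArg (starRingEnd ℂ) (Complex.cpow_conj (1 - z * w) (l : ℂ) harg)
      simpa using this.symm
    have hn : Complex.normSq (1 - z * w) = 1 - 2 * w * q + w ^ 2 := by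
      have : ((Complex.normSq (1 - z * w) : ℝ) : ℂ) = ((1 - 2 * w * q + w ^ 2 : ℝ) : ℂ) := by
        rw [← Complex.mul_conj]
        simp only [map_sub, map_one, map_mul, Complex.conj_ofReal]
        push_cast
        linear_combination (w : ℂ) ^ 2 * h1 - (w : ℂ) * h2
      exact_mod_cast this
    have hpos := one_sub_two_mul_add_sq_pos hq hw0 hw
    have hr : (‖1 - z * w‖ ^ l) ^ 2 = (1 - 2 * w * q + w ^ 2) ^ l := by
      rw [← hn, Complex.normSq_eq_norm_sq, ← Real.rpow_natCast, ← Real.rpow_natCast,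
        ← Real.rpow_mul (norm_nonneg _), ← Real.rpow_mul (norm_nonneg _), mul_comm l]
    rw [hc, one_div_mul_one_div, Complex.mul_conj, Complex.normSq_eq_norm_sq,
      Complex.norm_cpow_real, hr, Real.rpow_neg hpos.le]
    push_cast
    simp
  rw [hv] at hsum
  rw [← Complex.hasSum_ofReal]
  refine hsum.congr_fun ?_
  intro N
  push_cast
  rw [← gegComplex_eq l q h1 h2 N, gegComplex, Finset.sum_mul]
  refine Finset.sum_congr rfl fun i hi => ?_
  rw [← Finset.HasAntidiagonal.mem_antidiagonal.1 hi, pow_add]; ring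

/-! ### Beta integrals and the `L²` norms of Jacobi polynomials. -/

lemma integral_beta {p q : ℝ} (hp : 0 < p) (hq : 0 < q) :
    IntegrableOn (fun x : ℝ => x ^ (p - 1) * (1 - x) ^ (q - 1)) (Set.Ioo 0 1) ∧
    ∫ x in Set.Ioo (0 : ℝ) 1, x ^ (p - 1) * (1 - x) ^ (q - 1) =
      Real.Gamma p * Real.Gamma q / Real.Gamma (p + q) := by
  have hB := ProbabilityTheory.beta_pos hp hq
  have h1 := ProbabilityTheory.lintegral_betaPDF_eq_one hp hq
  rw [ProbabilityTheory.lintegral_betaPDF] at h1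
  set f : ℝ → ℝ := fun x => 1 / ProbabilityTheory.beta p q * x ^ (p - 1) * (1 - x) ^ (q - 1)
  have hf0 : ∀ᵐ x ∂volume.restrict (Set.Ioo (0 : ℝ) 1), 0 ≤ f x := by
    filter_upwards [ae_restrict_mem measurableSet_Ioo] with x hx
    have h0 := hx.1
    have h1 := sub_pos.2 hx.2
    simp only [f]; positivity
  have hfm : AEStronglyMeasurable f (volume.restrict (Set.Ioo (0 : ℝ) 1)) := by
    apply Measurable.aestronglyMeasurable; simp only [f]; fun_prop
  have hfi : IntegrableOn f (Set.Ioo 0 1) := by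
    refine ⟨hfm, ?_⟩
    rw [hasFiniteIntegral_iff_ofReal hf0, h1]; simp
  have hint : ∫ x in Set.Ioo (0 : ℝ) 1, f x = 1 := by
    rw [integral_eq_lintegral_of_nonneg_ae hf0 hfm, h1]; simp
  have he : (fun x : ℝ => x ^ (p - 1) * (1 - x) ^ (q - 1)) =
      fun x => ProbabilityTheory.beta p q * f x := by
    funext x; simp only [f]; field_simp
  rw [he]
  refine ⟨hfi.const_mul _, ?_⟩
  rw [integral_const_mul, hint, mul_one, ProbabilityTheory.beta]

lemma sin_half_sq_image :
    (fun τ : ℝ => Real.sin (τ / 2) ^ 2) '' Set.Ioo 0 Real.pi = Set.Ioo 0 1 := by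
  ext x
  constructor
  · rintro ⟨τ, ⟨h0, h1⟩, rfl⟩
    have hs : 0 < Real.sin (τ / 2) := Real.sin_pos_of_pos_of_lt_pi (by linarith) (by linarith)
    have hc : 0 < Real.cos (τ / 2) := Real.cos_pos_of_mem_Ioo ⟨by linarith, by linarith⟩
    refine ⟨by positivity, ?_⟩
    have := Real.sin_sq_add_cos_sq (τ / 2)
    have : 0 < Real.cos (τ / 2) ^ 2 := by positivity
    simp only
    linarith
  · rintro ⟨h0, h1⟩
    have hs0 : 0 < Real.sqrt x := Real.sqrt_pos.2 h0
    have hs1 : Real.sqrt x < 1 := by rw [Real.sqrt_lt' one_pos]; simpa using h1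
    refine ⟨2 * Real.arcsin (Real.sqrt x), ⟨?_, ?_⟩, ?_⟩
    · have := Real.arcsin_pos.2 hs0; linarith
    · have := Real.arcsin_lt_pi_div_two.2 hs1; linarith
    · simp only
      rw [mul_div_cancel_left₀ _ two_ne_zero, Real.sin_arcsin (by linarith) hs1.le,
        Real.sq_sqrt h0.le]

lemma sin_half_sq_injOn : Set.InjOn (fun τ : ℝ => Real.sin (τ / 2) ^ 2) (Set.Ioo 0 Real.pi) := by
  intro x hx y hy h
  have hx1 : 0 < Real.sin (x / 2) :=
    Real.sin_pos_of_pos_of_lt_pi (by linarith [hx.1]) (by linarith [hx.1, hx.2])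
  have hy1 : 0 < Real.sin (y / 2) :=
    Real.sin_pos_of_pos_of_lt_pi (by linarith [hy.1]) (by linarith [hy.1, hy.2])
  have h2 := (pow_left_inj₀ hx1.le hy1.le two_ne_zero).1 h
  have := Real.injOn_sin (x₁ := x / 2) (x₂ := y / 2) ⟨by linarith [hx.1, hx.2], by linarith [hx.2]⟩
    ⟨by linarith [hy.1, hy.2], by linarith [hy.2]⟩ h2
  linarith

/-- The substitution `x = sin² (τ/2)` in an integral against the Jacobi measure. -/
lemma integral_jacobiMeasure (α β : ℝ) (G : ℝ → ℝ) :
    ∫ τ, G (Real.sin (τ / 2) ^ 2) ∂(jacobiMeasure α β) =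
      ∫ x in Set.Ioo (0 : ℝ) 1, x ^ α * (1 - x) ^ β * G x := by
  have hd : ∀ τ ∈ Set.Ioo 0 Real.pi, HasDerivWithinAt (fun τ : ℝ => Real.sin (τ / 2) ^ 2)
      (Real.sin (τ / 2) * Real.cos (τ / 2)) (Set.Ioo 0 Real.pi) τ := by
    intro τ _
    have := (((Real.hasDerivAt_sin (τ / 2)).comp τ ((hasDerivAt_id τ).div_const 2)).pow 2)
    refine (this.congr_deriv ?_).hasDerivWithinAt
    simp [Function.comp]; ring
  rw [← sin_half_sq_image, integral_image_eq_integral_abs_deriv_smul measurableSet_Ioo hd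
    sin_half_sq_injOn, jacobiMeasure, integral_withDensity_eq_integral_toReal_smul
      (by fun_prop) (by simp), integral_Icc_eq_integral_Ioo]
  refine setIntegral_congr_fun measurableSet_Ioo fun τ hτ => ?_
  have hs : 0 < Real.sin (τ / 2) :=
    Real.sin_pos_of_pos_of_lt_pi (by linarith [hτ.1]) (by linarith [hτ.1, hτ.2])
  have hc : 0 < Real.cos (τ / 2) :=
    Real.cos_pos_of_mem_Ioo ⟨by linarith [hτ.1, hτ.2], by linarith [hτ.2]⟩
  have e : 1 - Real.sin (τ / 2) ^ 2 = Real.cos (τ / 2) ^ 2 := by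
    rw [Real.cos_sq']
  have p1 : ∀ {x : ℝ} (c : ℝ), 0 < x → x ^ (2 * c + 1) = (x ^ 2) ^ c * x := by
    intro x c hx
    rw [Real.rpow_add_one hx.ne', Real.rpow_mul hx.le]; norm_num
  simp only [smul_eq_mul]
  rw [ENNReal.toReal_ofReal (by positivity), abs_of_pos (by positivity), e, p1 _ hs, p1 _ hc]
  ring

lemma rpow_mul_pow_beta {a b x : ℝ} (hx : x ∈ Set.Ioo (0 : ℝ) 1) (k i : ℕ) :
    x ^ (a - 1) * (1 - x) ^ (b - 1) * (x ^ k * (1 - x) ^ i) =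
      x ^ (a + k - 1) * (1 - x) ^ (b + i - 1) := by
  have h1 : 0 < 1 - x := sub_pos.2 hx.2
  rw [add_sub_right_comm a, add_sub_right_comm b, Real.rpow_add_natCast hx.1.ne',
    Real.rpow_add_natCast h1.ne']
  ring

/-- Integrating term by term gives beta values whose sum is Chu–Vandermonde. For `c = n+a+b-1` the
numerator is `(i+1-n)_n`, which vanishes for `i < n`: this is the orthogonality of Jacobi
polynomials. -/
lemma integrableOn_hyp_mul_pow {a b : ℝ} (ha : 0 < a) (hb : 0 < b) (n : ℕ) (c : ℝ) (i : ℕ) :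
    IntegrableOn (fun x : ℝ => x ^ (a - 1) * (1 - x) ^ (b - 1) * (hyp n c a x * (1 - x) ^ i))
      (Set.Ioo 0 1) ∧
    ∫ x in Set.Ioo (0 : ℝ) 1, x ^ (a - 1) * (1 - x) ^ (b - 1) * (hyp n c a x * (1 - x) ^ i) =
      Real.Gamma a * Real.Gamma (b + i) / Real.Gamma (a + b + i) *
        (poch (a + b + i - c) n / poch (a + b + i) n) := by
  have he : Set.EqOn (fun x : ℝ => x ^ (a - 1) * (1 - x) ^ (b - 1) * (hyp n c a x * (1 - x) ^ i))
      (fun x => ∑ k ∈ Finset.range (n + 1),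
        poch (-(n : ℝ)) k * poch c k / (poch a k * k.factorial) *
          (x ^ (a + k - 1) * (1 - x) ^ (b + i - 1))) (Set.Ioo 0 1) := by
    intro x hx
    simp only [hyp, Finset.sum_mul, Finset.mul_sum]
    refine Finset.sum_congr rfl fun k _ => ?_
    rw [← rpow_mul_pow_beta hx]; ring
  have hB := fun k : ℕ => integral_beta (p := a + k) (q := b + i) (by positivity) (by positivity)
  refine ⟨?_, ?_⟩
  · rw [integrableOn_congr_fun he measurableSet_Ioo]
    exact integrable_finsetSum _ fun k _ => (hB k).1.const_mul _
  · rw [setIntegral_congr_fun measurableSet_Ioo he,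
      integral_finsetSum _ fun k _ => (hB k).1.const_mul _,
      ← sum_choose_poch_div_poch n c (by positivity : 0 < a + b + i), Finset.mul_sum]
    refine Finset.sum_congr rfl fun k _ => ?_
    have h0 : 0 < a + b + i := by positivity
    have h1 := (poch_pos ha k).ne'
    have h2 := (poch_pos h0 k).ne'
    have h3 := (Real.Gamma_pos_of_pos h0).ne'
    rw [integral_const_mul, (hB k).2, Gamma_add_natCast ha,
      show a + k + (b + i) = a + b + i + k by ring, Gamma_add_natCast h0, poch_neg_natCast]
    field_simp

lemma poch_natCast_sub_eq_zero {n i : ℕ} (h : i < n) : poch ((i : ℝ) + 1 - n) n = 0 := by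
  have : (i : ℝ) + 1 - n = -((n - 1 - i : ℕ) : ℝ) := by
    rw [Nat.cast_sub (by omega), Nat.cast_sub (by omega)]; push_cast; ring
  rw [this, poch_neg_natCast_of_lt (by omega)]

/-- The square of the `L²` norm of the hypergeometric form of a Jacobi polynomial. -/
noncomputable def hypNormSq (a b : ℝ) (n : ℕ) : ℝ :=
  n.factorial * poch (n + a + b - 1) n / poch (a + b + n) n *
    (Real.Gamma a * Real.Gamma (b + n) / (poch a n * Real.Gamma (a + b + n)))

lemma integral_hyp_sq {a b : ℝ} (ha : 0 < a) (hb : 0 < b) (n : ℕ) :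
    ∫ x in Set.Ioo (0 : ℝ) 1, x ^ (a - 1) * (1 - x) ^ (b - 1) * hyp n (n + a + b - 1) a x ^ 2 =
      hypNormSq a b n := by
  set c := (n : ℝ) + a + b - 1 with hc
  have hpa := (poch_pos ha n).ne'
  have hpb := (poch_pos hb n).ne'
  -- One of the two factors is expanded in powers of `1 - x`; by orthogonality only the top power `i
  -- = n` survives integration.
  have hF : ∀ x, hyp n c a x = (-1) ^ n * poch b n / poch a n * hyp n c b (1 - x) := by
    intro x
    rw [hc, hyp_one_sub ha hb n x]
    have : ((-1 : ℝ) ^ n) * (-1) ^ n = 1 := by rw [← mul_pow]; simp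
    field_simp
    linear_combination (-hyp n (n + a + b - 1) a x) * this
  have he : (fun x : ℝ => x ^ (a - 1) * (1 - x) ^ (b - 1) * hyp n c a x ^ 2) = fun x =>
      ∑ i ∈ Finset.range (n + 1), ((-1) ^ n * poch b n / poch a n *
        (poch (-(n : ℝ)) i * poch c i / (poch b i * i.factorial))) *
        (x ^ (a - 1) * (1 - x) ^ (b - 1) * (hyp n c a x * (1 - x) ^ i)) := by
    funext x
    have : hyp n c a x ^ 2 = hyp n c a x * ((-1) ^ n * poch b n / poch a n * hyp n c b (1 - x)) := by
      rw [← hF, sq]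
    rw [this]
    conv_lhs => rw [hyp.eq_def n c b]
    simp only [Finset.mul_sum]
    exact Finset.sum_congr rfl fun k _ => by ring
  have hI := fun i : ℕ => integrableOn_hyp_mul_pow ha hb n c i
  rw [he, integral_finsetSum _ fun i _ => (hI i).1.const_mul _]
  simp only [integral_const_mul, (hI _).2]
  have hs : ∀ i : ℕ, a + b + i - c = i + 1 - n := fun i => by rw [hc]; ring
  rw [Finset.sum_range_succ, Finset.sum_eq_zero, zero_add, hs, hypNormSq, ← hc,
    poch_neg_natCast_self, show (n : ℝ) + 1 - n = 1 by ring,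
    show poch 1 n = n.factorial from ascPochhammer_eval_one ℝ n]
  · have h0 : 0 < a + b + n := by positivity
    have h2 := (poch_pos h0 n).ne'
    have h3 := (Real.Gamma_pos_of_pos h0).ne'
    have : ((-1 : ℝ) ^ n) * (-1) ^ n = 1 := by rw [← mul_pow]; simp
    have h4 : (n.factorial : ℝ) ≠ 0 := by positivity
    field_simp
    linear_combination (poch c n) * this
  · intro i hi
    rw [hs, poch_natCast_sub_eq_zero (Finset.mem_range.1 hi)]; simp

/-- The normalizing factor `Γ(a+b) / (Γ(a) Γ(b))`. -/
noncomputable def betaInv (a b : ℝ) : ℝ := Real.Gamma (a + b) / (Real.Gamma a * Real.Gamma b)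

lemma betaInv_pos {a b : ℝ} (ha : 0 < a) (hb : 0 < b) : 0 < betaInv a b := by
  have := Real.Gamma_pos_of_pos ha
  have := Real.Gamma_pos_of_pos hb
  have := Real.Gamma_pos_of_pos (add_pos ha hb)
  unfold betaInv; positivity

lemma hypNormSq_zero (a b : ℝ) : hypNormSq a b 0 = (betaInv a b)⁻¹ := by
  simp [hypNormSq, betaInv]

/-- Stated at `n+1` because the simplified formula involves `(a+b)` with index one below the degree;
degree 0 is treated apart. The shape is the one met in `gegMoment_succ_sub`. -/
lemma hypNormSq_succ_inv {a b : ℝ} (ha : 0 < a) (hb : 0 < b) (n : ℕ) :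
    0 < hypNormSq a b (n + 1) ∧ (hypNormSq a b (n + 1))⁻¹ = betaInv a b *
      ((2 * n + 1 + a + b) * poch (a + b) n / (n + 1).factorial *
        (poch a (n + 1) / poch b (n + 1))) := by
  have h0 : 0 < a + b := by positivity
  have g1 := Real.Gamma_pos_of_pos ha
  have g2 := Real.Gamma_pos_of_pos hb
  have g3 := Real.Gamma_pos_of_pos h0
  have p1 := poch_pos ha (n + 1)
  have p2 := poch_pos hb (n + 1)
  have p3 := poch_pos h0 n
  have p4 := poch_pos (by positivity : 0 < a + b + n + 1) n
  have e : hypNormSq a b (n + 1) = (n + 1).factorial * poch b (n + 1) *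
      Real.Gamma a * Real.Gamma b /
      ((2 * n + 1 + a + b) * poch (a + b) n * poch a (n + 1) * Real.Gamma (a + b)) := by
    have e1 : poch (((n + 1 : ℕ) : ℝ) + a + b - 1) (n + 1) =
        (a + b + n) * poch (a + b + n + 1) n := by
      rw [poch_succ_left]; push_cast; congr 2 <;> ring
    have e2 : poch (a + b + ((n + 1 : ℕ) : ℝ)) (n + 1) =
        poch (a + b + n + 1) n * (2 * n + 1 + a + b) := by
      rw [poch_succ]; push_cast; rw [← add_assoc]; ring
    rw [hypNormSq, e1, e2, Gamma_add_natCast h0, Gamma_add_natCast hb, poch_succ (a + b)]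
    field_simp
  rw [e]
  refine ⟨by positivity, ?_⟩
  rw [betaInv]
  field_simp

/-! ### Products of normalized Jacobi polynomials as differences of Gegenbauer moments. -/

/-- The value of the even Gegenbauer polynomial `C_{2n}^{(a+b)}` under the moment functional. -/
noncomputable def gegMoment (a b x y : ℝ) (n : ℕ) : ℝ :=
  ∑ j ∈ Finset.range (n + 1), (-1) ^ (n - j) * poch (a + b) (n + j) / (n - j).factorial *
    (appellBlock a b y j).eval x

/-- In the block of degree `j` the two contributions combine through `(a+b+n+j) + (n-j+1) =
2n+1+a+b`, which does not depend on `j`; what remains is the coefficient of the Appell polynomial.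
The block `j = n+1` comes from the first moment only. -/
lemma gegMoment_succ_sub (a b x y : ℝ) (n : ℕ) :
    gegMoment a b x y (n + 1) - gegMoment a b x y n =
      (-1) ^ (n + 1) * (2 * n + 1 + a + b) * poch (a + b) n / (n + 1).factorial *
        (appell a b (n + 1) y).eval x := by
  simp only [gegMoment, appell, Polynomial.eval_finsetSum, Polynomial.eval_mul, Polynomial.eval_C,
    Finset.mul_sum]
  rw [Finset.sum_range_succ, Finset.sum_range_succ (n := n + 1), add_sub_right_comm,
    ← Finset.sum_sub_distrib]
  congr 1
  · refine Finset.sum_congr rfl fun j hj => ?_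
    have hj : j ≤ n := by have := Finset.mem_range.1 hj; omega
    obtain ⟨m, rfl⟩ := Nat.exists_eq_add_of_le hj
    have e1 : poch (((j + m + 1 : ℕ) : ℝ) + a + b - 1) j = poch (a + b + (j + m : ℕ)) j := by
      congr 1; push_cast; ring
    have e2 : ((j + m + 1).choose j : ℝ) * (j.factorial * (m + 1).factorial) =
        (j + m + 1).factorial := by
      have := Nat.choose_mul_factorial_mul_factorial (show j ≤ j + m + 1 by omega)
      rw [show j + m + 1 - j = m + 1 by omega, mul_assoc] at this
      exact_mod_cast this
    have e3 : ((-1 : ℝ) ^ j) * (-1) ^ j = 1 := by rw [← mul_pow]; simp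
    rw [show j + m + 1 - j = m + 1 by omega, show j + m - j = m by omega, poch_neg_natCast, e1,
      show j + m + 1 + j = (j + m) + j + 1 by omega, poch_succ, poch_add _ (j + m) j, ← e2,
      Nat.factorial_succ m]
    have h1 : ((j + m + 1).choose j : ℝ) ≠ 0 := by
      exact_mod_cast (Nat.choose_pos (by omega)).ne'
    push_cast
    field_simp
    linear_combination ((-1) ^ m * (2 * j + 2 * m + 1 + a + b) * poch (a + b) (j + m) *
      poch (a + b + (j + m)) j * (appellBlock a b y j).eval x) * e3
  · have e1 : poch (((n + 1 : ℕ) : ℝ) + a + b - 1) (n + 1) = poch (a + b + n) n * (a + b + n + n) := by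
      rw [poch_succ]; push_cast; congr 2 <;> ring
    have e3 : ((-1 : ℝ) ^ (n + 1)) * (-1) ^ (n + 1) = 1 := by rw [← mul_pow]; simp
    rw [e1, Nat.sub_self, show n + 1 + (n + 1) = n + n + 1 + 1 by omega, poch_succ, poch_succ,
      poch_add, poch_neg_natCast_self]
    have : ((n + 1).factorial : ℝ) ≠ 0 := by positivity
    push_cast
    field_simp
    linear_combination (-(2 * n + 1 + a + b) * (a + b + n + n) * poch (a + b) n *
      poch (a + b + n) n * (appellBlock a b y (n + 1)).eval x) * e3

lemma sin_half_sq (θ : ℝ) : (1 - Real.cos θ) / 2 = Real.sin (θ / 2) ^ 2 := by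
  rw [Real.sin_sq_eq_half_sub, mul_div_cancel₀ _ two_ne_zero]; ring

/-- The prefactor `(α+1)_n / n!` cancels against its square in the norm, so only the hypergeometric
form matters. -/
lemma jacobiTrig_mul {α β : ℝ} (hα : -1 < α) (hβ : -1 < β) (n : ℕ) (θ φ : ℝ)
    (hn : 0 < hypNormSq (α + 1) (β + 1) n) :
    jacobiTrig α β n θ * jacobiTrig α β n φ = (hypNormSq (α + 1) (β + 1) n)⁻¹ *
      (hyp n (n + (α + 1) + (β + 1) - 1) (α + 1) (Real.sin (θ / 2) ^ 2) *
        hyp n (n + (α + 1) + (β + 1) - 1) (α + 1) (Real.sin (φ / 2) ^ 2)) := by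
  have ha : 0 < α + 1 := by linarith
  have hb : 0 < β + 1 := by linarith
  have hP : ∀ τ, jacobiPoly α β n (Real.cos τ) = poch (α + 1) n / n.factorial *
      hyp n (n + (α + 1) + (β + 1) - 1) (α + 1) (Real.sin (τ / 2) ^ 2) := by
    intro τ
    rw [jacobiPoly_eq, sin_half_sq]; congr 2; ring
  have hI : ∫ τ, jacobiPoly α β n (Real.cos τ) ^ 2 ∂(jacobiMeasure α β) =
      (poch (α + 1) n / n.factorial) ^ 2 * hypNormSq (α + 1) (β + 1) n := by
    simp only [hP, mul_pow]
    rw [integral_const_mul, integral_jacobiMeasure α β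
      (fun x => hyp n (n + (α + 1) + (β + 1) - 1) (α + 1) x ^ 2), ← integral_hyp_sq ha hb]
    simp only [add_sub_cancel_right]
  have hp : poch (α + 1) n / n.factorial ≠ 0 := div_ne_zero (poch_pos ha n).ne' (by positivity)
  rw [jacobiTrig, jacobiTrig, div_mul_div_comm, Real.mul_self_sqrt (by rw [hI]; positivity), hI, hP, hP,
    ← div_eq_inv_mul]
  generalize poch (α + 1) n / n.factorial = p at hp
  field_simp

lemma jacobiTrig_mul_zero {α β : ℝ} (hα : -1 < α) (hβ : -1 < β) (θ φ : ℝ) :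
    jacobiTrig α β 0 θ * jacobiTrig α β 0 φ = betaInv (α + 1) (β + 1) *
      gegMoment (α + 1) (β + 1) (Real.sin (θ / 2) ^ 2) (Real.sin (φ / 2) ^ 2) 0 := by
  have h := betaInv_pos (show 0 < α + 1 by linarith) (show 0 < β + 1 by linarith)
  rw [jacobiTrig_mul hα hβ 0 θ φ (by rw [hypNormSq_zero]; positivity), hypNormSq_zero]
  simp [hyp, gegMoment, appellBlock]

/-- The inverse norm carries `(a)_{n+1}/(b)_{n+1}`, exactly the constant in Bailey's factorization;
the sign from that factorization cancels the one in the moment difference. -/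
lemma jacobiTrig_mul_succ {α β : ℝ} (hα : -1 < α) (hβ : -1 < β) (θ φ : ℝ) (n : ℕ) :
    jacobiTrig α β (n + 1) θ * jacobiTrig α β (n + 1) φ = betaInv (α + 1) (β + 1) *
      (gegMoment (α + 1) (β + 1) (Real.sin (θ / 2) ^ 2) (Real.sin (φ / 2) ^ 2) (n + 1) -
        gegMoment (α + 1) (β + 1) (Real.sin (θ / 2) ^ 2) (Real.sin (φ / 2) ^ 2) n) := by
  have ha : 0 < α + 1 := by linarith
  have hb : 0 < β + 1 := by linarith
  obtain ⟨h0, h1⟩ := hypNormSq_succ_inv ha hb n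
  rw [jacobiTrig_mul hα hβ _ θ φ h0, h1, gegMoment_succ_sub, eval_appell ha hb]
  have e3 : ((-1 : ℝ) ^ (n + 1)) * (-1) ^ (n + 1) = 1 := by rw [← mul_pow]; simp
  rw [mul_assoc (betaInv _ _)]
  congr 1
  generalize hyp (n + 1) _ _ _ * hyp (n + 1) _ _ _ = H
  linear_combination (-((2 * n + 1 + (α + 1) + (β + 1)) * poch (α + 1 + (β + 1)) n /
    (n + 1).factorial * (poch (α + 1) (n + 1) / poch (β + 1) (n + 1)) * H)) * e3

/-! ### Moments of `dΠ_ν` and their continuation to `-1 < ν < -1/2`. -/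

/-- The moments of `dΠ_ν`. -/
noncomputable def piMoment (ν : ℝ) (k : ℕ) : ℝ :=
  if Even k then poch (1 / 2) (k / 2) / poch (ν + 1) (k / 2) else 0

lemma piMoment_two_mul (ν : ℝ) (m : ℕ) :
    piMoment ν (2 * m) = poch (1 / 2) m / poch (ν + 1) m := by
  simp [piMoment]

lemma piMoment_odd (ν : ℝ) {k : ℕ} (hk : Odd k) : piMoment ν k = 0 := by
  simp [piMoment, Nat.not_even_iff_odd.2 hk]

/-- The substitution `x = u²` turns this into a beta integral. -/
lemma integral_even_pow_mul {p : ℝ} (hp : 0 < p) (m : ℕ) :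
    IntervalIntegrable (fun u : ℝ => u ^ (2 * m) * (1 - u ^ 2) ^ (p - 1)) volume 0 1 ∧
    ∫ u in (0 : ℝ)..1, u ^ (2 * m) * (1 - u ^ 2) ^ (p - 1) =
      Real.Gamma (1 / 2 + m) * Real.Gamma p / (2 * Real.Gamma (1 / 2 + p + m)) := by
  obtain ⟨h1, h2⟩ := integral_beta (p := 1 / 2 + m) (q := p) (by positivity) hp
  have himg : (fun u : ℝ => u ^ 2) '' Set.Ioo 0 1 = Set.Ioo 0 1 := by
    ext x
    constructor
    · rintro ⟨u, ⟨h0, h1⟩, rfl⟩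
      exact ⟨by positivity, by simp only; nlinarith⟩
    · rintro ⟨h0, h1⟩
      exact ⟨Real.sqrt x, ⟨Real.sqrt_pos.2 h0, by rw [Real.sqrt_lt' one_pos]; simpa using h1⟩,
        Real.sq_sqrt h0.le⟩
  have hd : ∀ u ∈ Set.Ioo (0 : ℝ) 1,
      HasDerivWithinAt (fun u : ℝ => u ^ 2) (2 * u) (Set.Ioo 0 1) u := fun u _ => by
    simpa using (hasDerivAt_pow 2 u).hasDerivWithinAt
  have hinj : Set.InjOn (fun u : ℝ => u ^ 2) (Set.Ioo 0 1) := fun x hx y hy h =>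
    (pow_left_inj₀ hx.1.le hy.1.le two_ne_zero).1 h
  have hEq : Set.EqOn (fun u : ℝ => |2 * u| • ((u ^ 2) ^ (1 / 2 + (m : ℝ) - 1) *
      (1 - u ^ 2) ^ (p - 1))) (fun u => 2 * (u ^ (2 * m) * (1 - u ^ 2) ^ (p - 1))) (Set.Ioo 0 1) := by
    intro u hu
    have hu0 := hu.1
    simp only [smul_eq_mul]
    have : (u ^ 2) ^ (1 / 2 + (m : ℝ) - 1) * u = u ^ (2 * m) := by
      rw [← Real.rpow_natCast u 2, ← Real.rpow_mul hu0.le, ← Real.rpow_add_one hu0.ne',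
        ← Real.rpow_natCast]
      congr 1; push_cast; ring
    rw [abs_of_pos (by positivity), ← this]; ring
  rw [← himg, integrableOn_image_iff_integrableOn_abs_deriv_smul measurableSet_Ioo hd hinj,
    integrableOn_congr_fun hEq measurableSet_Ioo] at h1
  rw [← himg, integral_image_eq_integral_abs_deriv_smul measurableSet_Ioo hd hinj,
    setIntegral_congr_fun measurableSet_Ioo hEq, integral_const_mul] at h2
  constructor
  · rw [intervalIntegrable_iff_integrableOn_Ioo_of_le zero_le_one]
    have h3 : IntegrableOn _ (Set.Ioo (0 : ℝ) 1) := h1.const_mul (1 / 2)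
    exact h3.congr_fun (fun u _ => by ring) measurableSet_Ioo
  · rw [intervalIntegral.integral_of_le zero_le_one, integral_Ioc_eq_integral_Ioo]
    rw [show 1 / 2 + p + (m : ℝ) = 1 / 2 + m + p by ring, mul_comm 2 (Real.Gamma _), ← div_div, ← h2]
    ring

lemma intervalIntegrable_one_sub_sq {p : ℝ} (hp : 0 < p) :
    IntervalIntegrable (fun u : ℝ => (1 - u ^ 2) ^ (p - 1)) volume (-1) 1 := by
  have h := (integral_even_pow_mul hp 0).1
  simp only [mul_zero, pow_zero, one_mul] at h
  have h2 := (IntervalIntegrable.iff_comp_neg).1 h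
  simp only [even_two, Even.neg_pow, neg_zero] at h2
  exact h2.symm.trans h

lemma intervalIntegrable_pow_mul_piDensity {ν : ℝ} (hν : -1 / 2 < ν) (k : ℕ) :
    IntervalIntegrable (fun u : ℝ => u ^ k * piDensity ν u) volume (-1) 1 := by
  have h := intervalIntegrable_one_sub_sq (show 0 < ν + 1 / 2 by linarith)
  rw [show ν + 1 / 2 - 1 = ν - 1 / 2 by ring] at h
  exact (h.const_mul _).continuousOn_mul (by fun_prop)

lemma piDensity_neg (ν u : ℝ) : piDensity ν (-u) = piDensity ν u := by
  simp [piDensity]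

lemma subset_uIcc_left : Set.uIcc (-1 : ℝ) 0 ⊆ Set.uIcc (-1) 1 := by
  rw [Set.uIcc_of_le (by norm_num), Set.uIcc_of_le (by norm_num)]
  exact Set.Icc_subset_Icc_right (by norm_num)

lemma subset_uIcc_right : Set.uIcc (0 : ℝ) 1 ⊆ Set.uIcc (-1) 1 := by
  rw [Set.uIcc_of_le (by norm_num), Set.uIcc_of_le (by norm_num)]
  exact Set.Icc_subset_Icc_left (by norm_num)

lemma integral_neg_one_zero_pow_mul_piDensity (ν : ℝ) (k : ℕ) :
    ∫ u in (-1 : ℝ)..0, u ^ k * piDensity ν u =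
      (-1) ^ k * ∫ u in (0 : ℝ)..1, u ^ k * piDensity ν u := by
  have h := intervalIntegral.integral_comp_neg (a := 0) (b := 1) fun u : ℝ => u ^ k * piDensity ν u
  rw [neg_zero] at h
  rw [← h, ← intervalIntegral.integral_const_mul]
  congr 1
  funext u
  rw [piDensity_neg, neg_pow]; ring

lemma integral_zero_one_even_pow_mul_piDensity {ν : ℝ} (hν : -1 / 2 < ν) (m : ℕ) :
    ∫ u in (0 : ℝ)..1, u ^ (2 * m) * piDensity ν u = piMoment ν (2 * m) / 2 := by
  have h := (integral_even_pow_mul (show 0 < ν + 1 / 2 by linarith) m).2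
  rw [show ν + 1 / 2 - 1 = ν - 1 / 2 by ring] at h
  have e : (fun u : ℝ => u ^ (2 * m) * piDensity ν u) = fun u =>
      Real.Gamma (ν + 1) / (Real.sqrt Real.pi * Real.Gamma (ν + 1 / 2)) *
        (u ^ (2 * m) * (1 - u ^ 2) ^ (ν - 1 / 2)) := by
    funext u; rw [piDensity]; ring
  have hν1 : 0 < ν + 1 := by linarith
  have g1 := (Real.Gamma_pos_of_pos hν1).ne'
  have g2 := (Real.Gamma_pos_of_pos (show 0 < ν + 1 / 2 by linarith)).ne'
  have p1 := (poch_pos hν1 m).ne'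
  have hs : Real.sqrt Real.pi ≠ 0 := (Real.sqrt_pos.2 Real.pi_pos).ne'
  rw [e, intervalIntegral.integral_const_mul, h, piMoment_two_mul,
    show 1 / 2 + (ν + 1 / 2) + (m : ℝ) = ν + 1 + m by ring, Gamma_add_natCast (by norm_num),
    Gamma_add_natCast hν1, Real.Gamma_one_half_eq]
  generalize Real.Gamma (ν + 1 / 2) = G at g2
  field_simp

lemma integral_pow_mul_piDensity {ν : ℝ} (hν : -1 / 2 < ν) (k : ℕ) :
    ∫ u in (-1 : ℝ)..1, u ^ k * piDensity ν u = piMoment ν k := by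
  have hi := intervalIntegrable_pow_mul_piDensity hν k
  rw [← intervalIntegral.integral_add_adjacent_intervals
    (hi.mono_set subset_uIcc_left) (hi.mono_set subset_uIcc_right),
    integral_neg_one_zero_pow_mul_piDensity]
  rcases Nat.even_or_odd k with hk | hk
  · obtain ⟨m, rfl⟩ := even_iff_exists_two_mul.1 hk
    rw [hk.neg_one_pow, integral_zero_one_even_pow_mul_piDensity hν]; ring
  · rw [hk.neg_one_pow, piMoment_odd _ hk]; ring

lemma piDensity_nonneg {ν u : ℝ} (hν : -1 / 2 < ν) (hu : u ∈ Set.Ioo (-1 : ℝ) 1) :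
    0 ≤ piDensity ν u := by
  have g1 := Real.Gamma_pos_of_pos (show 0 < ν + 1 by linarith)
  have g2 := Real.Gamma_pos_of_pos (show 0 < ν + 1 / 2 by linarith)
  have : 0 < 1 - u ^ 2 := by nlinarith [hu.1, hu.2]
  unfold piDensity; positivity

lemma measurable_piDensity (ν : ℝ) : Measurable (piDensity ν) := by
  unfold piDensity; fun_prop

lemma piMeasure_neg_half :
    piMeasure (-1 / 2) = (2⁻¹ : ENNReal) • (Measure.dirac (-1 : ℝ) + Measure.dirac (1 : ℝ)) := by
  simp [piMeasure]

lemma piMeasure_of_gt {ν : ℝ} (hν : -1 / 2 < ν) :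
    piMeasure ν = (volume.restrict (Set.Ioo (-1) 1)).withDensity
      fun w => ENNReal.ofReal (piDensity ν w) := by
  simp [piMeasure, hν.ne']

lemma isFiniteMeasure_piMeasure {ν : ℝ} (hν : -1 / 2 ≤ ν) : IsFiniteMeasure (piMeasure ν) := by
  rcases hν.eq_or_lt with rfl | hν
  · rw [piMeasure_neg_half]
    exact Measure.smul_finite _ (by simp)
  · rw [piMeasure_of_gt hν]
    apply isFiniteMeasure_withDensity_ofReal
    have h := intervalIntegrable_pow_mul_piDensity hν 0
    rw [intervalIntegrable_iff_integrableOn_Ioo_of_le (by norm_num)] at h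
    simp only [pow_zero, one_mul] at h
    exact h.2

lemma ae_piMeasure_mem {ν : ℝ} (hν : -1 / 2 ≤ ν) : ∀ᵐ u ∂(piMeasure ν), u ∈ Set.Icc (-1 : ℝ) 1 := by
  rcases hν.eq_or_lt with rfl | hν
  · rw [piMeasure_neg_half]
    refine Measure.ae_smul_measure ?_ _
    rw [ae_add_measure_iff]
    constructor <;> · rw [ae_dirac_eq]; simp
  · rw [piMeasure_of_gt hν]
    refine (withDensity_absolutelyContinuous _ _).ae_le ?_
    filter_upwards [ae_restrict_mem measurableSet_Ioo] with u hu using Set.Ioo_subset_Icc_self hu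

lemma integral_pow_piMeasure {ν : ℝ} (hν : -1 / 2 ≤ ν) (k : ℕ) :
    ∫ u, u ^ k ∂(piMeasure ν) = piMoment ν k := by
  rcases hν.eq_or_lt with rfl | hν
  · have : ∫ u : ℝ, u ^ k ∂(piMeasure (-1 / 2)) = ((-1) ^ k + 1) / 2 := by
      rw [piMeasure_neg_half, integral_smul_measure, integral_add_measure, integral_dirac,
        integral_dirac]
      · simp; ring
      all_goals exact integrable_dirac (by simp)
    rw [this]
    rcases Nat.even_or_odd k with hk | hk
    · obtain ⟨m, rfl⟩ := even_iff_exists_two_mul.1 hk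
      have := (poch_pos (show (0 : ℝ) < 1 / 2 by norm_num) m).ne'
      rw [hk.neg_one_pow, piMoment_two_mul, show (-1 / 2 : ℝ) + 1 = 1 / 2 by norm_num, div_self this]
      norm_num
    · rw [hk.neg_one_pow, piMoment_odd _ hk]; norm_num
  · rw [piMeasure_of_gt hν, integral_withDensity_eq_integral_toReal_smul
      (measurable_piDensity ν).ennreal_ofReal (by simp), ← integral_pow_mul_piDensity hν,
      intervalIntegral.integral_of_le (by norm_num), integral_Ioc_eq_integral_Ioo]
    refine setIntegral_congr_fun measurableSet_Ioo fun u hu => ?_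
    simp only [smul_eq_mul]
    rw [ENNReal.toReal_ofReal (piDensity_nonneg hν hu), mul_comm]

lemma piFun_one {ν : ℝ} (hν : -1 / 2 < ν) : piFun ν 1 = 1 / 2 := by
  have := integral_zero_one_even_pow_mul_piDensity hν 0
  simpa [piFun, piMoment] using this

lemma piFun_neg (ν u : ℝ) : piFun ν (-u) = -piFun ν u := by
  have h := intervalIntegral.integral_comp_neg (a := -u) (b := 0) (piDensity ν)
  simp only [piDensity_neg, neg_neg, neg_zero] at h
  rw [piFun, piFun, intervalIntegral.integral_symm, h]

lemma hasDerivAt_mul_one_sub_sq_rpow (ν : ℝ) {w : ℝ} (hw : w ∈ Set.Ioo (-1 : ℝ) 1) :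
    HasDerivAt (fun w : ℝ => w * (1 - w ^ 2) ^ (ν + 1 / 2))
      ((2 * ν + 2) * (1 - w ^ 2) ^ (ν + 1 / 2) - (2 * ν + 1) * (1 - w ^ 2) ^ (ν - 1 / 2)) w := by
  have hpos : 0 < 1 - w ^ 2 := by nlinarith [hw.1, hw.2]
  have h := (hasDerivAt_id w).mul
    ((((hasDerivAt_id w).pow 2).const_sub 1).rpow_const (p := ν + 1 / 2) (Or.inl hpos.ne'))
  refine h.congr_deriv ?_
  simp only [id, Pi.pow_apply]
  rw [show ν + 1 / 2 - 1 = ν - 1 / 2 by ring, show ν + 1 / 2 = ν - 1 / 2 + 1 by ring,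
    Real.rpow_add_one hpos.ne']
  norm_num
  ring

/-- The factor relating `Π_ν` and `Π_{ν+1}`. -/
noncomputable def piShift (ν : ℝ) : ℝ :=
  Real.Gamma (ν + 1 + 1) / (Real.sqrt Real.pi * Real.Gamma (ν + 1 + 1 / 2)) / (2 * ν + 2)

/-- For `ν < -1/2` the density is not integrable up to `±1`, but it differs from the integrable
density for `ν+1` by a multiple of the derivative of `w(1-w²)^(ν+1/2)`. This exhibits `Π_ν` as a
function integrable on `[-1,1]`. -/
lemma piDensity_eq_shift {ν : ℝ} (h1 : -1 < ν) (h2 : ν < -1 / 2) (w : ℝ) :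
    piDensity ν w = piDensity (ν + 1) w - piShift ν * ((2 * ν + 2) * (1 - w ^ 2) ^ (ν + 1 / 2) -
      (2 * ν + 1) * (1 - w ^ 2) ^ (ν - 1 / 2)) := by
  have hs : Real.sqrt Real.pi ≠ 0 := (Real.sqrt_pos.2 Real.pi_pos).ne'
  have e1 : Real.Gamma (ν + 1 + 1) = (ν + 1) * Real.Gamma (ν + 1) :=
    Real.Gamma_add_one (by linarith)
  have e2 : Real.Gamma (ν + 1 + 1 / 2) = (ν + 1 / 2) * Real.Gamma (ν + 1 / 2) := by
    rw [← Real.Gamma_add_one (by linarith)]; congr 1; ring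
  have g : Real.Gamma (ν + 1 / 2) ≠ 0 := by
    intro h
    rw [h, mul_zero] at e2
    exact (Real.Gamma_pos_of_pos (by linarith : 0 < ν + 1 + 1 / 2)).ne' e2
  have n1 : ν + 1 ≠ 0 := by linarith
  have n3 : ν + 1 / 2 ≠ 0 := by linarith
  have n4 : 2 * ν + 1 = 2 * (ν + 1 / 2) := by ring
  rw [piDensity, piDensity, piShift, show ν + 1 - 1 / 2 = ν + 1 / 2 by ring, e1, e2,
    show 2 * ν + 2 = 2 * (ν + 1) by ring, n4]
  generalize Real.Gamma (ν + 1 / 2) = G at g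
  generalize (1 - w ^ 2) ^ (ν + 1 / 2) = A
  generalize ν + 1 / 2 = c at n3
  field_simp
  ring

lemma piFun_eq_shift {ν : ℝ} (h1 : -1 < ν) (h2 : ν < -1 / 2) {u : ℝ}
    (hu : u ∈ Set.Ioo (-1 : ℝ) 1) :
    piFun ν u = piFun (ν + 1) u - piShift ν * (u * (1 - u ^ 2) ^ (ν + 1 / 2)) := by
  have hsub : Set.uIcc 0 u ⊆ Set.Ioo (-1 : ℝ) 1 :=
    Set.OrdConnected.uIcc_subset Set.ordConnected_Ioo ⟨by norm_num, by norm_num⟩ hu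
  have hpos : ∀ w ∈ Set.uIcc 0 u, 1 - w ^ 2 ≠ 0 := fun w hw => by
    have := hsub hw; nlinarith [this.1, this.2]
  have hc : ∀ p : ℝ, ContinuousOn (fun w : ℝ => (1 - w ^ 2) ^ p) (Set.uIcc 0 u) := fun p =>
    ContinuousOn.rpow_const (by fun_prop) fun w hw => Or.inl (hpos w hw)
  have hi : IntervalIntegrable (fun w : ℝ => (2 * ν + 2) * (1 - w ^ 2) ^ (ν + 1 / 2) -
      (2 * ν + 1) * (1 - w ^ 2) ^ (ν - 1 / 2)) volume 0 u :=
    ContinuousOn.intervalIntegrable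
      ((continuousOn_const.mul (hc _)).sub (continuousOn_const.mul (hc _)))
  have hF := intervalIntegral.integral_eq_sub_of_hasDerivAt
    (fun w hw => hasDerivAt_mul_one_sub_sq_rpow ν (hsub hw)) hi
  have hd : IntervalIntegrable (piDensity (ν + 1)) volume 0 u :=
    ContinuousOn.intervalIntegrable (continuousOn_const.mul (hc _))
  rw [piFun, intervalIntegral.integral_congr fun w _ => piDensity_eq_shift h1 h2 w,
    intervalIntegral.integral_sub hd (hi.const_mul _), intervalIntegral.integral_const_mul, hF, piFun]
  simp

lemma continuousOn_piFun {ν : ℝ} (hν : -1 / 2 < ν) :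
    ContinuousOn (piFun ν) (Set.Icc (-1 : ℝ) 1) := by
  have h := intervalIntegrable_pow_mul_piDensity hν 0
  simp only [pow_zero, one_mul] at h
  have := intervalIntegral.continuousOn_primitive_interval' h
    (a := 0) (by rw [Set.uIcc_of_le (by norm_num)]; constructor <;> norm_num)
  rwa [Set.uIcc_of_le (by norm_num)] at this

lemma intervalIntegrable_piFun_of_gt {ν : ℝ} (hν : -1 / 2 < ν) :
    IntervalIntegrable (piFun ν) volume (-1) 1 := by
  apply ContinuousOn.intervalIntegrable
  rw [Set.uIcc_of_le (by norm_num)]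
  exact continuousOn_piFun hν

lemma hasDerivAt_piFun {ν u : ℝ} (hν : -1 / 2 < ν) (hu : u ∈ Set.Ioo (-1 : ℝ) 1) :
    HasDerivAt (piFun ν) (piDensity ν u) u := by
  have h := intervalIntegrable_pow_mul_piDensity hν 0
  simp only [pow_zero, one_mul] at h
  refine intervalIntegral.integral_hasDerivAt_right (h.mono_set ?_)
    (measurable_piDensity ν).stronglyMeasurable.stronglyMeasurableAtFilter ?_
  · rw [Set.uIcc_of_le (show (-1 : ℝ) ≤ 1 by norm_num)]
    exact Set.OrdConnected.uIcc_subset Set.ordConnected_Icc ⟨by norm_num, by norm_num⟩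
      ⟨hu.1.le, hu.2.le⟩
  · have : (1 : ℝ) - u ^ 2 ≠ 0 := by nlinarith [hu.1, hu.2]
    unfold piDensity
    exact ContinuousAt.mul continuousAt_const
      (ContinuousAt.rpow_const (by fun_prop) (Or.inl this))

/-- Integration by parts, the boundary values of `Π_ν` at `±1` being `±1/2`. -/
lemma integral_deriv_pow_mul_piFun {ν : ℝ} (hν : -1 / 2 < ν) (k : ℕ) :
    ∫ u in (-1 : ℝ)..1, (k * u ^ (k - 1)) * piFun ν u =
      (1 + (-1) ^ k) / 2 - piMoment ν k := by
  have i1 : IntervalIntegrable (fun u : ℝ => (k * u ^ (k - 1)) * piFun ν u) volume (-1) 1 :=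
    (intervalIntegrable_piFun_of_gt hν).continuousOn_mul (by fun_prop)
  have i2 := intervalIntegrable_pow_mul_piDensity hν k
  have h := intervalIntegral.integral_eq_sub_of_hasDerivAt_of_le (a := -1) (b := 1)
    (f := fun u => u ^ k * piFun ν u) (by norm_num)
    (ContinuousOn.mul (by fun_prop) (continuousOn_piFun hν))
    (fun u hu => (hasDerivAt_pow k u).mul (hasDerivAt_piFun hν hu)) (i1.add i2)
  rw [intervalIntegral.integral_add i1 i2, integral_pow_mul_piDensity hν] at h
  rw [piFun_neg, piFun_one hν] at h
  simp only [one_pow] at h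
  linarith

lemma intervalIntegrable_piFun {ν : ℝ} (h1 : -1 < ν) (h2 : ν < -1 / 2) :
    IntervalIntegrable (piFun ν) volume (-1) 1 := by
  have i1 := intervalIntegrable_piFun_of_gt (show -1 / 2 < ν + 1 by linarith)
  have i2 : IntervalIntegrable (fun u : ℝ => u * (1 - u ^ 2) ^ (ν + 1 / 2)) volume (-1) 1 := by
    have h := intervalIntegrable_one_sub_sq (show 0 < ν + 3 / 2 by linarith)
    rw [show ν + 3 / 2 - 1 = ν + 1 / 2 by ring] at h
    exact h.continuousOn_mul (by fun_prop)
  have i3 := i1.sub (i2.const_mul (piShift ν))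
  rw [intervalIntegrable_iff_integrableOn_Ioo_of_le (by norm_num)] at i3 ⊢
  exact i3.congr_fun (fun u hu => (piFun_eq_shift h1 h2 hu).symm) measurableSet_Ioo

/-- Direct integration by parts fails because `Π_ν` is unbounded at `±1`. Instead `Π_ν` is written
as `Π_{ν+1}` minus a multiple of `u` times the density for `ν+1`, for which everything is known. -/
lemma integral_deriv_pow_mul_piFun_of_lt {ν : ℝ} (h1 : -1 < ν) (h2 : ν < -1 / 2) (k : ℕ) :
    ∫ u in (-1 : ℝ)..1, (k * u ^ (k - 1)) * piFun ν u = (1 + (-1) ^ k) / 2 - piMoment ν k := by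
  have hν : -1 / 2 < ν + 1 := by linarith
  have hk : ∀ u : ℝ, (k * u ^ (k - 1)) * u = k * u ^ k := fun u => by
    rcases k with _ | k
    · simp
    · rw [Nat.add_sub_cancel, pow_succ]; ring
  have e : Set.EqOn (fun u : ℝ => (k * u ^ (k - 1)) * piFun ν u) (fun u : ℝ =>
      (k * u ^ (k - 1)) * piFun (ν + 1) u - k / (2 * ν + 2) * (u ^ k * piDensity (ν + 1) u))
      (Set.Ioo (-1) 1) := by
    intro u hu
    simp only
    rw [piFun_eq_shift h1 h2 hu, piDensity, piShift, show ν + 1 - 1 / 2 = ν + 1 / 2 by ring]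
    linear_combination (-Real.Gamma (ν + 1 + 1) / (Real.sqrt Real.pi * Real.Gamma (ν + 1 + 1 / 2)) /
      (2 * ν + 2) * (1 - u ^ 2) ^ (ν + 1 / 2)) * hk u
  have i1 : IntervalIntegrable (fun u : ℝ => (k * u ^ (k - 1)) * piFun (ν + 1) u) volume (-1) 1 :=
    (intervalIntegrable_piFun_of_gt hν).continuousOn_mul (by fun_prop)
  have i2 := (intervalIntegrable_pow_mul_piDensity hν k).const_mul (k / (2 * ν + 2) : ℝ)
  rw [intervalIntegral.integral_of_le (by norm_num), integral_Ioc_eq_integral_Ioo,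
    setIntegral_congr_fun measurableSet_Ioo e, ← integral_Ioc_eq_integral_Ioo,
    ← intervalIntegral.integral_of_le (by norm_num), intervalIntegral.integral_sub i1 i2,
    intervalIntegral.integral_const_mul, integral_pow_mul_piDensity hν,
    integral_deriv_pow_mul_piFun hν]
  -- For `k = 2m` this is `(ν+2)_m / (ν+1)_m = (ν+1+m)/(ν+1)`.
  have : piMoment ν k = piMoment (ν + 1) k * (1 + k / (2 * ν + 2)) := by
    rcases Nat.even_or_odd k with hk | hk
    · obtain ⟨m, rfl⟩ := even_iff_exists_two_mul.1 hk
      have n1 : 0 < ν + 1 := by linarith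
      have p1 := (poch_pos n1 m).ne'
      have p2 := (poch_pos (show 0 < ν + 1 + 1 by linarith) m).ne'
      have e : poch (ν + 1) m * (ν + 1 + m) = (ν + 1) * poch (ν + 1 + 1) m := by
        rw [← poch_succ, poch_succ_left]
      rw [piMoment_two_mul, piMoment_two_mul, show 2 * ν + 2 = 2 * (ν + 1) by ring]
      push_cast
      field_simp
      linear_combination (-poch (1 / 2) m) * e
    · rw [piMoment_odd _ hk, piMoment_odd _ hk, zero_mul]
  rw [this]; ring

/-- The density is nonpositive because `Γ(ν+1/2)` is, by the functional equation with `ν+1/2 < 0`.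
At `u = 1` the integral diverges and takes the default value 0, which still fits. -/
lemma piFun_nonpos {ν u : ℝ} (h1 : -1 < ν) (h2 : ν < -1 / 2) (hu : u ∈ Set.Icc (0 : ℝ) 1) :
    piFun ν u ≤ 0 := by
  have e2 : Real.Gamma (ν + 1 + 1 / 2) = (ν + 1 / 2) * Real.Gamma (ν + 1 / 2) := by
    rw [← Real.Gamma_add_one (by linarith)]; congr 1; ring
  have g1 := Real.Gamma_pos_of_pos (show 0 < ν + 1 + 1 / 2 by linarith)
  have g0 := Real.Gamma_pos_of_pos (show 0 < ν + 1 by linarith)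
  have g : Real.Gamma (ν + 1 / 2) ≤ 0 := by
    by_contra! h
    rw [e2] at g1
    nlinarith
  have : 0 ≤ ∫ w in (0 : ℝ)..u, -piDensity ν w := by
    refine intervalIntegral.integral_nonneg hu.1 fun w hw => ?_
    have hw1 : 0 ≤ 1 - w ^ 2 := by nlinarith [hw.1, hw.2, hu.2]
    rw [piDensity, neg_nonneg]
    refine mul_nonpos_of_nonpos_of_nonneg ?_ (Real.rpow_nonneg hw1 _)
    exact div_nonpos_of_nonneg_of_nonpos g0.le
      (mul_nonpos_of_nonneg_of_nonpos (Real.sqrt_nonneg _) g)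
  rw [intervalIntegral.integral_neg] at this
  rw [piFun]; linarith

lemma mul_neg_piFun_nonneg {ν u : ℝ} (h1 : -1 < ν) (h2 : ν < -1 / 2)
    (hu : u ∈ Set.Icc (-1 : ℝ) 1) : 0 ≤ u * -piFun ν u := by
  rcases le_total 0 u with h | h
  · exact mul_nonneg h (neg_nonneg.2 (piFun_nonpos h1 h2 ⟨h, hu.2⟩))
  · have := piFun_nonpos h1 h2 (u := -u) ⟨by linarith, by linarith [hu.1]⟩
    rw [piFun_neg] at this
    exact mul_nonneg_of_nonpos_of_nonpos h this

/-! ### Bilinear Gegenbauer expansions and termwise integration. -/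

/-- The expansion of `C_N^{(l)}(uS + vK)` in monomials of `u` and `v`, with `u^i` replaced by `A i`
and `v^i` replaced by `B i`. -/
noncomputable def gegBi (l : ℝ) (N : ℕ) (S K : ℝ) (A B : ℕ → ℝ) : ℝ :=
  ∑ k ∈ Finset.range (N + 1), gegCoeff l N k * 2 ^ (N - 2 * k) *
    ∑ i ∈ Finset.HasAntidiagonal.antidiagonal (N - 2 * k),
      ((N - 2 * k).choose i.1 : ℝ) * (S ^ i.1 * K ^ i.2) * (A i.1 * B i.2)

lemma gegBi_add_left (l : ℝ) (N : ℕ) (S K : ℝ) (A A' B : ℕ → ℝ) :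
    gegBi l N S K (fun i => A i + A' i) B = gegBi l N S K A B + gegBi l N S K A' B := by
  simp only [gegBi, add_mul, mul_add, Finset.sum_add_distrib]

lemma gegBi_add_right (l : ℝ) (N : ℕ) (S K : ℝ) (A B B' : ℕ → ℝ) :
    gegBi l N S K A (fun i => B i + B' i) = gegBi l N S K A B + gegBi l N S K A B' := by
  simp only [gegBi, mul_add, Finset.sum_add_distrib]

lemma gegBi_hasDerivAt_left (l : ℝ) (N : ℕ) (S K : ℝ) {A : ℝ → ℕ → ℝ} {A' B : ℕ → ℝ} {u : ℝ}
    (h : ∀ i, HasDerivAt (fun u => A u i) (A' i) u) :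
    HasDerivAt (fun u => gegBi l N S K (A u) B) (gegBi l N S K A' B) u := by
  unfold gegBi
  exact HasDerivAt.fun_sum fun k _ => HasDerivAt.const_mul _ <| HasDerivAt.fun_sum fun i _ =>
    HasDerivAt.const_mul _ <| (h i.1).mul_const _

lemma gegBi_hasDerivAt_right (l : ℝ) (N : ℕ) (S K : ℝ) {B : ℝ → ℕ → ℝ} {A B' : ℕ → ℝ} {v : ℝ}
    (h : ∀ i, HasDerivAt (fun v => B v i) (B' i) v) :
    HasDerivAt (fun v => gegBi l N S K A (B v)) (gegBi l N S K A B') v := by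
  unfold gegBi
  exact HasDerivAt.fun_sum fun k _ => HasDerivAt.const_mul _ <| HasDerivAt.fun_sum fun i _ =>
    HasDerivAt.const_mul _ <| (h i.2).const_mul _

/-- The `a`-th derivative of `u ^ i`. -/
def powDeriv (a : ℕ) (u : ℝ) (i : ℕ) : ℝ := (i.descFactorial a : ℝ) * u ^ (i - a)

lemma hasDerivAt_powDeriv (a : ℕ) (u : ℝ) (i : ℕ) :
    HasDerivAt (fun u => powDeriv a u i) (powDeriv (a + 1) u i) u := by
  refine ((hasDerivAt_pow (i - a) u).const_mul _).congr_deriv ?_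
  rw [powDeriv, Nat.descFactorial_succ, Nat.sub_sub]; push_cast; ring

/-- The `r`-th derivative of the Gegenbauer polynomial `C_N^{(l)}`. -/
noncomputable def gegD (l : ℝ) (r N : ℕ) (q : ℝ) : ℝ :=
  if r ≤ N then 2 ^ r * poch l r * geg (l + r) (N - r) q else 0

lemma hasDerivAt_gegD (l : ℝ) (r N : ℕ) (q : ℝ) :
    HasDerivAt (gegD l r N) (gegD l (r + 1) N q) q := by
  rcases lt_trichotomy N r with h | h | h
  · have : gegD l r N = fun _ => 0 := by funext q; rw [gegD, if_neg (by omega)]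
    rw [this, gegD, if_neg (by omega)]
    exact hasDerivAt_const _ _
  · subst h
    have : gegD l N N = fun _ => 2 ^ N * poch l N := by
      funext q; rw [gegD, if_pos le_rfl, Nat.sub_self, geg_zero, mul_one]
    rw [this, gegD, if_neg (by omega)]
    exact hasDerivAt_const _ _
  · obtain ⟨M, rfl⟩ := Nat.exists_eq_add_of_lt h
    have : gegD l r (r + M + 1) = fun q => 2 ^ r * poch l r * geg (l + r) (M + 1) q := by
      funext q; rw [gegD, if_pos h.le, show r + M + 1 - r = M + 1 by omega]
    rw [this, gegD, if_pos (by omega), show r + M + 1 - (r + 1) = M by omega]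
    refine ((hasDerivAt_geg_succ (l + r) M q).const_mul _).congr_deriv ?_
    rw [poch_succ]; push_cast; rw [← add_assoc]; ring

/-- For `a = b = 0` this is the binomial theorem. Each further derivative is obtained by
differentiating both sides and using uniqueness of the derivative. -/
lemma gegBi_powDeriv (l : ℝ) (N : ℕ) (S K : ℝ) (a b : ℕ) (u v : ℝ) :
    gegBi l N S K (powDeriv a u) (powDeriv b v) =
      S ^ a * K ^ b * gegD l (a + b) N (u * S + v * K) := by
  induction a generalizing u with
  | zero =>
    induction b generalizing v with
    | zero =>
      simp only [gegBi, powDeriv, gegD, geg, Nat.descFactorial_zero, Nat.sub_zero, zero_le, if_true,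
        pow_zero, one_mul, poch_zero, Nat.cast_zero, Nat.cast_one, add_zero]
      refine Finset.sum_congr rfl fun k _ => ?_
      rw [mul_pow, (Commute.all (u * S) (v * K)).add_pow', mul_assoc]
      congr 2
      refine Finset.sum_congr rfl fun i _ => ?_
      rw [nsmul_eq_mul, mul_pow, mul_pow]; ring
    | succ b ih =>
      have h1 := gegBi_hasDerivAt_right l N S K (A := powDeriv 0 u) (fun i => hasDerivAt_powDeriv b v i)
      simp only [ih] at h1
      have h2 := ((hasDerivAt_gegD l (0 + b) N (u * S + v * K)).comp v
        (((hasDerivAt_id v).mul_const K).const_add (u * S))).const_mul (S ^ 0 * K ^ b)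
      rw [h1.unique h2, ← add_assoc]; ring
  | succ a ih =>
    have h1 := gegBi_hasDerivAt_left l N S K (B := powDeriv b v) (fun i => hasDerivAt_powDeriv a u i)
    simp only [ih] at h1
    have h2 := ((hasDerivAt_gegD l (a + b) N (u * S + v * K)).comp u
      (((hasDerivAt_id u).mul_const S).add_const (v * K))).const_mul (S ^ a * K ^ b)
    rw [h1.unique h2, add_right_comm a 1 b]; ring

/-- The derivative `∂_u^a ∂_v^b` of `(1 - 2w(uS + vK) + w²)^(-l)`. -/
noncomputable def genKernel (l w S K : ℝ) (a b : ℕ) (u v : ℝ) : ℝ :=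
  S ^ a * K ^ b * ((2 * w) ^ (a + b) * poch l (a + b) *
    (1 - 2 * w * (u * S + v * K) + w ^ 2) ^ (-(l + (a + b : ℕ))))

/-- A summable majorant for the terms of the expansion of `genKernel`. -/
noncomputable def gegDMaj (l w : ℝ) (r N : ℕ) : ℝ :=
  if r ≤ N then 2 ^ r * poch l r * (w ^ r * gegMaj (l + r) w (N - r)) else 0

lemma summable_gegDMaj (l : ℝ) {w : ℝ} (hw0 : 0 ≤ w) (hw : w < 1) (r : ℕ) :
    Summable (gegDMaj l w r) := by
  rw [← summable_nat_add_iff r]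
  simp only [gegDMaj, Nat.le_add_left, if_true, Nat.add_sub_cancel]
  exact ((summable_gegMaj hw0 hw).mul_left _).mul_left _

lemma abs_pow_mul_gegD_le {l q w : ℝ} (hl : 0 < l) (hq : |q| ≤ 1) (hw0 : 0 ≤ w) (r N : ℕ) :
    |w ^ N * gegD l r N q| ≤ gegDMaj l w r N := by
  unfold gegD gegDMaj
  split_ifs with h
  · obtain ⟨n, rfl⟩ := Nat.exists_eq_add_of_le h
    have h1 := abs_geg_mul_pow_le (show 0 < l + r by positivity) hq hw0 n
    have h2 : 0 ≤ 2 ^ r * poch l r * w ^ r := by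
      have := poch_pos hl r; positivity
    rw [Nat.add_sub_cancel_left]
    calc |w ^ (r + n) * (2 ^ r * poch l r * geg (l + r) n q)|
        = |2 ^ r * poch l r * w ^ r * (geg (l + r) n q * w ^ n)| := by congr 1; rw [pow_add]; ring
      _ = 2 ^ r * poch l r * w ^ r * |geg (l + r) n q * w ^ n| := by rw [abs_mul, abs_of_nonneg h2]
      _ ≤ 2 ^ r * poch l r * w ^ r * gegMaj (l + r) w n := mul_le_mul_of_nonneg_left h1 h2
      _ = _ := by ring
  · simp

lemma hasSum_gegD {l q w : ℝ} (hl : 0 < l) (hq : |q| ≤ 1) (hw0 : 0 ≤ w) (hw : w < 1) (r : ℕ) :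
    HasSum (fun N => w ^ N * gegD l r N q)
      ((2 * w) ^ r * poch l r * (1 - 2 * w * q + w ^ 2) ^ (-(l + r))) := by
  rw [← hasSum_nat_add_iff' r]
  have h0 : ∑ i ∈ Finset.range r, w ^ i * gegD l r i q = 0 :=
    Finset.sum_eq_zero fun i hi => by
      rw [gegD, if_neg (by simpa using hi), mul_zero]
  rw [h0, sub_zero]
  have h := (hasSum_geg (show 0 < l + r by positivity) hq hw0 hw).mul_left ((2 * w) ^ r * poch l r)
  refine h.congr_fun fun n => ?_
  simp only [gegD, Nat.le_add_left, if_true, Nat.add_sub_cancel, mul_pow, pow_add]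
  ring

lemma abs_arg_le_one {S K u v : ℝ} (hS : 0 ≤ S) (hK : 0 ≤ K) (hSK : S + K ≤ 1)
    (hu : u ∈ Set.Icc (-1 : ℝ) 1) (hv : v ∈ Set.Icc (-1 : ℝ) 1) : |u * S + v * K| ≤ 1 := by
  rw [abs_le]
  constructor <;> nlinarith [hu.1, hu.2, hv.1, hv.2, mul_nonneg hS (sub_nonneg.2 hu.2),
    mul_nonneg hK (sub_nonneg.2 hv.2), mul_nonneg hS (neg_le_iff_add_nonneg.1 hu.1),
    mul_nonneg hK (neg_le_iff_add_nonneg.1 hv.1)]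

lemma ae_prod_mem_Icc {μ₁ μ₂ : Measure ℝ} (h₁ : ∀ᵐ u ∂μ₁, u ∈ Set.Icc (-1 : ℝ) 1)
    (h₂ : ∀ᵐ u ∂μ₂, u ∈ Set.Icc (-1 : ℝ) 1) :
    ∀ᵐ p ∂(μ₁.prod μ₂), p.1 ∈ Set.Icc (-1 : ℝ) 1 ∧ p.2 ∈ Set.Icc (-1 : ℝ) 1 :=
  (Measure.quasiMeasurePreserving_fst.ae h₁).and (Measure.quasiMeasurePreserving_snd.ae h₂)

section Integration

variable {μ₁ μ₂ : Measure ℝ} [SFinite μ₁] [SFinite μ₂] {g₁ g₂ : ℝ → ℝ}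

lemma integrable_powDeriv_mul {μ : Measure ℝ} {g : ℝ → ℝ} (h : ∀ᵐ u ∂μ, u ∈ Set.Icc (-1 : ℝ) 1)
    (hg : Integrable g μ) (a i : ℕ) : Integrable (fun u => powDeriv a u i * g u) μ := by
  refine hg.bdd_mul (c := i.descFactorial a) ?_ ?_
  · unfold powDeriv
    exact (by fun_prop : Measurable _).aestronglyMeasurable
  · filter_upwards [h] with u hu
    rw [powDeriv, norm_mul, norm_pow, Real.norm_eq_abs, Real.norm_eq_abs, Nat.abs_cast]
    exact mul_le_of_le_one_right (Nat.cast_nonneg _) (pow_le_one₀ (abs_nonneg _) (abs_le.2 hu))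

lemma integral_gegBi (h₁ : ∀ᵐ u ∂μ₁, u ∈ Set.Icc (-1 : ℝ) 1)
    (h₂ : ∀ᵐ u ∂μ₂, u ∈ Set.Icc (-1 : ℝ) 1) (hg₁ : Integrable g₁ μ₁) (hg₂ : Integrable g₂ μ₂)
    (l : ℝ) (N : ℕ) (S K : ℝ) (a b : ℕ) :
    Integrable (fun p : ℝ × ℝ => gegBi l N S K (powDeriv a p.1) (powDeriv b p.2) *
      (g₁ p.1 * g₂ p.2)) (μ₁.prod μ₂) ∧
    ∫ p : ℝ × ℝ, gegBi l N S K (powDeriv a p.1) (powDeriv b p.2) * (g₁ p.1 * g₂ p.2) ∂(μ₁.prod μ₂) =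
      gegBi l N S K (fun i => ∫ u, powDeriv a u i * g₁ u ∂μ₁)
        (fun i => ∫ v, powDeriv b v i * g₂ v ∂μ₂) := by
  have e : (fun p : ℝ × ℝ => gegBi l N S K (powDeriv a p.1) (powDeriv b p.2) * (g₁ p.1 * g₂ p.2)) =
      fun p => ∑ k ∈ Finset.range (N + 1), ∑ i ∈ Finset.HasAntidiagonal.antidiagonal (N - 2 * k),
        gegCoeff l N k * 2 ^ (N - 2 * k) * (((N - 2 * k).choose i.1 : ℝ) * (S ^ i.1 * K ^ i.2)) *
          ((powDeriv a p.1 i.1 * g₁ p.1) * (powDeriv b p.2 i.2 * g₂ p.2)) := by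
    funext p
    simp only [gegBi, Finset.sum_mul, Finset.mul_sum]
    exact Finset.sum_congr rfl fun k _ => Finset.sum_congr rfl fun i _ => by ring
  have hi : ∀ i j, Integrable (fun p : ℝ × ℝ =>
      (powDeriv a p.1 i * g₁ p.1) * (powDeriv b p.2 j * g₂ p.2)) (μ₁.prod μ₂) := fun i j =>
    (integrable_powDeriv_mul h₁ hg₁ a i).mul_prod (integrable_powDeriv_mul h₂ hg₂ b j)
  rw [e]
  refine ⟨integrable_finsetSum _ fun k _ => integrable_finsetSum _ fun i _ =>
    (hi _ _).const_mul _, ?_⟩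
  rw [integral_finsetSum _ fun k _ => integrable_finsetSum _ fun i _ => (hi _ _).const_mul _]
  refine Finset.sum_congr rfl fun k _ => ?_
  rw [integral_finsetSum _ fun i _ => (hi _ _).const_mul _, Finset.mul_sum]
  refine Finset.sum_congr rfl fun i _ => ?_
  rw [integral_const_mul, integral_prod_mul (fun u => powDeriv a u i.1 * g₁ u)
    (fun v => powDeriv b v i.2 * g₂ v)]
  ring

lemma measurable_genKernel (l w S K : ℝ) (a b : ℕ) :
    Measurable fun p : ℝ × ℝ => genKernel l w S K a b p.1 p.2 := by
  unfold genKernel; fun_prop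

/-- Termwise integration of the Gegenbauer expansion of `genKernel`. -/
lemma integral_genKernel (h₁ : ∀ᵐ u ∂μ₁, u ∈ Set.Icc (-1 : ℝ) 1)
    (h₂ : ∀ᵐ u ∂μ₂, u ∈ Set.Icc (-1 : ℝ) 1) (hg₁ : Integrable g₁ μ₁) (hg₂ : Integrable g₂ μ₂)
    {l w S K : ℝ} (hl : 0 < l) (hw0 : 0 ≤ w) (hw : w < 1) (hS : 0 ≤ S) (hK : 0 ≤ K)
    (hSK : S + K ≤ 1) (a b : ℕ) :
    Integrable (fun p : ℝ × ℝ => genKernel l w S K a b p.1 p.2 * (g₁ p.1 * g₂ p.2))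
      (μ₁.prod μ₂) ∧
    HasSum (fun N => w ^ N * gegBi l N S K (fun i => ∫ u, powDeriv a u i * g₁ u ∂μ₁)
        (fun i => ∫ v, powDeriv b v i * g₂ v ∂μ₂))
      (∫ p : ℝ × ℝ, genKernel l w S K a b p.1 p.2 * (g₁ p.1 * g₂ p.2) ∂(μ₁.prod μ₂)) := by
  have hae := ae_prod_mem_Icc h₁ h₂
  have hgg : Integrable (fun p : ℝ × ℝ => g₁ p.1 * g₂ p.2) (μ₁.prod μ₂) := hg₁.mul_prod hg₂
  have hSK1 : |S ^ a * K ^ b| ≤ 1 := by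
    rw [abs_of_nonneg (by positivity)]
    exact mul_le_one₀ (pow_le_one₀ hS (by linarith)) (by positivity) (pow_le_one₀ hK (by linarith))
  have hterm : ∀ p : ℝ × ℝ, ∀ N, w ^ N * gegBi l N S K (powDeriv a p.1) (powDeriv b p.2) =
      S ^ a * K ^ b * (w ^ N * gegD l (a + b) N (p.1 * S + p.2 * K)) := fun p N => by
    rw [gegBi_powDeriv]; ring
  have hbound : ∀ p : ℝ × ℝ, p.1 ∈ Set.Icc (-1 : ℝ) 1 ∧ p.2 ∈ Set.Icc (-1 : ℝ) 1 → ∀ N,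
      ‖w ^ N * gegBi l N S K (powDeriv a p.1) (powDeriv b p.2)‖ ≤ gegDMaj l w (a + b) N := by
    intro p hp N
    rw [hterm, norm_mul, Real.norm_eq_abs, Real.norm_eq_abs]
    refine (mul_le_of_le_one_left (abs_nonneg _) hSK1).trans ?_
    exact abs_pow_mul_gegD_le hl (abs_arg_le_one hS hK hSK hp.1 hp.2) hw0 _ _
  have hsum : ∀ p : ℝ × ℝ, p.1 ∈ Set.Icc (-1 : ℝ) 1 ∧ p.2 ∈ Set.Icc (-1 : ℝ) 1 →
      HasSum (fun N => w ^ N * gegBi l N S K (powDeriv a p.1) (powDeriv b p.2))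
        (genKernel l w S K a b p.1 p.2) := by
    intro p hp
    simp only [hterm]
    exact (hasSum_gegD hl (abs_arg_le_one hS hK hSK hp.1 hp.2) hw0 hw (a + b)).mul_left _
  have hmaj := summable_gegDMaj l hw0 hw (a + b)
  have hint := fun N => integral_gegBi h₁ h₂ hg₁ hg₂ l N S K a b
  constructor
  · refine hgg.bdd_mul (c := ∑' N, gegDMaj l w (a + b) N)
      (measurable_genKernel l w S K a b).aestronglyMeasurable ?_
    filter_upwards [hae] with p hp
    rw [← (hsum p hp).tsum_eq]
    exact tsum_of_norm_bounded hmaj.hasSum (hbound p hp)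
  -- The uniform majorant times the integrable weight bounds the `L¹` norms summably, which allows
  -- sum and integral to be exchanged.
  · set F : ℕ → ℝ × ℝ → ℝ := fun N p =>
      w ^ N * (gegBi l N S K (powDeriv a p.1) (powDeriv b p.2) * (g₁ p.1 * g₂ p.2)) with hF
    have hFi : ∀ N, Integrable (F N) (μ₁.prod μ₂) := fun N => (hint N).1.const_mul _
    have hFs : Summable fun N => ∫ p, ‖F N p‖ ∂(μ₁.prod μ₂) := by
      refine Summable.of_nonneg_of_le (fun N => integral_nonneg fun p => norm_nonneg _) (fun N => ?_)
        (hmaj.mul_right (∫ p : ℝ × ℝ, ‖g₁ p.1 * g₂ p.2‖ ∂(μ₁.prod μ₂)))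
      rw [← integral_const_mul]
      refine integral_mono_ae (hFi N).norm (hgg.norm.const_mul _) ?_
      filter_upwards [hae] with p hp
      simp only [hF]
      rw [← mul_assoc, norm_mul]
      exact mul_le_mul_of_nonneg_right (hbound p hp N) (norm_nonneg _)
    have h := hasSum_integral_of_summable_integral_norm hFi hFs
    have e1 : ∫ p, ∑' N, F N p ∂(μ₁.prod μ₂) =
        ∫ p : ℝ × ℝ, genKernel l w S K a b p.1 p.2 * (g₁ p.1 * g₂ p.2) ∂(μ₁.prod μ₂) := by
      refine integral_congr_ae ?_
      filter_upwards [hae] with p hp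
      rw [← (hsum p hp).tsum_eq, ← tsum_mul_right]
      simp only [hF, mul_assoc]
    rw [e1] at h
    refine h.congr_fun fun N => ?_
    simp only [hF]
    rw [integral_const_mul, (hint N).2]

end Integration

/-! ### The moment functional on Gegenbauer polynomials. -/

lemma gegBi_odd (l S K α β : ℝ) {N : ℕ} (hN : Odd N) :
    gegBi l N S K (piMoment α) (piMoment β) = 0 := by
  refine Finset.sum_eq_zero fun k _ => ?_
  rcases Nat.lt_or_ge N (2 * k) with h | h
  · rw [gegCoeff_of_lt h, zero_mul, zero_mul]
  · rw [Finset.sum_eq_zero, mul_zero]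
    rintro ⟨i, j⟩ hij
    have hij := Finset.HasAntidiagonal.mem_antidiagonal.1 hij
    simp only at hij ⊢
    rcases Nat.even_or_odd i with hi | hi
    · have : Odd j := by
        rcases hi with ⟨c, hc⟩
        rcases hN with ⟨d, hd⟩
        exact ⟨d - k - c, by omega⟩
      rw [piMoment_odd _ this]; ring
    · rw [piMoment_odd _ hi]; ring

lemma factorial_two_mul (m : ℕ) : ((2 * m).factorial : ℝ) = 4 ^ m * m.factorial * poch (1 / 2) m := by
  induction m with
  | zero => simp
  | succ m ih =>
    rw [show 2 * (m + 1) = 2 * m + 1 + 1 by ring, Nat.factorial_succ, Nat.factorial_succ,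
      Nat.cast_mul, Nat.cast_mul, ih, poch_succ, Nat.factorial_succ]
    push_cast; ring

/-- Only pairs of even exponents `(2m, 2n)` contribute. There `(2m)! = 4^m m! (1/2)_m` cancels the
numerators of the moments, leaving the coefficients of an Appell block. -/
lemma sum_antidiagonal_piMoment {a b : ℝ} (ha : 0 < a) (hb : 0 < b) {S K x y : ℝ}
    (hS : S ^ 2 = x * y) (hK : K ^ 2 = (1 - x) * (1 - y)) (j : ℕ) :
    ∑ i ∈ Finset.HasAntidiagonal.antidiagonal (2 * j),
      ((2 * j).choose i.1 : ℝ) * (S ^ i.1 * K ^ i.2) * (piMoment (a - 1) i.1 * piMoment (b - 1) i.2) =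
    (2 * j).factorial / 4 ^ j * (appellBlock a b y j).eval x := by
  rw [eval_appellBlock, Finset.mul_sum]
  symm
  refine Finset.sum_of_injOn (fun i : ℕ × ℕ => (2 * i.1, 2 * i.2)) ?_ ?_ ?_ ?_
  · rintro ⟨i, j⟩ _ ⟨i', j'⟩ _ h
    simp only [Prod.mk.injEq] at h ⊢
    omega
  · rintro ⟨i, j⟩ h
    simp only [Finset.mem_coe, Finset.HasAntidiagonal.mem_antidiagonal] at h ⊢
    omega
  · rintro ⟨m, n⟩ h h'
    have h := Finset.HasAntidiagonal.mem_antidiagonal.1 h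
    simp only at h ⊢
    rcases Nat.even_or_odd m with hm | hm
    · exfalso
      obtain ⟨c, rfl⟩ := even_iff_exists_two_mul.1 hm
      refine h' ⟨(c, j - c), ?_, ?_⟩
      · simp only [Finset.mem_coe, Finset.HasAntidiagonal.mem_antidiagonal]; omega
      · simp only [Prod.mk.injEq, true_and]; omega
    · rw [piMoment_odd _ hm]; ring
  · rintro ⟨m, n⟩ h
    have h := Finset.HasAntidiagonal.mem_antidiagonal.1 h
    simp only at h ⊢
    subst h
    have hc : ((2 * (m + n)).choose (2 * m) : ℝ) * ((2 * m).factorial * (2 * n).factorial) =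
        (2 * (m + n)).factorial := by
      have := Nat.choose_mul_factorial_mul_factorial (show 2 * m ≤ 2 * (m + n) by omega)
      rw [show 2 * (m + n) - 2 * m = 2 * n by omega, mul_assoc] at this
      exact_mod_cast this
    rw [← hc, factorial_two_mul, factorial_two_mul, piMoment_two_mul, piMoment_two_mul,
      sub_add_cancel, sub_add_cancel, pow_mul, pow_mul, hS, hK, pow_add]
    have := (poch_pos ha m).ne'
    have := (poch_pos hb n).ne'
    have : (m.factorial : ℝ) ≠ 0 := by positivity
    have : (n.factorial : ℝ) ≠ 0 := by positivity
    field_simp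

lemma gegBi_even {a b : ℝ} (ha : 0 < a) (hb : 0 < b) {S K x y : ℝ}
    (hS : S ^ 2 = x * y) (hK : K ^ 2 = (1 - x) * (1 - y)) (n : ℕ) :
    gegBi (a + b) (2 * n) S K (piMoment (a - 1)) (piMoment (b - 1)) = gegMoment a b x y n := by
  have h1 : gegBi (a + b) (2 * n) S K (piMoment (a - 1)) (piMoment (b - 1)) =
      ∑ k ∈ Finset.range (n + 1), gegCoeff (a + b) (2 * n) k * 2 ^ (2 * n - 2 * k) *
        ∑ i ∈ Finset.HasAntidiagonal.antidiagonal (2 * n - 2 * k),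
          ((2 * n - 2 * k).choose i.1 : ℝ) * (S ^ i.1 * K ^ i.2) *
            (piMoment (a - 1) i.1 * piMoment (b - 1) i.2) := by
    symm
    refine Finset.sum_subset (Finset.range_mono (by omega)) fun k _ hk => ?_
    rw [gegCoeff_of_lt (by have := Finset.mem_range.not.1 hk; omega)]; ring
  -- The terms with `2k > 2n` having vanished, reversal by `k = n - j` leaves degree `2j`, matching
  -- the block of degree `j`.
  rw [h1, ← Finset.sum_range_reflect, gegMoment]
  refine Finset.sum_congr rfl fun j hj => ?_
  have hj : j ≤ n := by have := Finset.mem_range.1 hj; omega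
  have e : 2 * n - 2 * (n + 1 - 1 - j) = 2 * j := by omega
  rw [e, sum_antidiagonal_piMoment ha hb hS hK, gegCoeff, show n + 1 - 1 - j = n - j by omega,
    show 2 * n - (n - j) = n + j by omega]
  have hc : ((n + j).choose (n - j) : ℝ) * ((n - j).factorial * (2 * j).factorial) =
      (n + j).factorial := by
    have := Nat.choose_mul_factorial_mul_factorial (show n - j ≤ n + j by omega)
    rw [show n + j - (n - j) = 2 * j by omega, mul_assoc] at this
    exact_mod_cast this
  have h2 : ((n + j).choose (n - j) : ℝ) ≠ 0 := by exact_mod_cast (Nat.choose_pos (by omega)).ne'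
  rw [← hc, pow_mul, show (2 : ℝ) ^ 2 = 4 by norm_num]
  field_simp

/-! ### Derivatives, monotonicity and sign of the kernel. -/

lemma hasDerivAt_genKernel_left {l w S K : ℝ} (a b : ℕ) {u v : ℝ}
    (h : 0 < 1 - 2 * w * (u * S + v * K) + w ^ 2) :
    HasDerivAt (fun u => genKernel l w S K a b u v) (genKernel l w S K (a + 1) b u v) u := by
  have h1 : HasDerivAt (fun u => 1 - 2 * w * (u * S + v * K) + w ^ 2) (-(2 * w * S)) u := by
    have := ((((hasDerivAt_id u).mul_const S).add_const (v * K)).const_mul (2 * w)).const_sub 1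
      |>.add_const (w ^ 2)
    simpa using this
  have h2 := ((h1.rpow_const (p := -(l + (a + b : ℕ))) (Or.inl h.ne')).const_mul
    ((2 * w) ^ (a + b) * poch l (a + b))).const_mul (S ^ a * K ^ b)
  refine h2.congr_deriv ?_
  rw [genKernel, show a + 1 + b = a + b + 1 by ring, poch_succ,
    show -(l + ((a + b + 1 : ℕ) : ℝ)) = -(l + (a + b : ℕ)) - 1 by push_cast; ring]
  ring

lemma genKernel_swap (l w S K : ℝ) (a b : ℕ) (u v : ℝ) :
    genKernel l w S K a b u v = genKernel l w K S b a v u := by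
  rw [genKernel, genKernel, add_comm a b, add_comm (u * S), mul_comm (S ^ a)]

lemma hasDerivAt_genKernel_right {l w S K : ℝ} (a b : ℕ) {u v : ℝ}
    (h : 0 < 1 - 2 * w * (u * S + v * K) + w ^ 2) :
    HasDerivAt (fun v => genKernel l w S K a b u v) (genKernel l w S K a (b + 1) u v) v := by
  rw [genKernel_swap]
  simp only [genKernel_swap l w S K]
  exact hasDerivAt_genKernel_left b a (by rwa [add_comm (v * K)])

section Sign

variable {l w S K u v : ℝ}

lemma genKernel_base_pos (hw0 : 0 ≤ w) (hw : w < 1) (hS : 0 ≤ S) (hK : 0 ≤ K) (hSK : S + K ≤ 1)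
    (hu : u ∈ Set.Icc (-1 : ℝ) 1) (hv : v ∈ Set.Icc (-1 : ℝ) 1) :
    0 < 1 - 2 * w * (u * S + v * K) + w ^ 2 :=
  one_sub_two_mul_add_sq_pos (abs_arg_le_one hS hK hSK hu hv) hw0 hw

lemma genKernel_nonneg (hl : 0 < l) (hw0 : 0 ≤ w) (hw : w < 1) (hS : 0 ≤ S) (hK : 0 ≤ K)
    (hSK : S + K ≤ 1) (a b : ℕ) (hu : u ∈ Set.Icc (-1 : ℝ) 1) (hv : v ∈ Set.Icc (-1 : ℝ) 1) :
    0 ≤ genKernel l w S K a b u v := by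
  have := genKernel_base_pos hw0 hw hS hK hSK hu hv
  have := poch_pos hl (a + b)
  unfold genKernel
  positivity

lemma neg_mem_Icc (hu : u ∈ Set.Icc (-1 : ℝ) 1) : -u ∈ Set.Icc (-1 : ℝ) 1 :=
  ⟨by linarith [hu.2], by linarith [hu.1]⟩

lemma genKernel_le_genKernel (hl : 0 < l) (hw0 : 0 ≤ w) (hw : w < 1) (hS : 0 ≤ S) (hK : 0 ≤ K)
    (hSK : S + K ≤ 1) (a b : ℕ) {u' : ℝ} (huu : u' ≤ u)
    (hu : u ∈ Set.Icc (-1 : ℝ) 1) (hv : v ∈ Set.Icc (-1 : ℝ) 1) :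
    genKernel l w S K a b u' v ≤ genKernel l w S K a b u v := by
  have h1 := genKernel_base_pos hw0 hw hS hK hSK hu hv
  have h2 := poch_pos hl (a + b)
  unfold genKernel
  refine mul_le_mul_of_nonneg_left (mul_le_mul_of_nonneg_left ?_ (by positivity)) (by positivity)
  refine Real.rpow_le_rpow_of_nonpos h1 ?_ (neg_nonpos.2 (by positivity))
  have := mul_le_mul_of_nonneg_left (mul_le_mul_of_nonneg_right huu hS) hw0
  linarith

lemma mul_genKernel_sub_nonneg (hl : 0 < l) (hw0 : 0 ≤ w) (hw : w < 1) (hS : 0 ≤ S) (hK : 0 ≤ K)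
    (hSK : S + K ≤ 1) (a b : ℕ) (hu : u ∈ Set.Icc (-1 : ℝ) 1) (hv : v ∈ Set.Icc (-1 : ℝ) 1) :
    0 ≤ u * (genKernel l w S K a b u v - genKernel l w S K a b (-u) v) := by
  rcases le_total 0 u with h | h
  · exact mul_nonneg h (sub_nonneg.2
      (genKernel_le_genKernel hl hw0 hw hS hK hSK a b (by linarith) hu hv))
  · exact mul_nonneg_of_nonpos_of_nonpos h (sub_nonpos.2
      (genKernel_le_genKernel hl hw0 hw hS hK hSK a b (by linarith) (neg_mem_Icc hu) hv))

/-- Both `d` and `g` have the sign of `z`; at `z = 0` this says nothing, so the vanishing of `d` is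
required separately. -/
lemma mul_nonneg_of_mul_nonneg_of_mul_nonneg {z d g : ℝ} (h1 : 0 ≤ z * d) (h2 : 0 ≤ z * g)
    (h0 : z = 0 → d = 0) : 0 ≤ d * g := by
  rcases lt_trichotomy z 0 with h | h | h
  · exact mul_nonneg_of_nonpos_of_nonpos (nonpos_of_mul_nonneg_right h1 h)
      (nonpos_of_mul_nonneg_right h2 h)
  · rw [h0 h, zero_mul]
  · exact mul_nonneg (nonneg_of_mul_nonneg_right h1 h) (nonneg_of_mul_nonneg_right h2 h)

/-- The even part of `s ↦ (1 - 2ws + w²)^(-p)` is increasing on `[0,1]`. -/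
lemma monotoneOn_even_rpow {p : ℝ} (hp : 0 < p) (hw0 : 0 ≤ w) (hw : w < 1) :
    MonotoneOn (fun s : ℝ => (1 - 2 * w * s + w ^ 2) ^ (-p) + (1 - 2 * w * (-s) + w ^ 2) ^ (-p))
      (Set.Icc 0 1) := by
  have hpos : ∀ s ∈ Set.Icc (0 : ℝ) 1, 0 < 1 - 2 * w * s + w ^ 2 ∧ 0 < 1 - 2 * w * (-s) + w ^ 2 :=
    fun s hs => ⟨one_sub_two_mul_add_sq_pos (abs_le.2 ⟨by linarith [hs.1], hs.2⟩) hw0 hw,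
      one_sub_two_mul_add_sq_pos (abs_le.2 ⟨by linarith [hs.2], by linarith [hs.1]⟩) hw0 hw⟩
  have hd : ∀ s ∈ Set.Icc (0 : ℝ) 1, HasDerivAt
      (fun s : ℝ => (1 - 2 * w * s + w ^ 2) ^ (-p) + (1 - 2 * w * (-s) + w ^ 2) ^ (-p))
      (2 * w * p * ((1 - 2 * w * s + w ^ 2) ^ (-p - 1) - (1 - 2 * w * (-s) + w ^ 2) ^ (-p - 1))) s := by
    intro s hs
    have h1 : HasDerivAt (fun s : ℝ => 1 - 2 * w * s + w ^ 2) (-(2 * w)) s := by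
      simpa using (((hasDerivAt_id s).const_mul (2 * w)).const_sub 1).add_const (w ^ 2)
    have h2 : HasDerivAt (fun s : ℝ => 1 - 2 * w * (-s) + w ^ 2) (2 * w) s := by
      simpa using (((hasDerivAt_neg s).const_mul (2 * w)).const_sub 1).add_const (w ^ 2)
    refine ((h1.rpow_const (p := -p) (Or.inl (hpos s hs).1.ne')).add
      (h2.rpow_const (p := -p) (Or.inl (hpos s hs).2.ne'))).congr_deriv ?_
    ring
  refine monotoneOn_of_deriv_nonneg (convex_Icc 0 1)
    (fun s hs => (hd s hs).continuousAt.continuousWithinAt)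
    (fun s hs => (hd s (interior_subset hs)).differentiableAt.differentiableWithinAt) fun s hs => ?_
  have hs := interior_subset hs
  rw [(hd s hs).deriv]
  refine mul_nonneg (by positivity) (sub_nonneg.2 ?_)
  refine Real.rpow_le_rpow_of_nonpos (hpos s hs).1 ?_ (by linarith)
  have := mul_nonneg hw0 hs.1
  linarith

lemma even_rpow_le {p : ℝ} (hp : 0 < p) (hw0 : 0 ≤ w) (hw : w < 1) {s s' : ℝ} (h : |s| ≤ |s'|)
    (h' : |s'| ≤ 1) :
    (1 - 2 * w * s + w ^ 2) ^ (-p) + (1 - 2 * w * (-s) + w ^ 2) ^ (-p) ≤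
      (1 - 2 * w * s' + w ^ 2) ^ (-p) + (1 - 2 * w * (-s') + w ^ 2) ^ (-p) := by
  have h1 := monotoneOn_even_rpow hp hw0 hw ⟨abs_nonneg s, h.trans h'⟩ ⟨abs_nonneg s', h'⟩ h
  have e : ∀ s : ℝ, (1 - 2 * w * |s| + w ^ 2) ^ (-p) + (1 - 2 * w * (-|s|) + w ^ 2) ^ (-p) =
      (1 - 2 * w * s + w ^ 2) ^ (-p) + (1 - 2 * w * (-s) + w ^ 2) ^ (-p) := by
    intro s
    rcases abs_choice s with h | h <;> rw [h]
    rw [neg_neg, add_comm]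
  simp only [e] at h1
  exact h1

/-- The four sign changes group into the even function of `monotoneOn_even_rpow`, taken at `uS+vK`
minus its value at `uS-vK`. Which argument is larger in absolute value is decided by the sign of
`uv`, since their squares differ by `4uvSK`. -/
lemma mul_genKernel_second_diff_nonneg (hl : 0 < l) (hw0 : 0 ≤ w) (hw : w < 1) (hS : 0 ≤ S)
    (hK : 0 ≤ K) (hSK : S + K ≤ 1) (a b : ℕ)
    (hu : u ∈ Set.Icc (-1 : ℝ) 1) (hv : v ∈ Set.Icc (-1 : ℝ) 1) :
    0 ≤ (u * v) * (genKernel l w S K a b u v - genKernel l w S K a b (-u) v -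
      (genKernel l w S K a b u (-v) - genKernel l w S K a b (-u) (-v))) := by
  have h2 := poch_pos hl (a + b)
  have hp : 0 < l + (a + b : ℕ) := by positivity
  have a1 := abs_arg_le_one hS hK hSK hu hv
  have a2 := abs_arg_le_one hS hK hSK hu (neg_mem_Icc hv)
  have e1 : -u * S + v * K = -(u * S + -v * K) := by ring
  have e2 : -u * S + -v * K = -(u * S + v * K) := by ring
  have hsq : (u * S + v * K) ^ 2 - (u * S + -v * K) ^ 2 = 4 * (u * v) * (S * K) := by ring
  have hSK0 := mul_nonneg hS hK
  have hc : 0 ≤ S ^ a * K ^ b * ((2 * w) ^ (a + b) * poch l (a + b)) := by positivity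
  simp only [genKernel, e1, e2]
  rcases le_total 0 (u * v) with h | h
  · have := even_rpow_le hp hw0 hw (s := u * S + -v * K) (s' := u * S + v * K)
      (sq_le_sq.1 (by nlinarith [mul_nonneg h hSK0])) a1
    refine mul_nonneg h ?_
    nlinarith [mul_le_mul_of_nonneg_left this hc]
  · have := even_rpow_le hp hw0 hw (s := u * S + v * K) (s' := u * S + -v * K)
      (sq_le_sq.1 (by nlinarith [mul_nonneg (neg_nonneg.2 h) hSK0])) a2
    refine mul_nonneg_of_nonpos_of_nonpos h ?_
    nlinarith [mul_le_mul_of_nonneg_left this hc]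

end Sign

/-! ### Positivity by symmetrization. -/

lemma measurePreserving_neg_lebSym : MeasurePreserving (Neg.neg : ℝ → ℝ) lebSym lebSym := by
  have h := (Measure.measurePreserving_neg (volume : Measure ℝ)).restrict_preimage
    (measurableSet_Icc (a := (-1 : ℝ)) (b := 1))
  have e : (Neg.neg : ℝ → ℝ) ⁻¹' Set.Icc (-1) 1 = Set.Icc (-1) 1 := by
    ext x; simp only [Set.mem_preimage, Set.mem_Icc]; constructor <;> rintro ⟨h1, h2⟩ <;>
      constructor <;> linarith
  rw [e] at h
  exact h

instance : IsFiniteMeasure lebSym := by unfold lebSym; infer_instance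

lemma ae_lebSym_mem : ∀ᵐ u ∂lebSym, u ∈ Set.Icc (-1 : ℝ) 1 := ae_restrict_mem measurableSet_Icc

lemma integral_genKernel_nonneg {μ μ' : Measure ℝ} {g g' : ℝ → ℝ} {l w S K : ℝ}
    (hl : 0 < l) (hw0 : 0 ≤ w) (hw : w < 1)
    (hS : 0 ≤ S) (hK : 0 ≤ K) (hSK : S + K ≤ 1) (a b : ℕ)
    (hμ : ∀ᵐ u ∂μ, u ∈ Set.Icc (-1 : ℝ) 1) (hμ' : ∀ᵐ u ∂μ', u ∈ Set.Icc (-1 : ℝ) 1)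
    (hg : ∀ v, 0 ≤ g v) (hg' : ∀ v, 0 ≤ g' v) :
    0 ≤ ∫ p : ℝ × ℝ, genKernel l w S K a b p.1 p.2 * (g p.1 * g' p.2) ∂(μ.prod μ') := by
  refine integral_nonneg_of_ae ?_
  filter_upwards [ae_prod_mem_Icc hμ hμ'] with p hp
  exact mul_nonneg (genKernel_nonneg hl hw0 hw hS hK hSK a b hp.1 hp.2)
    (mul_nonneg (hg _) (hg' _))

section Symmetrization

variable {μ : Measure ℝ} [SFinite μ]

lemma measurePreserving_neg_fst : MeasurePreserving
    (MeasurableEquiv.prodCongr (MeasurableEquiv.neg ℝ) (MeasurableEquiv.refl ℝ))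
    (lebSym.prod μ) (lebSym.prod μ) :=
  measurePreserving_neg_lebSym.prod (MeasurePreserving.id μ)

/-- Reflection in the first variable preserves the measure, so symmetrizing the integrand doubles
the integral. The integrand itself need not have a sign. -/
lemma integral_nonneg_of_add_neg_fst {h : ℝ × ℝ → ℝ} (hi : Integrable h (lebSym.prod μ))
    (h0 : 0 ≤ ∫ p : ℝ × ℝ, (h p + h (-p.1, p.2)) ∂(lebSym.prod μ)) :
    0 ≤ ∫ p, h p ∂(lebSym.prod μ) := by
  have h1 := measurePreserving_neg_fst (μ := μ) |>.integral_comp' h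
  have h2 : Integrable (fun p : ℝ × ℝ => h (-p.1, p.2)) (lebSym.prod μ) :=
    (measurePreserving_neg_fst (μ := μ)).integrable_comp_of_integrable hi
  have h3 : ∫ p : ℝ × ℝ, h (-p.1, p.2) ∂(lebSym.prod μ) = ∫ p, h p ∂(lebSym.prod μ) := h1
  rw [integral_add hi h2, h3] at h0
  linarith

lemma integrable_add_neg_fst {h : ℝ × ℝ → ℝ} (hi : Integrable h (lebSym.prod μ)) :
    Integrable (fun p : ℝ × ℝ => h p + h (-p.1, p.2)) (lebSym.prod μ) :=
  hi.add ((measurePreserving_neg_fst (μ := μ)).integrable_comp_of_integrable hi)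

lemma integral_nonneg_of_add_neg_snd {h : ℝ × ℝ → ℝ} (hi : Integrable h (μ.prod lebSym))
    (h0 : 0 ≤ ∫ p : ℝ × ℝ, (h p + h (p.1, -p.2)) ∂(μ.prod lebSym)) :
    0 ≤ ∫ p, h p ∂(μ.prod lebSym) := by
  rw [← integral_prod_swap]
  rw [← integral_prod_swap] at h0
  exact integral_nonneg_of_add_neg_fst (h := fun p => h p.swap) hi.swap h0

variable {l w S K : ℝ} {g g' : ℝ → ℝ}

/-- Against an odd weight `g`, symmetrization replaces the kernel by its difference under `u ↦ -u`,
which has the sign of `u`, as does `g`. -/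
lemma integral_genKernel_nonneg_fst (hl : 0 < l) (hw0 : 0 ≤ w) (hw : w < 1) (hS : 0 ≤ S)
    (hK : 0 ≤ K) (hSK : S + K ≤ 1) (a b : ℕ) (hμ : ∀ᵐ u ∂μ, u ∈ Set.Icc (-1 : ℝ) 1)
    (hgi : Integrable g lebSym) (hodd : ∀ u, g (-u) = -g u)
    (hg : ∀ u ∈ Set.Icc (-1 : ℝ) 1, 0 ≤ u * g u)
    (hgi' : Integrable g' μ) (hg' : ∀ v, 0 ≤ g' v) :
    0 ≤ ∫ p : ℝ × ℝ, genKernel l w S K a b p.1 p.2 * (g p.1 * g' p.2) ∂(lebSym.prod μ) := by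
  refine integral_nonneg_of_add_neg_fst
    (integral_genKernel ae_lebSym_mem hμ hgi hgi' hl hw0 hw hS hK hSK a b).1
    (integral_nonneg_of_ae ?_)
  filter_upwards [ae_prod_mem_Icc ae_lebSym_mem hμ] with p hp
  have h1 := mul_genKernel_sub_nonneg hl hw0 hw hS hK hSK a b hp.1 hp.2
  have h2 := mul_nonneg_of_mul_nonneg_of_mul_nonneg h1 (hg _ hp.1) (fun h => by rw [h]; simp)
  have h3 := mul_nonneg h2 (hg' p.2)
  simp only [Pi.zero_apply, hodd]
  linarith

lemma integral_genKernel_nonneg_snd (hl : 0 < l) (hw0 : 0 ≤ w) (hw : w < 1) (hS : 0 ≤ S)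
    (hK : 0 ≤ K) (hSK : S + K ≤ 1) (a b : ℕ) (hμ : ∀ᵐ u ∂μ, u ∈ Set.Icc (-1 : ℝ) 1)
    (hgi : Integrable g lebSym) (hodd : ∀ u, g (-u) = -g u)
    (hg : ∀ u ∈ Set.Icc (-1 : ℝ) 1, 0 ≤ u * g u)
    (hgi' : Integrable g' μ) (hg' : ∀ v, 0 ≤ g' v) :
    0 ≤ ∫ p : ℝ × ℝ, genKernel l w S K a b p.1 p.2 * (g' p.1 * g p.2) ∂(μ.prod lebSym) := by
  have h := integral_genKernel_nonneg_fst hl hw0 hw hK hS (by linarith) b a hμ hgi hodd hg hgi' hg'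
  rw [← integral_prod_swap]
  refine h.trans_eq (integral_congr_ae (Filter.Eventually.of_forall fun p => ?_))
  simp only [Prod.fst_swap, Prod.snd_swap]
  rw [genKernel_swap l w S K, mul_comm (g p.1)]

/-- Symmetrizing in both variables produces the mixed second difference, which has the sign of `uv`,
as does the product of the two odd weights. -/
lemma integral_genKernel_nonneg_both (hl : 0 < l) (hw0 : 0 ≤ w) (hw : w < 1) (hS : 0 ≤ S)
    (hK : 0 ≤ K) (hSK : S + K ≤ 1) (a b : ℕ)
    (hgi : Integrable g lebSym) (hodd : ∀ u, g (-u) = -g u)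
    (hg : ∀ u ∈ Set.Icc (-1 : ℝ) 1, 0 ≤ u * g u)
    (hgi' : Integrable g' lebSym) (hodd' : ∀ u, g' (-u) = -g' u)
    (hg' : ∀ u ∈ Set.Icc (-1 : ℝ) 1, 0 ≤ u * g' u) :
    0 ≤ ∫ p : ℝ × ℝ, genKernel l w S K a b p.1 p.2 * (g p.1 * g' p.2) ∂(lebSym.prod lebSym) := by
  have hi := (integral_genKernel ae_lebSym_mem ae_lebSym_mem hgi hgi' hl hw0 hw hS hK hSK a b).1
  refine integral_nonneg_of_add_neg_fst hi
    (integral_nonneg_of_add_neg_snd (integrable_add_neg_fst hi) (integral_nonneg_of_ae ?_))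
  filter_upwards [ae_prod_mem_Icc ae_lebSym_mem ae_lebSym_mem] with p hp
  have h1 := mul_genKernel_second_diff_nonneg hl hw0 hw hS hK hSK a b hp.1 hp.2
  have h2 : 0 ≤ (p.1 * p.2) * (g p.1 * g' p.2) := by
    have := mul_nonneg (hg _ hp.1) (hg' _ hp.2)
    linarith
  have h3 := mul_nonneg_of_mul_nonneg_of_mul_nonneg h1 h2 (fun h => by
    rcases mul_eq_zero.1 h with h | h <;> rw [h] <;> simp)
  simp only [Pi.zero_apply, hodd, hodd']
  linarith

end Symmetrization

/-! ### From the kernel to `Ψ` and to the Jacobi series. -/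

lemma exp_neg_half_lt_one {t : ℝ} (ht : 0 < t) : Real.exp (-(t / 2)) < 1 := by
  rw [← Real.exp_zero]
  exact Real.exp_lt_exp.2 (by linarith)

/-- The factor in front of `genKernel` in `Ψ`. -/
noncomputable def psiFactor (α β t : ℝ) : ℝ :=
  betaInv (α + 1) (β + 1) * Real.exp (-t * ((α + β + 1) / 2)) * (1 - Real.exp (-(t / 2)) ^ 2)

lemma psiFactor_nonneg {α β t : ℝ} (hα : -1 < α) (hβ : -1 < β) (ht : 0 < t) :
    0 ≤ psiFactor α β t := by
  have h := betaInv_pos (show 0 < α + 1 by linarith) (show 0 < β + 1 by linarith)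
  have hw := exp_neg_half_lt_one ht
  have : 0 ≤ 1 - Real.exp (-(t / 2)) ^ 2 := sub_nonneg.2 (pow_le_one₀ (Real.exp_pos _).le hw.le)
  unfold psiFactor
  positivity

/-- `sin (θ/2) sin (φ/2)`. -/
noncomputable def sinProd (θ φ : ℝ) : ℝ := Real.sin (θ / 2) * Real.sin (φ / 2)

/-- `cos (θ/2) cos (φ/2)`. -/
noncomputable def cosProd (θ φ : ℝ) : ℝ := Real.cos (θ / 2) * Real.cos (φ / 2)

lemma sin_cos_half_nonneg {θ : ℝ} (hθ : θ ∈ Set.Icc 0 Real.pi) :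
    0 ≤ Real.sin (θ / 2) ∧ 0 ≤ Real.cos (θ / 2) :=
  ⟨Real.sin_nonneg_of_nonneg_of_le_pi (by linarith [hθ.1]) (by linarith [hθ.1, hθ.2, Real.pi_pos]),
    Real.cos_nonneg_of_mem_Icc ⟨by linarith [hθ.1, Real.pi_pos], by linarith [hθ.2]⟩⟩

lemma sinProd_cosProd_bounds {θ φ : ℝ} (hθ : θ ∈ Set.Icc 0 Real.pi) (hφ : φ ∈ Set.Icc 0 Real.pi) :
    0 ≤ sinProd θ φ ∧ 0 ≤ cosProd θ φ ∧ sinProd θ φ + cosProd θ φ ≤ 1 := by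
  obtain ⟨h1, h2⟩ := sin_cos_half_nonneg hθ
  obtain ⟨h3, h4⟩ := sin_cos_half_nonneg hφ
  refine ⟨mul_nonneg h1 h3, mul_nonneg h2 h4, ?_⟩
  have := Real.cos_le_one (θ / 2 - φ / 2)
  rw [Real.cos_sub] at this
  unfold sinProd cosProd; linarith

/-- The kernel `genKernel` at the parameters of `Ψ`. -/
noncomputable def psiKernel (α β t θ φ : ℝ) (a b : ℕ) (u v : ℝ) : ℝ :=
  genKernel (α + 1 + (β + 1)) (Real.exp (-(t / 2))) (sinProd θ φ) (cosProd θ φ) a b u v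

/-- With `w = e^{-t/2}` one has `sinh(t/2) = (1-w²)/(2w)`, and the base of the power in `Ψ` is the
base of the kernel divided by `2w`. The powers of 2 cancel against those in `c_{α,β}`. -/
lemma jacobiPsi_eq {α β t θ φ u v : ℝ}
    (h : 0 < 1 - 2 * Real.exp (-(t / 2)) * (u * sinProd θ φ + v * cosProd θ φ) +
      Real.exp (-(t / 2)) ^ 2) :
    jacobiPsi α β t θ φ u v = psiFactor α β t * psiKernel α β t θ φ 0 0 u v := by
  have hw0 : 0 < Real.exp (-(t / 2)) := Real.exp_pos _
  have he : Real.exp (-t * ((α + β + 1) / 2)) = Real.exp (-(t / 2)) ^ (α + β + 1) := by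
    rw [← Real.exp_mul]; congr 1; ring
  have hinv : Real.exp (t / 2) = (Real.exp (-(t / 2)))⁻¹ := by rw [Real.exp_neg, inv_inv]
  have hsinh : Real.sinh (t / 2) = (1 - Real.exp (-(t / 2)) ^ 2) / (2 * Real.exp (-(t / 2))) := by
    rw [Real.sinh_eq, hinv]; field_simp
  have hbase : Real.cosh (t / 2) - 1 + jacobiQ θ φ u v =
      (1 - 2 * Real.exp (-(t / 2)) * (u * sinProd θ φ + v * cosProd θ φ) +
        Real.exp (-(t / 2)) ^ 2) / (2 * Real.exp (-(t / 2))) := by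
    rw [Real.cosh_eq, hinv, jacobiQ, sinProd, cosProd]; field_simp; ring
  rw [jacobiPsi, hbase, hsinh, psiFactor, psiKernel, genKernel, he, jacobiConst]
  set w := Real.exp (-(t / 2))
  set D := 1 - 2 * w * (u * sinProd θ φ + v * cosProd θ φ) + w ^ 2
  have h1 : (D / (2 * w)) ^ (α + β + 2) = D ^ (α + β + 2) / (2 ^ (α + β + 1) * w ^ (α + β + 1) *
      (2 * w)) := by
    rw [Real.div_rpow h.le (by positivity), ← Real.mul_rpow (by norm_num) hw0.le,
      ← Real.rpow_add_one (by positivity)]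
    congr 2; ring
  have h2 : D ^ (-(α + 1 + (β + 1) + ((0 + 0 : ℕ) : ℝ))) = (D ^ (α + β + 2))⁻¹ := by
    rw [← Real.rpow_neg h.le]; congr 1; push_cast; ring
  have h3 : 0 < D ^ (α + β + 2) := Real.rpow_pos_of_pos h _
  have h4 : 0 < (2 : ℝ) ^ (α + β + 1) := Real.rpow_pos_of_pos two_pos _
  rw [h1, h2, betaInv, show α + β + 2 = α + 1 + (β + 1) by ring] at *
  simp only [pow_zero, poch_zero, add_zero, one_mul]
  generalize Real.Gamma (α + 1) = G1
  generalize Real.Gamma (β + 1) = G2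
  field_simp

lemma isOpen_base_fst (w S K v : ℝ) :
    IsOpen {u : ℝ | 0 < 1 - 2 * w * (u * S + v * K) + w ^ 2} :=
  isOpen_lt continuous_const (by fun_prop)

lemma isOpen_base_snd (w S K u : ℝ) :
    IsOpen {v : ℝ | 0 < 1 - 2 * w * (u * S + v * K) + w ^ 2} :=
  isOpen_lt continuous_const (by fun_prop)

lemma jacobiPsiU_eq {α β t θ φ u v : ℝ}
    (h : 0 < 1 - 2 * Real.exp (-(t / 2)) * (u * sinProd θ φ + v * cosProd θ φ) +
      Real.exp (-(t / 2)) ^ 2) :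
    jacobiPsiU α β t θ φ u v = psiFactor α β t * psiKernel α β t θ φ 1 0 u v := by
  refine HasDerivAt.deriv (((hasDerivAt_genKernel_left 0 0 h).const_mul
    (psiFactor α β t)).congr_of_eventuallyEq ?_)
  filter_upwards [(isOpen_base_fst _ _ _ _).mem_nhds h] with x hx using jacobiPsi_eq hx

lemma jacobiPsiV_eq {α β t θ φ u v : ℝ}
    (h : 0 < 1 - 2 * Real.exp (-(t / 2)) * (u * sinProd θ φ + v * cosProd θ φ) +
      Real.exp (-(t / 2)) ^ 2) :
    jacobiPsiV α β t θ φ u v = psiFactor α β t * psiKernel α β t θ φ 0 1 u v := by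
  refine HasDerivAt.deriv (((hasDerivAt_genKernel_right 0 0 h).const_mul
    (psiFactor α β t)).congr_of_eventuallyEq ?_)
  filter_upwards [(isOpen_base_snd _ _ _ _).mem_nhds h] with x hx using jacobiPsi_eq hx

lemma jacobiPsiUV_eq {α β t θ φ u v : ℝ}
    (h : 0 < 1 - 2 * Real.exp (-(t / 2)) * (u * sinProd θ φ + v * cosProd θ φ) +
      Real.exp (-(t / 2)) ^ 2) :
    jacobiPsiUV α β t θ φ u v = psiFactor α β t * psiKernel α β t θ φ 1 1 u v := by
  refine HasDerivAt.deriv (((hasDerivAt_genKernel_left 0 1 h).const_mul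
    (psiFactor α β t)).congr_of_eventuallyEq ?_)
  filter_upwards [(isOpen_base_fst _ _ _ _).mem_nhds h] with x hx using jacobiPsiV_eq hx

lemma integral_eq_psiFactor_mul {μ : Measure (ℝ × ℝ)} {f h : ℝ × ℝ → ℝ} {α β t θ φ : ℝ}
    (ht : 0 < t) (hθ : θ ∈ Set.Icc 0 Real.pi) (hφ : φ ∈ Set.Icc 0 Real.pi)
    (hμ : ∀ᵐ p ∂μ, p.1 ∈ Set.Icc (-1 : ℝ) 1 ∧ p.2 ∈ Set.Icc (-1 : ℝ) 1) (hh : Integrable h μ)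
    (hf : ∀ p : ℝ × ℝ, 0 < 1 - 2 * Real.exp (-(t / 2)) * (p.1 * sinProd θ φ + p.2 * cosProd θ φ) +
      Real.exp (-(t / 2)) ^ 2 → f p = psiFactor α β t * h p) :
    Integrable f μ ∧ ∫ p, f p ∂μ = psiFactor α β t * ∫ p, h p ∂μ := by
  obtain ⟨hS, hK, hSK⟩ := sinProd_cosProd_bounds hθ hφ
  have e : f =ᵐ[μ] fun p => psiFactor α β t * h p := by
    filter_upwards [hμ] with p hp
    exact hf p (genKernel_base_pos (Real.exp_pos _).le (exp_neg_half_lt_one ht) hS hK hSK hp.1 hp.2)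
  exact ⟨(hh.const_mul _).congr e.symm, by rw [integral_congr_ae e, integral_const_mul]⟩

/-- Multiplying `∑ G_n w^{2n}` by the factor `1 - w²` in `psiFactor` gives `G_0 + ∑ (G_{n+1} - G_n)
w^{2n+2}`, the Jacobi series term by term. Only the numbers `piMoment` enter, so this serves all
ranges of `α` and `β`. -/
lemma hasSum_jacobiKernelTerm {α β t θ φ V : ℝ} (hα : -1 < α) (hβ : -1 < β)
    (h : HasSum (fun N => Real.exp (-(t / 2)) ^ N *
      gegBi (α + 1 + (β + 1)) N (sinProd θ φ) (cosProd θ φ) (piMoment α) (piMoment β)) V) :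
    HasSum (jacobiKernelTerm α β t θ φ) (psiFactor α β t * V) := by
  have ha : 0 < α + 1 := by linarith
  have hb : 0 < β + 1 := by linarith
  set w := Real.exp (-(t / 2)) with hw
  set x := Real.sin (θ / 2) ^ 2 with hx
  set y := Real.sin (φ / 2) ^ 2 with hy
  set G := gegMoment (α + 1) (β + 1) x y with hG
  have heven : ∀ n, gegBi (α + 1 + (β + 1)) (2 * n) (sinProd θ φ) (cosProd θ φ) (piMoment α)
      (piMoment β) = G n := fun n => by
    have := gegBi_even ha hb (S := sinProd θ φ) (K := cosProd θ φ) (x := x) (y := y)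
      (by rw [sinProd, hx, hy]; ring)
      (by rw [cosProd, hx, hy, ← Real.cos_sq', ← Real.cos_sq']; ring) n
    rwa [add_sub_cancel_right, add_sub_cancel_right] at this
  have h1 : HasSum (fun n => w ^ (2 * n) * G n) V := by
    rw [← (mul_right_injective₀ (two_ne_zero (α := ℕ))).hasSum_iff] at h
    · simpa only [Function.comp_def, heven] using h
    · intro N hN
      have : Odd N := by
        rw [← Nat.not_even_iff_odd]
        intro hE
        obtain ⟨m, rfl⟩ := even_iff_exists_two_mul.1 hE
        exact hN ⟨m, rfl⟩
      rw [gegBi_odd _ _ _ _ _ this, mul_zero]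
  -- The series times `w²`, shifted by one index so that it can be subtracted termwise.
  have h2 : HasSum (fun n => if n = 0 then 0 else w ^ (2 * n) * G (n - 1)) (w ^ 2 * V) := by
    rw [← hasSum_nat_add_iff' 1]
    simp only [Nat.add_eq_zero_iff, one_ne_zero, and_false, if_false, Nat.add_sub_cancel,
      Finset.range_one, Finset.sum_singleton, if_true, sub_zero]
    refine (h1.mul_left (w ^ 2)).congr_fun fun n => ?_
    rw [mul_add, pow_add]; ring
  have h3 := (h1.sub h2).mul_left
    (betaInv (α + 1) (β + 1) * Real.exp (-t * ((α + β + 1) / 2)))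
  have hexp : ∀ n : ℕ, Real.exp (-t * ((n : ℝ) + (α + β + 1) / 2)) =
      Real.exp (-t * ((α + β + 1) / 2)) * w ^ (2 * n) := by
    intro n
    rw [hw, ← Real.exp_nat_mul, ← Real.exp_add]; congr 1; push_cast; ring
  have hV : psiFactor α β t * V =
      betaInv (α + 1) (β + 1) * Real.exp (-t * ((α + β + 1) / 2)) * (V - w ^ 2 * V) := by
    rw [psiFactor]; ring
  rw [hV]
  refine h3.congr_fun fun n => ?_
  rw [jacobiKernelTerm, mul_assoc, hexp]
  rcases n with _ | n
  · rw [jacobiTrig_mul_zero hα hβ]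
    simp only [if_true, ← hx, ← hy, ← hG]; ring
  · rw [jacobiTrig_mul_succ hα hβ]
    simp only [Nat.add_eq_zero_iff, one_ne_zero, and_false, if_false, Nat.add_sub_cancel,
      ← hx, ← hy, ← hG]; ring

lemma integral_powDeriv_zero_piMeasure {ν : ℝ} (hν : -1 / 2 ≤ ν) :
    (fun i => ∫ u, powDeriv 0 u i * (1 : ℝ) ∂(piMeasure ν)) = piMoment ν := by
  funext i
  simp [powDeriv, integral_pow_piMeasure hν]

lemma integrable_piFun {ν : ℝ} (h1 : -1 < ν) (h2 : ν < -1 / 2) :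
    Integrable (fun u => -piFun ν u) lebSym := by
  have h := intervalIntegrable_piFun h1 h2
  rw [intervalIntegrable_iff_integrableOn_Icc_of_le (by norm_num)] at h
  exact Integrable.neg h

/-- The point masses supply exactly the boundary term `(1 + (-1)^i)/2` of the integration by parts.
This is why a case with `ν < -1/2` consists of a derivative term and a `dΠ_{-1/2}` term. -/
lemma integral_powDeriv_one_add {ν : ℝ} (h1 : -1 < ν) (h2 : ν < -1 / 2) :
    (fun i => (∫ u, powDeriv 1 u i * -piFun ν u ∂lebSym) +
      ∫ u, powDeriv 0 u i * (1 : ℝ) ∂(piMeasure (-1 / 2))) = piMoment ν := by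
  funext i
  have e0 := congrFun (integral_powDeriv_zero_piMeasure (le_refl (-1 / 2 : ℝ))) i
  have e1 := integral_deriv_pow_mul_piFun_of_lt h1 h2 i
  rw [intervalIntegral.integral_of_le (by norm_num), ← integral_Icc_eq_integral_Ioc] at e1
  rw [e0]
  have e2 : ∫ u, powDeriv 1 u i * -piFun ν u ∂lebSym =
      -∫ u in Set.Icc (-1 : ℝ) 1, (i * u ^ (i - 1)) * piFun ν u := by
    rw [← integral_neg, lebSym]
    congr 1
    funext u
    rw [powDeriv, Nat.descFactorial_one]; ring
  have e3 : piMoment (-1 / 2) i = (1 + (-1) ^ i) / 2 := by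
    rcases Nat.even_or_odd i with hi | hi
    · obtain ⟨m, rfl⟩ := even_iff_exists_two_mul.1 hi
      have := (poch_pos (show (0 : ℝ) < 1 / 2 by norm_num) m).ne'
      rw [hi.neg_one_pow, piMoment_two_mul, show (-1 / 2 : ℝ) + 1 = 1 / 2 by norm_num, div_self this]
      norm_num
    · rw [hi.neg_one_pow, piMoment_odd _ hi]; norm_num
  rw [e2, e1, e3]; ring

/-! ### The four parameter ranges. -/

section Cases

variable {α β t θ φ : ℝ}

lemma hasSum_jacobiKernelTerm_of_ge (hα : -1 / 2 ≤ α) (hβ : -1 / 2 ≤ β) (ht : 0 < t)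
    (hθ : θ ∈ Set.Icc 0 Real.pi) (hφ : φ ∈ Set.Icc 0 Real.pi) :
    Integrable (fun p : ℝ × ℝ => jacobiPsi α β t θ φ p.1 p.2)
        ((piMeasure α).prod (piMeasure β)) ∧
      0 ≤ ∫ p : ℝ × ℝ, jacobiPsi α β t θ φ p.1 p.2 ∂((piMeasure α).prod (piMeasure β)) ∧
      HasSum (jacobiKernelTerm α β t θ φ)
        (∫ p : ℝ × ℝ, jacobiPsi α β t θ φ p.1 p.2 ∂((piMeasure α).prod (piMeasure β))) := by
  have := isFiniteMeasure_piMeasure hα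
  have := isFiniteMeasure_piMeasure hβ
  obtain ⟨hS, hK, hSK⟩ := sinProd_cosProd_bounds hθ hφ
  have hw0 := (Real.exp_pos (-(t / 2))).le
  have hw := exp_neg_half_lt_one ht
  have hl : 0 < α + 1 + (β + 1) := by linarith
  have hc := psiFactor_nonneg (α := α) (β := β) (by linarith) (by linarith) ht
  have h1 := ae_piMeasure_mem hα
  have h2 := ae_piMeasure_mem hβ
  obtain ⟨i1, s1⟩ := integral_genKernel h1 h2 (integrable_const 1) (integrable_const 1)
    hl hw0 hw hS hK hSK 0 0
  obtain ⟨j1, e1⟩ := integral_eq_psiFactor_mul (α := α) (β := β)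
    (f := fun p => jacobiPsi α β t θ φ p.1 p.2) ht hθ hφ (ae_prod_mem_Icc h1 h2) i1
    fun p hp => by rw [jacobiPsi_eq hp, psiKernel, mul_one, mul_one]
  rw [integral_powDeriv_zero_piMeasure hα, integral_powDeriv_zero_piMeasure hβ] at s1
  rw [e1]
  exact ⟨j1, mul_nonneg hc (integral_genKernel_nonneg hl hw0 hw hS hK hSK 0 0 h1 h2
    (fun _ => zero_le_one) fun _ => zero_le_one),
    hasSum_jacobiKernelTerm (by linarith) (by linarith) s1⟩

lemma hasSum_jacobiKernelTerm_of_lt_of_ge (hα1 : -1 < α) (hα : α < -1 / 2) (hβ : -1 / 2 ≤ β)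
    (ht : 0 < t) (hθ : θ ∈ Set.Icc 0 Real.pi) (hφ : φ ∈ Set.Icc 0 Real.pi) :
    Integrable (fun p : ℝ × ℝ => -jacobiPsiU α β t θ φ p.1 p.2 * piFun α p.1)
        (lebSym.prod (piMeasure β)) ∧
      Integrable (fun p : ℝ × ℝ => jacobiPsi α β t θ φ p.1 p.2)
        ((piMeasure (-1 / 2)).prod (piMeasure β)) ∧
      0 ≤ ∫ p : ℝ × ℝ, -jacobiPsiU α β t θ φ p.1 p.2 * piFun α p.1 ∂(lebSym.prod (piMeasure β)) ∧
      0 ≤ ∫ p : ℝ × ℝ, jacobiPsi α β t θ φ p.1 p.2 ∂((piMeasure (-1 / 2)).prod (piMeasure β)) ∧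
      HasSum (jacobiKernelTerm α β t θ φ)
        ((∫ p : ℝ × ℝ, -jacobiPsiU α β t θ φ p.1 p.2 * piFun α p.1
          ∂(lebSym.prod (piMeasure β))) +
        (∫ p : ℝ × ℝ, jacobiPsi α β t θ φ p.1 p.2
          ∂((piMeasure (-1 / 2)).prod (piMeasure β)))) := by
  have := isFiniteMeasure_piMeasure (le_refl (-1 / 2 : ℝ))
  have := isFiniteMeasure_piMeasure hβ
  obtain ⟨hS, hK, hSK⟩ := sinProd_cosProd_bounds hθ hφ
  have hw0 := (Real.exp_pos (-(t / 2))).le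
  have hw := exp_neg_half_lt_one ht
  have hl : 0 < α + 1 + (β + 1) := by linarith
  have hc := psiFactor_nonneg (α := α) (β := β) (by linarith) (by linarith) ht
  have h0 := ae_piMeasure_mem (le_refl (-1 / 2 : ℝ))
  have h2 := ae_piMeasure_mem hβ
  have hg := integrable_piFun hα1 hα
  obtain ⟨i1, s1⟩ := integral_genKernel ae_lebSym_mem h2 hg (integrable_const 1)
    hl hw0 hw hS hK hSK 1 0
  obtain ⟨i2, s2⟩ := integral_genKernel h0 h2 (integrable_const 1) (integrable_const 1)
    hl hw0 hw hS hK hSK 0 0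
  obtain ⟨j1, e1⟩ := integral_eq_psiFactor_mul (α := α) (β := β)
    (f := fun p => -jacobiPsiU α β t θ φ p.1 p.2 * piFun α p.1) ht hθ hφ
    (ae_prod_mem_Icc ae_lebSym_mem h2) i1
    fun p hp => by rw [jacobiPsiU_eq hp, psiKernel]; ring
  obtain ⟨j2, e2⟩ := integral_eq_psiFactor_mul (α := α) (β := β)
    (f := fun p => jacobiPsi α β t θ φ p.1 p.2) ht hθ hφ (ae_prod_mem_Icc h0 h2) i2
    fun p hp => by rw [jacobiPsi_eq hp, psiKernel, mul_one, mul_one]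
  -- The two series share their `v`-moments; by linearity in the `u`-moments they merge into the
  -- series with moments `piMoment α`.
  have s := s1.add s2
  simp only [← mul_add, ← gegBi_add_left] at s
  rw [integral_powDeriv_one_add hα1 hα, integral_powDeriv_zero_piMeasure hβ] at s
  rw [e1, e2, ← mul_add]
  exact ⟨j1, j2, mul_nonneg hc (integral_genKernel_nonneg_fst hl hw0 hw hS hK hSK 1 0 h2 hg
      (fun u => by rw [piFun_neg]) (fun u hu => mul_neg_piFun_nonneg hα1 hα hu)
      (integrable_const 1) fun _ => zero_le_one),
    mul_nonneg hc (integral_genKernel_nonneg hl hw0 hw hS hK hSK 0 0 h0 h2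
      (fun _ => zero_le_one) fun _ => zero_le_one),
    hasSum_jacobiKernelTerm hα1 (by linarith) s⟩

lemma hasSum_jacobiKernelTerm_of_ge_of_lt (hα : -1 / 2 ≤ α) (hβ1 : -1 < β) (hβ : β < -1 / 2)
    (ht : 0 < t) (hθ : θ ∈ Set.Icc 0 Real.pi) (hφ : φ ∈ Set.Icc 0 Real.pi) :
    Integrable (fun p : ℝ × ℝ => -jacobiPsiV α β t θ φ p.1 p.2 * piFun β p.2)
        ((piMeasure α).prod lebSym) ∧
      Integrable (fun p : ℝ × ℝ => jacobiPsi α β t θ φ p.1 p.2)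
        ((piMeasure α).prod (piMeasure (-1 / 2))) ∧
      0 ≤ ∫ p : ℝ × ℝ, -jacobiPsiV α β t θ φ p.1 p.2 * piFun β p.2 ∂((piMeasure α).prod lebSym) ∧
      0 ≤ ∫ p : ℝ × ℝ, jacobiPsi α β t θ φ p.1 p.2 ∂((piMeasure α).prod (piMeasure (-1 / 2))) ∧
      HasSum (jacobiKernelTerm α β t θ φ)
        ((∫ p : ℝ × ℝ, -jacobiPsiV α β t θ φ p.1 p.2 * piFun β p.2
          ∂((piMeasure α).prod lebSym)) +
        (∫ p : ℝ × ℝ, jacobiPsi α β t θ φ p.1 p.2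
          ∂((piMeasure α).prod (piMeasure (-1 / 2))))) := by
  have := isFiniteMeasure_piMeasure (le_refl (-1 / 2 : ℝ))
  have := isFiniteMeasure_piMeasure hα
  obtain ⟨hS, hK, hSK⟩ := sinProd_cosProd_bounds hθ hφ
  have hw0 := (Real.exp_pos (-(t / 2))).le
  have hw := exp_neg_half_lt_one ht
  have hl : 0 < α + 1 + (β + 1) := by linarith
  have hc := psiFactor_nonneg (α := α) (β := β) (by linarith) (by linarith) ht
  have h0 := ae_piMeasure_mem (le_refl (-1 / 2 : ℝ))
  have h2 := ae_piMeasure_mem hα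
  have hg := integrable_piFun hβ1 hβ
  obtain ⟨i1, s1⟩ := integral_genKernel h2 ae_lebSym_mem (integrable_const 1) hg
    hl hw0 hw hS hK hSK 0 1
  obtain ⟨i2, s2⟩ := integral_genKernel h2 h0 (integrable_const 1) (integrable_const 1)
    hl hw0 hw hS hK hSK 0 0
  obtain ⟨j1, e1⟩ := integral_eq_psiFactor_mul (α := α) (β := β)
    (f := fun p => -jacobiPsiV α β t θ φ p.1 p.2 * piFun β p.2) ht hθ hφ
    (ae_prod_mem_Icc h2 ae_lebSym_mem) i1
    fun p hp => by rw [jacobiPsiV_eq hp, psiKernel]; ring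
  obtain ⟨j2, e2⟩ := integral_eq_psiFactor_mul (α := α) (β := β)
    (f := fun p => jacobiPsi α β t θ φ p.1 p.2) ht hθ hφ (ae_prod_mem_Icc h2 h0) i2
    fun p hp => by rw [jacobiPsi_eq hp, psiKernel, mul_one, mul_one]
  have s := s1.add s2
  simp only [← mul_add, ← gegBi_add_right] at s
  rw [integral_powDeriv_one_add hβ1 hβ, integral_powDeriv_zero_piMeasure hα] at s
  rw [e1, e2, ← mul_add]
  exact ⟨j1, j2, mul_nonneg hc (integral_genKernel_nonneg_snd hl hw0 hw hS hK hSK 0 1 h2 hg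
      (fun u => by rw [piFun_neg]) (fun u hu => mul_neg_piFun_nonneg hβ1 hβ hu)
      (integrable_const 1) fun _ => zero_le_one),
    mul_nonneg hc (integral_genKernel_nonneg hl hw0 hw hS hK hSK 0 0 h2 h0
      (fun _ => zero_le_one) fun _ => zero_le_one),
    hasSum_jacobiKernelTerm (by linarith) hβ1 s⟩

lemma hasSum_jacobiKernelTerm_of_lt (hα1 : -1 < α) (hα : α < -1 / 2) (hβ1 : -1 < β)
    (hβ : β < -1 / 2) (ht : 0 < t) (hθ : θ ∈ Set.Icc 0 Real.pi) (hφ : φ ∈ Set.Icc 0 Real.pi) :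
    Integrable (fun p : ℝ × ℝ => jacobiPsiUV α β t θ φ p.1 p.2 * piFun α p.1 * piFun β p.2)
        (lebSym.prod lebSym) ∧
      Integrable (fun p : ℝ × ℝ => -jacobiPsiU α β t θ φ p.1 p.2 * piFun α p.1)
        (lebSym.prod (piMeasure (-1 / 2))) ∧
      Integrable (fun p : ℝ × ℝ => -jacobiPsiV α β t θ φ p.1 p.2 * piFun β p.2)
        ((piMeasure (-1 / 2)).prod lebSym) ∧
      Integrable (fun p : ℝ × ℝ => jacobiPsi α β t θ φ p.1 p.2)
        ((piMeasure (-1 / 2)).prod (piMeasure (-1 / 2))) ∧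
      0 ≤ ∫ p : ℝ × ℝ, jacobiPsiUV α β t θ φ p.1 p.2 * piFun α p.1 * piFun β p.2
        ∂(lebSym.prod lebSym) ∧
      0 ≤ ∫ p : ℝ × ℝ, -jacobiPsiU α β t θ φ p.1 p.2 * piFun α p.1
        ∂(lebSym.prod (piMeasure (-1 / 2))) ∧
      0 ≤ ∫ p : ℝ × ℝ, -jacobiPsiV α β t θ φ p.1 p.2 * piFun β p.2
        ∂((piMeasure (-1 / 2)).prod lebSym) ∧
      0 ≤ ∫ p : ℝ × ℝ, jacobiPsi α β t θ φ p.1 p.2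
        ∂((piMeasure (-1 / 2)).prod (piMeasure (-1 / 2))) ∧
      HasSum (jacobiKernelTerm α β t θ φ)
        ((∫ p : ℝ × ℝ, jacobiPsiUV α β t θ φ p.1 p.2 * piFun α p.1 * piFun β p.2
          ∂(lebSym.prod lebSym)) +
        (∫ p : ℝ × ℝ, -jacobiPsiU α β t θ φ p.1 p.2 * piFun α p.1
          ∂(lebSym.prod (piMeasure (-1 / 2)))) +
        (∫ p : ℝ × ℝ, -jacobiPsiV α β t θ φ p.1 p.2 * piFun β p.2
          ∂((piMeasure (-1 / 2)).prod lebSym)) +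
        (∫ p : ℝ × ℝ, jacobiPsi α β t θ φ p.1 p.2
          ∂((piMeasure (-1 / 2)).prod (piMeasure (-1 / 2))))) := by
  have := isFiniteMeasure_piMeasure (le_refl (-1 / 2 : ℝ))
  obtain ⟨hS, hK, hSK⟩ := sinProd_cosProd_bounds hθ hφ
  have hw0 := (Real.exp_pos (-(t / 2))).le
  have hw := exp_neg_half_lt_one ht
  have hl : 0 < α + 1 + (β + 1) := by linarith
  have hc := psiFactor_nonneg (α := α) (β := β) (by linarith) (by linarith) ht
  have h0 := ae_piMeasure_mem (le_refl (-1 / 2 : ℝ))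
  have h1 := ae_lebSym_mem
  have hg := integrable_piFun hα1 hα
  have hg' := integrable_piFun hβ1 hβ
  obtain ⟨i1, s1⟩ := integral_genKernel h1 h1 hg hg' hl hw0 hw hS hK hSK 1 1
  obtain ⟨i2, s2⟩ := integral_genKernel h1 h0 hg (integrable_const 1) hl hw0 hw hS hK hSK 1 0
  obtain ⟨i3, s3⟩ := integral_genKernel h0 h1 (integrable_const 1) hg' hl hw0 hw hS hK hSK 0 1
  obtain ⟨i4, s4⟩ := integral_genKernel h0 h0 (integrable_const 1) (integrable_const 1)
    hl hw0 hw hS hK hSK 0 0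
  obtain ⟨j1, e1⟩ := integral_eq_psiFactor_mul (α := α) (β := β)
    (f := fun p => jacobiPsiUV α β t θ φ p.1 p.2 * piFun α p.1 * piFun β p.2) ht hθ hφ
    (ae_prod_mem_Icc h1 h1) i1 fun p hp => by rw [jacobiPsiUV_eq hp, psiKernel]; ring
  obtain ⟨j2, e2⟩ := integral_eq_psiFactor_mul (α := α) (β := β)
    (f := fun p => -jacobiPsiU α β t θ φ p.1 p.2 * piFun α p.1) ht hθ hφ
    (ae_prod_mem_Icc h1 h0) i2 fun p hp => by rw [jacobiPsiU_eq hp, psiKernel]; ring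
  obtain ⟨j3, e3⟩ := integral_eq_psiFactor_mul (α := α) (β := β)
    (f := fun p => -jacobiPsiV α β t θ φ p.1 p.2 * piFun β p.2) ht hθ hφ
    (ae_prod_mem_Icc h0 h1) i3 fun p hp => by rw [jacobiPsiV_eq hp, psiKernel]; ring
  obtain ⟨j4, e4⟩ := integral_eq_psiFactor_mul (α := α) (β := β)
    (f := fun p => jacobiPsi α β t θ φ p.1 p.2) ht hθ hφ (ae_prod_mem_Icc h0 h0) i4
    fun p hp => by rw [jacobiPsi_eq hp, psiKernel, mul_one, mul_one]
  -- Pairs with equal `v`-moments are merged first, which makes both `u`-moments those of `α`; the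
  -- two results then merge in the `v`-moments.
  have s13 := s1.add s3
  have s24 := s2.add s4
  simp only [← mul_add, ← gegBi_add_left] at s13 s24
  have s := s13.add s24
  simp only [← mul_add, ← gegBi_add_right] at s
  rw [integral_powDeriv_one_add hα1 hα, integral_powDeriv_one_add hβ1 hβ] at s
  have hs := hasSum_jacobiKernelTerm hα1 hβ1 s
  have hodd : ∀ ν u : ℝ, -piFun ν (-u) = - -piFun ν u := fun ν u => by rw [piFun_neg]
  rw [e1, e2, e3, e4]
  refine ⟨j1, j2, j3, j4, mul_nonneg hc (integral_genKernel_nonneg_both hl hw0 hw hS hK hSK 1 1 hg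
      (hodd α) (fun u hu => mul_neg_piFun_nonneg hα1 hα hu) hg'
      (hodd β) (fun u hu => mul_neg_piFun_nonneg hβ1 hβ hu)),
    mul_nonneg hc (integral_genKernel_nonneg_fst hl hw0 hw hS hK hSK 1 0 h0 hg
      (hodd α) (fun u hu => mul_neg_piFun_nonneg hα1 hα hu)
      (integrable_const 1) fun _ => zero_le_one),
    mul_nonneg hc (integral_genKernel_nonneg_snd hl hw0 hw hS hK hSK 0 1 h0 hg'
      (hodd β) (fun u hu => mul_neg_piFun_nonneg hβ1 hβ hu)
      (integrable_const 1) fun _ => zero_le_one),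
    mul_nonneg hc (integral_genKernel_nonneg hl hw0 hw hS hK hSK 0 0 h0 h0
      (fun _ => zero_le_one) fun _ => zero_le_one), ?_⟩
  convert hs using 1
  ring

end Cases

theorem mainTheorem2 (α β t θ φ : ℝ) (hα : -1 < α) (hβ : -1 < β) (ht : 0 < t)
    (hθ : θ ∈ Set.Icc 0 Real.pi) (hφ : φ ∈ Set.Icc 0 Real.pi) :
    Summable (jacobiKernelTerm α β t θ φ) ∧
    (-1 / 2 ≤ α → -1 / 2 ≤ β →
      Integrable (fun p : ℝ × ℝ => jacobiPsi α β t θ φ p.1 p.2)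
        ((piMeasure α).prod (piMeasure β)) ∧
      0 ≤ ∫ p : ℝ × ℝ, jacobiPsi α β t θ φ p.1 p.2 ∂((piMeasure α).prod (piMeasure β)) ∧
      jacobiKernel α β t θ φ =
        (∫ p : ℝ × ℝ, jacobiPsi α β t θ φ p.1 p.2
          ∂((piMeasure α).prod (piMeasure β)))) ∧
    (α < -1 / 2 → -1 / 2 ≤ β →
      Integrable (fun p : ℝ × ℝ => -jacobiPsiU α β t θ φ p.1 p.2 * piFun α p.1)
        (lebSym.prod (piMeasure β)) ∧
      Integrable (fun p : ℝ × ℝ => jacobiPsi α β t θ φ p.1 p.2)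
        ((piMeasure (-1 / 2)).prod (piMeasure β)) ∧
      0 ≤ ∫ p : ℝ × ℝ, -jacobiPsiU α β t θ φ p.1 p.2 * piFun α p.1 ∂(lebSym.prod (piMeasure β)) ∧
      0 ≤ ∫ p : ℝ × ℝ, jacobiPsi α β t θ φ p.1 p.2 ∂((piMeasure (-1 / 2)).prod (piMeasure β)) ∧
      jacobiKernel α β t θ φ =
        (∫ p : ℝ × ℝ, -jacobiPsiU α β t θ φ p.1 p.2 * piFun α p.1
          ∂(lebSym.prod (piMeasure β))) +
        (∫ p : ℝ × ℝ, jacobiPsi α β t θ φ p.1 p.2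
          ∂((piMeasure (-1 / 2)).prod (piMeasure β)))) ∧
    (-1 / 2 ≤ α → β < -1 / 2 →
      Integrable (fun p : ℝ × ℝ => -jacobiPsiV α β t θ φ p.1 p.2 * piFun β p.2)
        ((piMeasure α).prod lebSym) ∧
      Integrable (fun p : ℝ × ℝ => jacobiPsi α β t θ φ p.1 p.2)
        ((piMeasure α).prod (piMeasure (-1 / 2))) ∧
      0 ≤ ∫ p : ℝ × ℝ, -jacobiPsiV α β t θ φ p.1 p.2 * piFun β p.2 ∂((piMeasure α).prod lebSym) ∧
      0 ≤ ∫ p : ℝ × ℝ, jacobiPsi α β t θ φ p.1 p.2 ∂((piMeasure α).prod (piMeasure (-1 / 2))) ∧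
      jacobiKernel α β t θ φ =
        (∫ p : ℝ × ℝ, -jacobiPsiV α β t θ φ p.1 p.2 * piFun β p.2
          ∂((piMeasure α).prod lebSym)) +
        (∫ p : ℝ × ℝ, jacobiPsi α β t θ φ p.1 p.2
          ∂((piMeasure α).prod (piMeasure (-1 / 2))))) ∧
    (α < -1 / 2 → β < -1 / 2 →
      Integrable (fun p : ℝ × ℝ => jacobiPsiUV α β t θ φ p.1 p.2 * piFun α p.1 * piFun β p.2)
        (lebSym.prod lebSym) ∧
      Integrable (fun p : ℝ × ℝ => -jacobiPsiU α β t θ φ p.1 p.2 * piFun α p.1)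
        (lebSym.prod (piMeasure (-1 / 2))) ∧
      Integrable (fun p : ℝ × ℝ => -jacobiPsiV α β t θ φ p.1 p.2 * piFun β p.2)
        ((piMeasure (-1 / 2)).prod lebSym) ∧
      Integrable (fun p : ℝ × ℝ => jacobiPsi α β t θ φ p.1 p.2)
        ((piMeasure (-1 / 2)).prod (piMeasure (-1 / 2))) ∧
      0 ≤ ∫ p : ℝ × ℝ, jacobiPsiUV α β t θ φ p.1 p.2 * piFun α p.1 * piFun β p.2
        ∂(lebSym.prod lebSym) ∧
      0 ≤ ∫ p : ℝ × ℝ, -jacobiPsiU α β t θ φ p.1 p.2 * piFun α p.1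
        ∂(lebSym.prod (piMeasure (-1 / 2))) ∧
      0 ≤ ∫ p : ℝ × ℝ, -jacobiPsiV α β t θ φ p.1 p.2 * piFun β p.2
        ∂((piMeasure (-1 / 2)).prod lebSym) ∧
      0 ≤ ∫ p : ℝ × ℝ, jacobiPsi α β t θ φ p.1 p.2
        ∂((piMeasure (-1 / 2)).prod (piMeasure (-1 / 2))) ∧
      jacobiKernel α β t θ φ =
        (∫ p : ℝ × ℝ, jacobiPsiUV α β t θ φ p.1 p.2 * piFun α p.1 * piFun β p.2
          ∂(lebSym.prod lebSym)) +
        (∫ p : ℝ × ℝ, -jacobiPsiU α β t θ φ p.1 p.2 * piFun α p.1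
          ∂(lebSym.prod (piMeasure (-1 / 2)))) +
        (∫ p : ℝ × ℝ, -jacobiPsiV α β t θ φ p.1 p.2 * piFun β p.2
          ∂((piMeasure (-1 / 2)).prod lebSym)) +
        (∫ p : ℝ × ℝ, jacobiPsi α β t θ φ p.1 p.2
          ∂((piMeasure (-1 / 2)).prod (piMeasure (-1 / 2))))) := by
  refine ⟨?_, fun h1 h2 => ?_, fun h1 h2 => ?_, fun h1 h2 => ?_, fun h1 h2 => ?_⟩
  · rcases le_or_gt (-1 / 2) α with h1 | h1 <;> rcases le_or_gt (-1 / 2) β with h2 | h2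
    · exact (hasSum_jacobiKernelTerm_of_ge h1 h2 ht hθ hφ).2.2.summable
    · exact (hasSum_jacobiKernelTerm_of_ge_of_lt h1 hβ h2 ht hθ hφ).2.2.2.2.summable
    · exact (hasSum_jacobiKernelTerm_of_lt_of_ge hα h1 h2 ht hθ hφ).2.2.2.2.summable
    · exact (hasSum_jacobiKernelTerm_of_lt hα h1 hβ h2 ht hθ hφ).2.2.2.2.2.2.2.2.summable
  · obtain ⟨i1, p1, s⟩ := hasSum_jacobiKernelTerm_of_ge h1 h2 ht hθ hφ
    exact ⟨i1, p1, s.tsum_eq⟩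
  · obtain ⟨i1, i2, p1, p2, s⟩ := hasSum_jacobiKernelTerm_of_lt_of_ge hα h1 h2 ht hθ hφ
    exact ⟨i1, i2, p1, p2, s.tsum_eq⟩
  · obtain ⟨i1, i2, p1, p2, s⟩ := hasSum_jacobiKernelTerm_of_ge_of_lt h1 hβ h2 ht hθ hφ
    exact ⟨i1, i2, p1, p2, s.tsum_eq⟩
  · obtain ⟨i1, i2, i3, i4, p1, p2, p3, p4, s⟩ :=
      hasSum_jacobiKernelTerm_of_lt hα h1 hβ h2 ht hθ hφ
    exact ⟨i1, i2, i3, i4, p1, p2, p3, p4, s.tsum_eq⟩
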